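/- **Model.** Let $K_1,K_2,\hat G,G,U\ge 0$ be integers, $K=K_1+K_2+1$, with $\hat G+2U\le G\le\min\{K_1,K_2\}$ and $2(2\hat G+U)<K$. Sub-carriers are $\mathcal K=\{-K_1,\dots,K_2\}$; put $\mathcal G=\{-G,\dots,G\}$, $\hat{\mathcal G}=\{-\hat G,\dots,\hat G\}$, $\mathcal U=\{-U,\dots,U\}$. Data $x_k$ are sent on $k\in\mathcal K\setminus\mathcal G$ and a fixed reference signal (RS) $p_g\in\mathbb C$ on $g\in\hat{\mathcal G}$ ($p_a=0$ for $|a|>\hat G$, $E_{\rm r}=\sum_g|p_g|^2$). Let $\beta_k\in\mathbb C$ be the channel gains, $\bar\beta=\max_{k\in\mathcal K}|\beta_k|$, $E_{\rm d},N_0>0$. The received samples, $0\le n<K$, are $$s[n]=\Big[\sum_{g\in\hat{\mathcal G}}\beta_0p_ge^{j2\pi gn/K}+\sum_{k\in\mathcal K\setminus\mathcal G}\beta_kx_ke^{j2\pi kn/K}\Big]e^{j\theta[n]}+w[n],$$ where the phase noise $\theta[n]$ is an arbitrary real random process, $w[n]$ are i.i.d. $\mathcal{CN}(0,N_0K)$,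 the $x_k$ are independent with $\mathbb E x_k=0$, $\mathbb E|x_k|^2=E_{\rm d}$, and $\theta$, $w$, $x$ are mutually independent. For $k\in\mathbb Z$ let $Y_k,\Omega_k,W_k$ be the coefficients $\frac1K\sum_n(\cdot)e^{-j2\pi kn/K}$ of $s[n]$, $e^{j\theta[n]}$, $w[n]$. Let $\mu(a,b)=\sum_{c=a-b}^{a+b}\mathbb E|\Omega_c|^2$. **Estimation and compensation.** Let $\mathbf P=(p_{v-u})_{|v|\le\hat G+U,\,u\in\mathcal U}$, $\mathbf Q=(p_{v-g})_{|v|\le\hat G+U,\,U<|g|\le2\hat G+U}$, $\mathbf R_p=\mathbf P^\dagger\mathbf P$ (assumed invertible), $\boldsymbol\Omega^{(U)}=(\Omega_u)_{u\in\mathcal U}$, $\boldsymbol\Omega^{\rm (inf)}=(\Omega_g)_{U<|g|\le2\hat G+U}$, $\mathbf L=\mathbf R_p^{-1}\mathbf P^\dagger\mathbf Q\boldsymbol\Omega^{\rm (inf)}$, and let $\Upsilon_p$ be the largest eigenvalue of $\mathbf Q^\dagger\mathbf P\mathbf R_p^{-2}\mathbf P^\dagger\mathbf Q$ ($\Upsilon_p=0$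 if $\hat G=0$). The leakage of data into the sub-carriers used for estimation is neglected, i.e. the estimate of $\beta_0\boldsymbol\Omega^{(U)}$ is the least-squares one, $\hat{\mathbf b}=\mathbf R_p^{-1}\mathbf P^\dagger\big(\beta_0\sum_gp_g\Omega_{v-g}+W_v\big)_{|v|\le\hat G+U}$. Put $\chi=\mathbb E\{\boldsymbol\Omega^{(U)\dagger}\mathbf L\}/\mu(0,U)$ ($\chi=0$ if $\mu(0,U)=0$), $\boldsymbol\Phi=\mathbf L-\chi\boldsymbol\Omega^{(U)}$, $\hat{\mathbf W}=\mathbf R_p^{-1}\mathbf P^\dagger(W_v)_{|v|\le\hat G+U}$, $c_u=(1+\chi^*)\Omega_u^*+\Phi_u^*$. The compensated output is $\hat Y_k=\sum_{u\in\mathcal U}\hat b_u^*Y_{k+u}$. **Claim.** Let $k\in\mathcal K\setminus\mathcal G$. Then $\hat Y_k=\hat S_k+\hat I_k+\hat Z_k$ with $\hat I_k=\hat I_k^{(1)}+\hat I_k^{(2)}$, $\hat Z_k=\sum_{j=1}^4\hat Z_k^{(j)}$, where $$\hat S_k=\beta_0^*\beta_kx_k(1+\chi^*)\mu(0,U),\qquad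 \hat I^{(1)}_k=\sum_{u\in\mathcal U}\sum_{g\in\hat{\mathcal G}}|\beta_0|^2c_up_g\Omega_{k+u-g},$$ $$\hat I^{(2)}_k=\sum_{u\in\mathcal U}\sum_{\bar k\in\mathcal K\setminus(\mathcal G\cup\{k\})}\beta_0^*\beta_{\bar k}x_{\bar k}c_u\Omega_{k+u-\bar k}+\beta_0^*\beta_kx_k\Big[\sum_{u\in\mathcal U}c_u\Omega_u-(1+\chi^*)\mu(0,U)\Big],$$ $$\hat Z^{(1)}_k=\sum_{u\in\mathcal U}\sum_{g\in\hat{\mathcal G}}\hat W_u^*\beta_0p_g\Omega_{k+u-g},\quad \hat Z^{(2)}_k=\sum_{u\in\mathcal U}\sum_{\bar k\in\mathcal K\setminus\mathcal G}\hat W_u^*\beta_{\bar k}x_{\bar k}\Omega_{k+u-\bar k},$$ $$\hat Z^{(3)}_k=\sum_{u\in\mathcal U}\beta_0^*c_uW_{k+u},\quad \hat Z^{(4)}_k=\sum_{u\in\mathcal U}\hat W_u^*W_{k+u}.$$ All these components are square integrable, $\mathbb E|\hat S_k|^2=|\beta_0\beta_k|^2E_{\rm d}|1+\chi|^2\mu(0,U)^2$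 and, with $B=(1+\chi+\chi^*)\mu(0,U)+\Upsilon_p[\mu(0,2\hat G+U)-\mu(0,U)]$, $$\mathbb E|\hat I_k^{(1)}|^2\le\bar\sigma^2_{\hat I_k^{(1)}}=\sum_{g\in\hat{\mathcal G}}(1+\Upsilon_p)E_{\rm r}|\beta_0|^4\mu(k-g,U),$$ $$\mathbb E|\hat I_k^{(2)}|^2\le\bar\sigma^2_{\hat I_k^{(2)}}=|\beta_0\bar\beta|^2E_{\rm d}\big[B-|1+\chi|^2\mu(0,U)^2\big],$$ $$\mathbb E|\hat Z_k^{(1)}|^2\le\bar\sigma^2_{\hat Z_k^{(1)}}=\mu(k,\hat G+U)(2U+1)|\beta_0|^2N_0,\quad \mathbb E|\hat Z_k^{(2)}|^2\le\bar\sigma^2_{\hat Z_k^{(2)}}={\rm Tr}\{\mathbf R_p^{-1}\}N_0\bar\beta^2E_{\rm d},$$ $$\mathbb E|\hat Z_k^{(3)}|^2\le\bar\sigma^2_{\hat Z_k^{(3)}}=|\beta_0|^2BN_0,\quad \mathbb E|\hat Z_k^{(4)}|^2\le\bar\sigma^2_{\hat Z_k^{(4)}}={\rm Tr}\{\mathbf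 R_p^{-1}\}N_0^2.$$ Moreover $\mathbb E|\hat I_k+\hat Z_k|^2>0$, and the SINR after compensation satisfies $$\frac{\mathbb E|\hat S_k|^2}{\mathbb E|\hat I_k+\hat Z_k|^2}\ \ge\ \Gamma_k^{\rm LB}(\boldsymbol\beta)=\frac{|\beta_0\beta_k|^2E_{\rm d}|1+\chi|^2\mu(0,U)^2}{\sum_{i=1}^2\bar\sigma^2_{\hat I_k^{(i)}}+\sum_{j=1}^4\bar\sigma^2_{\hat Z_k^{(j)}}}.$$ If moreover the signalling is Gaussian, $x_k\sim\mathcal{CN}(0,E_{\rm d})$ for all $k\in\mathcal K\setminus\mathcal G$, then the achievable throughput with independent demodulation of each sub-carrier satisfies $$C(\boldsymbol\beta)=\frac1K\sum_{k\in\mathcal K\setminus\mathcal G}\big[\mathscr H(x_k)-\mathscr H(x_k\,|\,\hat Y_k,\hat{\mathbf b})\big]\ \ge\ \frac1K\sum_{k\in\mathcal K\setminus\mathcal G}\log\big(1+\Gamma_k^{\rm LB}(\boldsymbol\beta)\big),$$ where $\mathscr H$ is the (conditional) differential entropy, in nats, as an extended real number. The sum over $\mathcal K\setminus\mathcal G$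 divided by $K$ accounts for the RS overhead. -/

import Mathlib

open MeasureTheory ProbabilityTheory Matrix
open scoped ComplexConjugate BigOperators

noncomputable section

/-! ### Circularly symmetric Gaussian law and differential entropy on `ℂ` -/

/-- The circularly symmetric complex Gaussian law `CN(0, v)`: independent real and imaginary parts,
each `N(0, v/2)`. -/
def complexGaussian (v : ℝ) : Measure ℂ :=
  ((gaussianReal 0 (v / 2).toNNReal).prod (gaussianReal 0 (v / 2).toNNReal)).map
    Complex.measurableEquivRealProd.symm

/-- The integral `∫ f dμ = ∫ f⁺ dμ - ∫ f⁻ dμ` as an extended real number. -/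
def extIntegral {α : Type*} [MeasurableSpace α] (f : α → ℝ) (μ : Measure α) : EReal :=
  ((∫⁻ a, ENNReal.ofReal (f a) ∂μ : ENNReal) : EReal) -
    ((∫⁻ a, ENNReal.ofReal (-f a) ∂μ : ENNReal) : EReal)

open Classical in
/-- Differential entropy `H(X) = -∫ f log f` (in nats), `f` the Lebesgue density of `X`;
it is `-∞` if `X` has no density. -/
def diffEntropy {Ω : Type*} [MeasurableSpace Ω] (X : Ω → ℂ) (P : Measure Ω) : EReal :=
  if P.map X ≪ volume then
    extIntegral (fun z => -llr (P.map X) volume z) (P.map X)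
  else ⊥

open Classical in
/-- Conditional differential entropy `H(X | Y) = -E[log f(X | Y)]` (in nats). The conditional
density `f(x | y)` is the density of the joint law of `(X, Y)` with respect to the product of
Lebesgue measure and the law of `Y`; the value is `-∞` if there is no conditional density. -/
def condDiffEntropy {Ω β : Type*} [MeasurableSpace Ω] [MeasurableSpace β]
    (X : Ω → ℂ) (Y : Ω → β) (P : Measure Ω) : EReal :=
  if P.map (fun ω => (X ω, Y ω)) ≪ (volume : Measure ℂ).prod (P.map Y) then
    extIntegral
      (fun z => -llr (P.map (fun ω => (X ω, Y ω))) ((volume : Measure ℂ).prod (P.map Y)) z)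
      (P.map (fun ω => (X ω, Y ω)))
  else ⊥

/-! ### System parameters -/

/-- The integers `-n, …, n`. -/
abbrev symIcc (n : ℕ) : Finset ℤ := Finset.Icc (-(n : ℤ)) (n : ℤ)

/-- Deterministic parameters. Sub-carriers are `-K₁, …, K₂`; those in `{-G, …, G}` carry no data;
the reference signal `p` lives on `{-Ghat, …, Ghat}`; the phase-noise coefficients with index in
`{-U, …, U}` are estimated; `β k` is the effective channel gain of sub-carrier `k`; `Ed` is the
energy of a data symbol; `N₀` is the noise power spectral density. -/
structure OFDM where
  K₁ : ℕ
  K₂ : ℕ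
  Ghat : ℕ
  G : ℕ
  U : ℕ
  p : ℤ → ℂ
  β : ℤ → ℂ
  Ed : ℝ
  N₀ : ℝ

namespace OFDM

variable (S : OFDM)

/-- The number of sub-carriers. -/
def K : ℕ := S.K₁ + S.K₂ + 1

/-- All sub-carriers. -/
def carriers : Finset ℤ := Finset.Icc (-(S.K₁ : ℤ)) (S.K₂ : ℤ)

/-- The data sub-carriers. -/
def dataIdx : Finset ℤ := S.carriers \ symIcc S.G

/-- The index set `{g : U < |g| ≤ 2 Ghat + U}` of the non-estimated phase-noise coefficients that
disturb the estimation. -/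
def infIdx : Finset ℤ := symIcc (2 * S.Ghat + S.U) \ symIcc S.U

/-- The energy of the reference signal. -/
def Er : ℝ := ∑ g ∈ symIcc S.Ghat, ‖S.p g‖ ^ 2

/-- `max_k |β_k|` over all sub-carriers. -/
def betaBar : ℝ := ⨆ k : S.carriers, ‖S.β k‖

/-- The banded Toeplitz matrix `P`, rows `|v| ≤ Ghat + U`, columns `|u| ≤ U`. -/
def Pmat : Matrix (symIcc (S.Ghat + S.U)) (symIcc S.U) ℂ :=
  Matrix.of fun v u => S.p ((v : ℤ) - (u : ℤ))

/-- The Toeplitz matrix `Q`, rows `|v| ≤ Ghat + U`, columns `U < |g| ≤ 2 Ghat + U`. -/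
def Qmat : Matrix (symIcc (S.Ghat + S.U)) S.infIdx ℂ :=
  Matrix.of fun v g => S.p ((v : ℤ) - (g : ℤ))

/-- `R_p = Pᴴ P`. -/
def Rp : Matrix (symIcc S.U) (symIcc S.U) ℂ := S.Pmatᴴ * S.Pmat

/-- The matrix `Qᴴ P R_p⁻² Pᴴ Q`. -/
def upsilonMat : Matrix S.infIdx S.infIdx ℂ :=
  S.Qmatᴴ * (S.Pmat * (S.Rp⁻¹ * S.Rp⁻¹) * S.Pmatᴴ) * S.Qmat

theorem upsilonMat_isHermitian : S.upsilonMat.IsHermitian := by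
  have hR : (S.Rp⁻¹)ᴴ = S.Rp⁻¹ :=
    (Matrix.isHermitian_conjTranspose_mul_self S.Pmat).inv
  unfold upsilonMat Matrix.IsHermitian
  simp only [Matrix.conjTranspose_mul, Matrix.conjTranspose_conjTranspose, hR, Matrix.mul_assoc]

/-- `Υ_p`, the largest eigenvalue of `Qᴴ P R_p⁻² Pᴴ Q` (and `0` if that matrix is empty, which
happens for `Ghat = 0`). -/
def Upsilon : ℝ := ⨆ i, S.upsilonMat_isHermitian.eigenvalues i

/-- Standing assumptions on the parameters. -/
structure Admissible : Prop where
  guard : S.Ghat + 2 * S.U ≤ S.G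
  lower : S.G ≤ S.K₁
  upper : S.G ≤ S.K₂
  /-- the phase-noise coefficients `|g| ≤ 2 Ghat + U` belong to distinct sub-carriers -/
  distinct : 2 * (2 * S.Ghat + S.U) < S.K
  /-- the reference signal is supported on `{-Ghat, …, Ghat}` -/
  p_support : ∀ g : ℤ, (S.Ghat : ℤ) < |g| → S.p g = 0
  /-- `R_p` has full rank -/
  fullRank : IsUnit S.Rp.det
  Ed_pos : 0 < S.Ed
  N₀_pos : 0 < S.N₀

/-- The sampled sub-carrier `e^{j 2π k n / K}`. -/
def tone (k : ℤ) (n : Fin S.K) : ℂ :=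
  Complex.exp (2 * Real.pi * Complex.I * (k : ℂ) * (n : ℂ) / (S.K : ℂ))

/-- Normalised DFT coefficient `(1/K) ∑ₙ f[n] e^{-j 2π k n / K}`, for every integer `k`. -/
def nDFT (f : Fin S.K → ℂ) (k : ℤ) : ℂ :=
  (1 / (S.K : ℂ)) * ∑ n, f n * S.tone (-k) n

end OFDM

/-! ### Random signals -/

/-- The random quantities: phase noise `θ[n]`, channel noise `w[n]` and data symbols `x_k`
(only the values `x k` at data sub-carriers `k` are used). -/
structure Signals (S : OFDM) (Ω : Type*) where
  θ : Fin S.K → Ω → ℝ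
  w : Fin S.K → Ω → ℂ
  x : ℤ → Ω → ℂ

namespace Signals

variable {S : OFDM} {Ω : Type*} [MeasurableSpace Ω] (T : Signals S Ω) (P : Measure Ω)

/-- Stochastic assumptions: `θ` is an arbitrary process; the `w[n]` are i.i.d. `CN(0, N₀ K)`; the
data are independent, zero mean, of energy `Ed`; phase noise, channel noise and data are mutually
independent. -/
structure Lawful : Prop where
  meas_θ : ∀ n, Measurable (T.θ n)
  meas_w : ∀ n, Measurable (T.w n)
  meas_x : ∀ k ∈ S.dataIdx, Measurable (T.x k)
  law_w : ∀ n, P.map (T.w n) = complexGaussian (S.N₀ * S.K)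
  indep_w : iIndepFun T.w P
  sq_x : ∀ k ∈ S.dataIdx, MemLp (T.x k) 2 P
  mean_x : ∀ k ∈ S.dataIdx, ∫ ω, T.x k ω ∂P = 0
  energy_x : ∀ k ∈ S.dataIdx, ∫ ω, ‖T.x k ω‖ ^ 2 ∂P = S.Ed
  indep_x : iIndepFun (fun (k : S.dataIdx) => T.x (k : ℤ)) P
  indep_θ_wx : IndepFun (fun ω n => T.θ n ω)
    (fun ω => ((fun n => T.w n ω), (fun k : S.dataIdx => T.x (k : ℤ) ω))) P
  indep_w_x : IndepFun (fun ω n => T.w n ω) (fun ω (k : S.dataIdx) => T.x (k : ℤ) ω) P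

/-- Gaussian signalling: every data symbol has law `CN(0, Ed)`. -/
def GaussianData : Prop := ∀ k ∈ S.dataIdx, P.map (T.x k) = complexGaussian S.Ed

/-! #### Receiver -/

/-- Phase-noise nDFT coefficient `Ω_k`. -/
def Om (k : ℤ) (ω : Ω) : ℂ := S.nDFT (fun n => Complex.exp (Complex.I * (T.θ n ω : ℂ))) k

/-- Channel-noise nDFT coefficient `W_k`. -/
def W (k : ℤ) (ω : Ω) : ℂ := S.nDFT (fun n => T.w n ω) k

/-- The reference-signal part of the noiseless sampled base-band signal, before phase noise. -/
def refPart (n : Fin S.K) : ℂ := ∑ g ∈ symIcc S.Ghat, S.β 0 * S.p g * S.tone g n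

/-- The data part of the noiseless sampled base-band signal, before phase noise. -/
def dataPart (n : Fin S.K) (ω : Ω) : ℂ := ∑ k ∈ S.dataIdx, S.β k * T.x k ω * S.tone k n

/-- Demodulated sub-carrier output `Y_k`. -/
def Y (k : ℤ) (ω : Ω) : ℂ :=
  S.nDFT (fun n => (refPart n + T.dataPart n ω) * Complex.exp (Complex.I * (T.θ n ω : ℂ))
    + T.w n ω) k

/-- Sub-carrier output used for phase-noise estimation: the leakage of the data sub-carriers into
it is neglected. -/
def Yref (v : ℤ) (ω : Ω) : ℂ :=
  S.nDFT (fun n => refPart n * Complex.exp (Complex.I * (T.θ n ω : ℂ)) + T.w n ω) v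

/-- Least-squares estimate `R_p⁻¹ Pᴴ Y` of `β₀ (Ω_u)_{|u| ≤ U}`. -/
def est (ω : Ω) : symIcc S.U → ℂ :=
  (S.Rp⁻¹ * S.Pmatᴴ) *ᵥ (fun v : symIcc (S.Ghat + S.U) => T.Yref (v : ℤ) ω)

/-- Output of sub-carrier `k` after phase-noise compensation. -/
def Yhat (k : ℤ) (ω : Ω) : ℂ := ∑ u : symIcc S.U, conj (T.est ω u) * T.Y (k + (u : ℤ)) ω

/-! #### Phase-noise statistics -/

/-- `Δ_{k₁,k₂} = E[Ω_{k₁} Ω_{k₂}^*]`. -/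
def Delta (k₁ k₂ : ℤ) : ℂ := ∫ ω, T.Om k₁ ω * conj (T.Om k₂ ω) ∂P

/-- `μ(a, b) = ∑_{c=a-b}^{a+b} Δ_{c,c}` (the numbers `Δ_{c,c}` are real). -/
def mu (a : ℤ) (b : ℕ) : ℝ := ∑ c ∈ Finset.Icc (a - b) (a + b), (T.Delta P c c).re

/-- The vector `R_p⁻¹ Pᴴ Q Ω^(inf)`. -/
def leak (ω : Ω) : symIcc S.U → ℂ :=
  (S.Rp⁻¹ * S.Pmatᴴ * S.Qmat) *ᵥ (fun g : S.infIdx => T.Om (g : ℤ) ω)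

/-- `χ = E[(Ω^(U))ᴴ R_p⁻¹ Pᴴ Q Ω^(inf)] / μ(0, U)`. -/
def chi : ℂ :=
  (∫ ω, ∑ u : symIcc S.U, conj (T.Om (u : ℤ) ω) * T.leak ω u ∂P) / (T.mu P 0 S.U : ℂ)

/-- `Φ_u`, the component of the leakage that is uncorrelated with the wanted coefficients. -/
def Phi (u : symIcc S.U) (ω : Ω) : ℂ := T.leak ω u - T.chi P * T.Om (u : ℤ) ω

/-- The estimation noise `R_p⁻¹ Pᴴ W`. -/
def What (u : symIcc S.U) (ω : Ω) : ℂ :=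
  ((S.Rp⁻¹ * S.Pmatᴴ) *ᵥ (fun v : symIcc (S.Ghat + S.U) => T.W (v : ℤ) ω)) u

/-- `(1 + χ^*) Ω_u^* + Φ_u^*`. -/
def coef (u : symIcc S.U) (ω : Ω) : ℂ :=
  (1 + conj (T.chi P)) * conj (T.Om (u : ℤ) ω) + conj (T.Phi P u ω)

/-! #### Signal, interference and noise components -/

def Shat (k : ℤ) (ω : Ω) : ℂ :=
  ∑ u : symIcc S.U, conj (S.β 0) * S.β k * T.x k ω * (1 + conj (T.chi P)) *
    ((∫ ω', ‖T.Om (u : ℤ) ω'‖ ^ 2 ∂P : ℝ) : ℂ)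

def I1 (k : ℤ) (ω : Ω) : ℂ :=
  ∑ u : symIcc S.U, ∑ g ∈ symIcc S.Ghat,
    ((‖S.β 0‖ ^ 2 : ℝ) : ℂ) * T.coef P u ω * S.p g * T.Om (k + (u : ℤ) - g) ω

def I2 (k : ℤ) (ω : Ω) : ℂ :=
  (∑ u : symIcc S.U, ∑ l ∈ S.dataIdx.erase k,
    conj (S.β 0) * S.β l * T.x l ω * T.coef P u ω * T.Om (k + (u : ℤ) - l) ω)
  + conj (S.β 0) * S.β k * T.x k ω *
    ((∑ u : symIcc S.U, T.coef P u ω * T.Om (u : ℤ) ω)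
      - (1 + conj (T.chi P)) * (T.mu P 0 S.U : ℂ))

def Z1 (k : ℤ) (ω : Ω) : ℂ :=
  ∑ u : symIcc S.U, ∑ g ∈ symIcc S.Ghat,
    conj (T.What u ω) * S.β 0 * S.p g * T.Om (k + (u : ℤ) - g) ω

def Z2 (k : ℤ) (ω : Ω) : ℂ :=
  ∑ u : symIcc S.U, ∑ l ∈ S.dataIdx,
    conj (T.What u ω) * S.β l * T.x l ω * T.Om (k + (u : ℤ) - l) ω

def Z3 (k : ℤ) (ω : Ω) : ℂ :=
  ∑ u : symIcc S.U, conj (S.β 0) * T.coef P u ω * T.W (k + (u : ℤ)) ω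

def Z4 (k : ℤ) (ω : Ω) : ℂ :=
  ∑ u : symIcc S.U, conj (T.What u ω) * T.W (k + (u : ℤ)) ω

/-- The interference component. -/
def Ihat (k : ℤ) (ω : Ω) : ℂ := T.I1 P k ω + T.I2 P k ω

/-- The noise component. -/
def Zhat (k : ℤ) (ω : Ω) : ℂ := T.Z1 k ω + T.Z2 k ω + T.Z3 P k ω + T.Z4 k ω

/-- The post-compensation SINR of sub-carrier `k`. -/
def SINR (k : ℤ) : ℝ :=
  (∫ ω, ‖T.Shat P k ω‖ ^ 2 ∂P) / (∫ ω, ‖T.Ihat P k ω + T.Zhat P k ω‖ ^ 2 ∂P)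

/-! #### Second-moment bounds, SINR bound and throughput -/

/-- `(1 + χ + χ^*) μ(0,U) + Υ_p (μ(0, 2 Ghat + U) - μ(0,U))`. -/
def coefEnergyBound : ℝ :=
  (1 + 2 * (T.chi P).re) * T.mu P 0 S.U
    + S.Upsilon * (T.mu P 0 (2 * S.Ghat + S.U) - T.mu P 0 S.U)

def signalEnergy (k : ℤ) : ℝ :=
  ‖S.β 0 * S.β k‖ ^ 2 * S.Ed * ‖1 + T.chi P‖ ^ 2 * (T.mu P 0 S.U) ^ 2

def boundI1 (k : ℤ) : ℝ :=
  ∑ g ∈ symIcc S.Ghat, (1 + S.Upsilon) * S.Er * ‖S.β 0‖ ^ 4 * T.mu P (k - g) S.U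

def boundI2 : ℝ :=
  (‖S.β 0‖ * S.betaBar) ^ 2 * S.Ed *
    (T.coefEnergyBound P - ‖1 + T.chi P‖ ^ 2 * (T.mu P 0 S.U) ^ 2)

def boundZ1 (k : ℤ) : ℝ :=
  T.mu P k (S.Ghat + S.U) * (2 * S.U + 1) * ‖S.β 0‖ ^ 2 * S.N₀

def boundZ2 (S : OFDM) : ℝ := (S.Rp⁻¹.trace).re * S.N₀ * S.betaBar ^ 2 * S.Ed

def boundZ3 : ℝ := ‖S.β 0‖ ^ 2 * T.coefEnergyBound P * S.N₀

def boundZ4 (S : OFDM) : ℝ := (S.Rp⁻¹.trace).re * S.N₀ ^ 2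

/-- The SINR lower bound `Γ_k^LB`. -/
def GammaLB (k : ℤ) : ℝ :=
  T.signalEnergy P k /
    ((T.boundI1 P k + T.boundI2 P)
      + (T.boundZ1 P k + boundZ2 S + T.boundZ3 P + boundZ4 S))

/-- The achievable throughput (nats per sub-carrier, reference-signal overhead included) with
independent demodulation of the sub-carriers:
`(1/K) ∑ₖ [H(x_k) - H(x_k | Yhat_k, est)]`, sum over the data sub-carriers. -/
def throughput : EReal :=
  ((1 / (S.K : ℝ) : ℝ) : EReal) *
    ∑ k ∈ S.dataIdx, (diffEntropy (T.x k) P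
      - condDiffEntropy (T.x k) (fun ω => (T.Yhat k ω, T.est ω)) P)

end Signals

end

/-! The estimate depends only on the "state": the phase noise and the noise coefficients `W_v`, `|v|
≤ Ghat + U`. The compensated output `Yhat_k` is then affine in the "fresh" variables, namely the
data `x_l` and the coefficients `W_{k+u}`, with weights that are functions of the state. The guard
condition places the two groups of noise coefficients on different sub-carriers. There the
circularly symmetric Gaussian noise is uncorrelated, hence independent, so the state is independent
of the fresh variables (`Lawful.indepFun_state_fresh`).

The fresh variables are centred and uncorrelated, so second moments split over them however
dependent the weights are (`WhiteFamily`). Each weight splits again into a function of the phase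
noise and a term linear in the centred, independent estimation noise. Hence the six interference and
noise components add in energy (`Lawful.integral_norm_sq_distortion`) and may be bounded one at a
time.

For the bounds, multiplication by the unimodular `e^{jθ}` is unitary: by Parseval, the gains from
all carriers into one compensated output have total energy `∑ |c_u|²`
(`Admissible.sum_norm_sq_combGain`). Since `c = (Ω + L)^*`, this energy is at most `1 + Υ`
pointwise, and its mean is at most `coefEnergyBound`, where `χ` is the cross term. Removing the mean
gain of the wanted symbol subtracts `|1 + χ|² μ(0,U)²`. The constants of the noise terms are traces:
`P R_p⁻¹ Pᴴ` is a projection of rank `2U + 1`, and the estimation noise has covariance `N₀ R_p⁻¹`.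

For the throughput, the distortion is uncorrelated with `x_k` because the residual gain of `x_k` has
mean zero. The linear MMSE estimate from `Yhat_k` therefore has error `Ed / (1 + SINR)`. Gibbs'
inequality bounds the conditional entropy by that of a Gaussian with this energy, and subtraction
from the entropy of `CN(0, Ed)` leaves `log (1 + SINR)`. -/

noncomputable section

set_option linter.unusedSectionVars false

/-! ### Independence and second moments -/

section Independence

variable {Ω α β γ : Type*} [MeasurableSpace Ω] [MeasurableSpace α] [MeasurableSpace β]
  [MeasurableSpace γ] {P : Measure Ω}

/-- If `X` is independent of `(Y, Z)` and `Y` of `Z`, then `(X, Y)` is independent of `Z`. -/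
theorem indepFun_prodMk_of_indepFun [IsProbabilityMeasure P] {X : Ω → α} {Y : Ω → β} {Z : Ω → γ}
    (hX : Measurable X) (hY : Measurable Y) (hZ : Measurable Z)
    (h₁ : IndepFun X (fun ω => (Y ω, Z ω)) P)
    (h₂ : IndepFun Y Z P) : IndepFun (fun ω => (X ω, Y ω)) Z P := by
  have hXY : IndepFun X Y P := h₁.comp measurable_id measurable_fst
  have := Measure.isProbabilityMeasure_map (μ := P) hX.aemeasurable
  have := Measure.isProbabilityMeasure_map (μ := P) hY.aemeasurable
  have := Measure.isProbabilityMeasure_map (μ := P) hZ.aemeasurable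
  rw [indepFun_iff_map_prod_eq_prod_map_map (by fun_prop) (by fun_prop)] at h₁ h₂ hXY ⊢
  rw [hXY]
  have h3 : P.map (fun ω => ((X ω, Y ω), Z ω))
      = (P.map (fun ω => (X ω, (Y ω, Z ω)))).map MeasurableEquiv.prodAssoc.symm := by
    rw [Measure.map_map (by fun_prop) (by fun_prop)]
    rfl
  rw [h3, h₁, h₂, ← Measure.prodAssoc_prod, Measure.map_map (by fun_prop) (by fun_prop)]
  simp

theorem integral_norm_sq_add {f g : Ω → ℂ} (hf : MemLp f 2 P) (hg : MemLp g 2 P)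
    (h : ∫ ω, f ω * conj (g ω) ∂P = 0) :
    ∫ ω, ‖f ω + g ω‖ ^ 2 ∂P = ∫ ω, ‖f ω‖ ^ 2 ∂P + ∫ ω, ‖g ω‖ ^ 2 ∂P := by
  have hfg : Integrable (fun ω => f ω * conj (g ω)) P := hf.integrable_mul hg.star
  have hre : ∫ ω, (f ω * conj (g ω)).re ∂P = 0 := by
    have := integral_re hfg
    simp only [RCLike.re_eq_complex_re] at this
    rw [this, h]; simp
  have hf2 : Integrable (fun ω => ‖f ω‖ ^ 2) P := hf.integrable_norm_pow two_ne_zero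
  have hg2 : Integrable (fun ω => ‖g ω‖ ^ 2) P := hg.integrable_norm_pow two_ne_zero
  have hfgr : Integrable (fun ω => 2 * (f ω * conj (g ω)).re) P := hfg.re.const_mul 2
  have key : ∀ ω, ‖f ω + g ω‖ ^ 2 = ‖f ω‖ ^ 2 + ‖g ω‖ ^ 2 + 2 * (f ω * conj (g ω)).re := by
    intro ω
    simp only [← Complex.normSq_eq_norm_sq]
    exact Complex.normSq_add _ _
  simp only [key]
  have h1 : Integrable (fun ω => ‖f ω‖ ^ 2 + ‖g ω‖ ^ 2) P := hf2.add hg2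
  rw [integral_add h1 hfgr, integral_add hf2 hg2, integral_const_mul, hre]
  ring

theorem integral_norm_sq_sum {ι : Type*} (s : Finset ι) {f : ι → Ω → ℂ}
    (hf : ∀ i ∈ s, MemLp (f i) 2 P)
    (h : ∀ i ∈ s, ∀ j ∈ s, i ≠ j → ∫ ω, f i ω * conj (f j ω) ∂P = 0) :
    ∫ ω, ‖∑ i ∈ s, f i ω‖ ^ 2 ∂P = ∑ i ∈ s, ∫ ω, ‖f i ω‖ ^ 2 ∂P := by
  classical
  induction s using Finset.induction_on with
  | empty => simp
  | insert a s ha ih =>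
    have hs : ∀ i ∈ s, MemLp (f i) 2 P := fun i hi => hf i (Finset.mem_insert_of_mem hi)
    simp only [Finset.sum_insert ha]
    have hsum : MemLp (fun ω => ∑ i ∈ s, f i ω) 2 P := memLp_finsetSum s hs
    rw [integral_norm_sq_add (hf a (Finset.mem_insert_self a s)) hsum,
      ih hs (fun i hi j hj => h i (Finset.mem_insert_of_mem hi) j (Finset.mem_insert_of_mem hj))]
    simp only [map_sum, Finset.mul_sum]
    rw [integral_finsetSum]
    · refine Finset.sum_eq_zero fun i hi => h a (Finset.mem_insert_self a s) i
        (Finset.mem_insert_of_mem hi) ?_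
      rintro rfl; exact ha hi
    · exact fun i hi => (hf a (Finset.mem_insert_self a s)).integrable_mul (hs i hi).star

/-- Independence replaces Hölder's inequality: `|X|²` and `|Y|²` are independent and integrable, so
no fourth moments are needed. -/
theorem IndepFun.memLp_two_mul {X Y : Ω → ℂ} (h : IndepFun X Y P) (hX : MemLp X 2 P)
    (hY : MemLp Y 2 P) : MemLp (fun ω => X ω * Y ω) 2 P := by
  have hm : AEStronglyMeasurable (fun ω => X ω * Y ω) P :=
    hX.aestronglyMeasurable.mul hY.aestronglyMeasurable
  rw [memLp_two_iff_integrable_sq_norm hm]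
  have hi : IndepFun (fun ω => ‖X ω‖ ^ 2) (fun ω => ‖Y ω‖ ^ 2) P :=
    h.comp (φ := fun z : ℂ => ‖z‖ ^ 2) (ψ := fun z : ℂ => ‖z‖ ^ 2) (by fun_prop) (by fun_prop)
  have := hi.integrable_mul (hX.integrable_norm_pow two_ne_zero)
    (hY.integrable_norm_pow two_ne_zero)
  refine this.congr (Filter.Eventually.of_forall fun ω => ?_)
  simp [mul_pow]

theorem IndepFun.integral_norm_sq_mul {X Y : Ω → ℂ} (h : IndepFun X Y P) (hX : MemLp X 2 P)
    (hY : MemLp Y 2 P) :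
    ∫ ω, ‖X ω * Y ω‖ ^ 2 ∂P = (∫ ω, ‖X ω‖ ^ 2 ∂P) * ∫ ω, ‖Y ω‖ ^ 2 ∂P := by
  have hi : IndepFun (fun ω => ‖X ω‖ ^ 2) (fun ω => ‖Y ω‖ ^ 2) P :=
    h.comp (φ := fun z : ℂ => ‖z‖ ^ 2) (ψ := fun z : ℂ => ‖z‖ ^ 2) (by fun_prop) (by fun_prop)
  have := hi.integral_fun_mul_eq_mul_integral
    (hX.integrable_norm_pow two_ne_zero).aestronglyMeasurable
    (hY.integrable_norm_pow two_ne_zero).aestronglyMeasurable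
  simpa [mul_pow] using this

variable {ι : Type*}

/-- A finite family of zero-mean, uncorrelated functions `y i` of `η`, with energies `σ i`. -/
structure WhiteFamily [DecidableEq ι] (P : Measure Ω) (η : Ω → γ) (y : ι → γ → ℂ) (σ : ι → ℝ) :
    Prop where
  meas : ∀ i, Measurable (y i)
  sq : ∀ i, MemLp (fun ω => y i (η ω)) 2 P
  mean : ∀ i, ∫ ω, y i (η ω) ∂P = 0
  cov : ∀ i j, i ≠ j → ∫ ω, y i (η ω) * conj (y j (η ω)) ∂P = 0
  energy : ∀ i, ∫ ω, ‖y i (η ω)‖ ^ 2 ∂P = σ i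

variable [DecidableEq ι] {ξ : Ω → α} {η : Ω → γ} {y : ι → γ → ℂ} {σ : ι → ℝ}
  {a : α → ℂ} {b : ι → α → ℂ}

theorem WhiteFamily.memLp_mul (hy : WhiteFamily P η y σ) (hind : IndepFun ξ η P)
    (hbm : ∀ i, Measurable (b i)) (hb : ∀ i, MemLp (fun ω => b i (ξ ω)) 2 P) (i : ι) :
    MemLp (fun ω => y i (η ω) * b i (ξ ω)) 2 P :=
  IndepFun.memLp_two_mul (hind.symm.comp (hy.meas i) (hbm i)) (hy.sq i) (hb i)

/-- Used with `Sum.inl` and `Sum.inr`, to treat sums over the data alone or over the channel noise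
alone. -/
theorem WhiteFamily.comp_injective {κ : Type*} [DecidableEq κ] (hy : WhiteFamily P η y σ)
    {e : κ → ι} (he : Function.Injective e) :
    WhiteFamily P η (fun i => y (e i)) fun i => σ (e i) where
  meas i := hy.meas (e i)
  sq i := hy.sq (e i)
  mean i := hy.mean (e i)
  cov i j hij := hy.cov (e i) (e j) fun h => hij (he h)
  energy i := hy.energy (e i)

variable [Fintype ι]

theorem WhiteFamily.memLp_sum (hy : WhiteFamily P η y σ) (hind : IndepFun ξ η P)
    (hbm : ∀ i, Measurable (b i)) (hb : ∀ i, MemLp (fun ω => b i (ξ ω)) 2 P) :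
    MemLp (fun ω => ∑ i, y i (η ω) * b i (ξ ω)) 2 P :=
  memLp_finsetSum _ fun i _ => hy.memLp_mul hind hbm hb i

/-- By independence an off-diagonal term factors as `E[y_i y_j^*] E[b_i b_j^*]`, and the first
factor vanishes. The weights `b_i` may therefore be arbitrarily dependent on each other. -/
theorem WhiteFamily.integral_norm_sq_sum (hy : WhiteFamily P η y σ) (hind : IndepFun ξ η P)
    (hbm : ∀ i, Measurable (b i)) (hb : ∀ i, MemLp (fun ω => b i (ξ ω)) 2 P) :
    ∫ ω, ‖∑ i, y i (η ω) * b i (ξ ω)‖ ^ 2 ∂P = ∑ i, σ i * ∫ ω, ‖b i (ξ ω)‖ ^ 2 ∂P := by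
  rw [_root_.integral_norm_sq_sum _ (fun i _ => hy.memLp_mul hind hbm hb i)]
  · refine Finset.sum_congr rfl fun i _ => ?_
    rw [← hy.energy i]
    exact IndepFun.integral_norm_sq_mul (hind.symm.comp (hy.meas i) (hbm i)) (hy.sq i) (hb i)
  · intro i _ j _ hij
    have hi : IndepFun (fun ω => y i (η ω) * conj (y j (η ω)))
        (fun ω => b i (ξ ω) * conj (b j (ξ ω))) P :=
      hind.symm.comp (φ := fun g => y i g * conj (y j g)) (ψ := fun g => b i g * conj (b j g))
        ((hy.meas i).mul (Complex.continuous_conj.measurable.comp (hy.meas j)))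
        ((hbm i).mul (Complex.continuous_conj.measurable.comp (hbm j)))
    have h2 := hi.integral_fun_mul_eq_mul_integral
      ((hy.sq i).aestronglyMeasurable.mul (hy.sq j).star.aestronglyMeasurable)
      ((hb i).aestronglyMeasurable.mul (hb j).star.aestronglyMeasurable)
    rw [hy.cov i j hij, zero_mul] at h2
    rw [← h2]
    refine integral_congr_ae (Filter.Eventually.of_forall fun ω => ?_)
    simp only [map_mul]; ring

/-- The cross terms with `a` carry a factor `E[y_i^*] = 0`. -/
theorem WhiteFamily.integral_norm_sq_affine (hy : WhiteFamily P η y σ) (hind : IndepFun ξ η P)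
    (ham : Measurable a) (ha : MemLp (fun ω => a (ξ ω)) 2 P)
    (hbm : ∀ i, Measurable (b i)) (hb : ∀ i, MemLp (fun ω => b i (ξ ω)) 2 P) :
    ∫ ω, ‖a (ξ ω) + ∑ i, y i (η ω) * b i (ξ ω)‖ ^ 2 ∂P
      = ∫ ω, ‖a (ξ ω)‖ ^ 2 ∂P + ∑ i, σ i * ∫ ω, ‖b i (ξ ω)‖ ^ 2 ∂P := by
  rw [integral_norm_sq_add ha (hy.memLp_sum hind hbm hb),
    hy.integral_norm_sq_sum hind hbm hb]
  simp only [map_sum, map_mul, Finset.mul_sum]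
  have hint : ∀ i, Integrable (fun ω => a (ξ ω) * conj (y i (η ω) * b i (ξ ω))) P :=
    fun i => ha.integrable_mul (hy.memLp_mul hind hbm hb i).star
  simp only [map_mul] at hint
  rw [integral_finsetSum _ fun i _ => hint i]
  refine Finset.sum_eq_zero fun i _ => ?_
  have hi : IndepFun (fun ω => conj (y i (η ω))) (fun ω => a (ξ ω) * conj (b i (ξ ω))) P :=
    hind.symm.comp (φ := fun g => conj (y i g)) (ψ := fun g => a g * conj (b i g))
      (Complex.continuous_conj.measurable.comp (hy.meas i))
      (ham.mul (Complex.continuous_conj.measurable.comp (hbm i)))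
  have h2 := hi.integral_fun_mul_eq_mul_integral (hy.sq i).star.aestronglyMeasurable
      (ha.aestronglyMeasurable.mul (hb i).star.aestronglyMeasurable)
  rw [integral_conj, hy.mean i, map_zero, zero_mul] at h2
  rw [← h2]
  refine integral_congr_ae (Filter.Eventually.of_forall fun ω => ?_)
  ring

/-- The correlation of an affine combination with one member of the family. -/
theorem WhiteFamily.integral_affine_mul_conj (hy : WhiteFamily P η y σ) (hind : IndepFun ξ η P)
    (ham : Measurable a) (ha : MemLp (fun ω => a (ξ ω)) 2 P)
    (hbm : ∀ i, Measurable (b i)) (hb : ∀ i, MemLp (fun ω => b i (ξ ω)) 2 P) (j : ι) :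
    ∫ ω, (a (ξ ω) + ∑ i, y i (η ω) * b i (ξ ω)) * conj (y j (η ω)) ∂P
      = σ j * ∫ ω, b j (ξ ω) ∂P := by
  simp only [add_mul, Finset.sum_mul]
  have i1 : Integrable (fun ω => a (ξ ω) * conj (y j (η ω))) P := ha.integrable_mul (hy.sq j).star
  have i2 : ∀ i, Integrable (fun ω => y i (η ω) * b i (ξ ω) * conj (y j (η ω))) P :=
    fun i => (hy.memLp_mul hind hbm hb i).integrable_mul (hy.sq j).star
  rw [integral_add i1 (integrable_finsetSum _ fun i _ => i2 i),
    integral_finsetSum _ fun i _ => i2 i]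
  have hconj : Measurable (fun g => conj (y j g)) :=
    Complex.continuous_conj.measurable.comp (hy.meas j)
  have z1 : ∫ ω, a (ξ ω) * conj (y j (η ω)) ∂P = 0 := by
    have hi : IndepFun (fun ω => a (ξ ω)) (fun ω => conj (y j (η ω))) P := hind.comp ham hconj
    rw [hi.integral_fun_mul_eq_mul_integral ha.aestronglyMeasurable
      (hy.sq j).star.aestronglyMeasurable, integral_conj, hy.mean j]
    simp
  have z2 : ∀ i, ∫ ω, y i (η ω) * b i (ξ ω) * conj (y j (η ω)) ∂P
      = (∫ ω, y i (η ω) * conj (y j (η ω)) ∂P) * ∫ ω, b i (ξ ω) ∂P := by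
    intro i
    have hi : IndepFun (fun ω => y i (η ω) * conj (y j (η ω))) (fun ω => b i (ξ ω)) P :=
      hind.symm.comp (φ := fun g => y i g * conj (y j g)) ((hy.meas i).mul hconj) (hbm i)
    rw [← hi.integral_fun_mul_eq_mul_integral
      ((hy.sq i).aestronglyMeasurable.mul (hy.sq j).star.aestronglyMeasurable)
      (hb i).aestronglyMeasurable]
    refine integral_congr_ae (Filter.Eventually.of_forall fun ω => ?_)
    ring
  rw [z1, zero_add, Finset.sum_eq_single j]
  · rw [z2, ← hy.energy j, ← integral_complex_ofReal]
    congr 2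
    ext ω
    rw [Complex.mul_conj, Complex.normSq_eq_norm_sq]
  · intro i _ hij
    rw [z2, hy.cov i j hij, zero_mul]
  · simp

end Independence

/-! ### The circularly symmetric complex Gaussian law -/

section ComplexGaussian

instance (v : ℝ) : IsProbabilityMeasure (complexGaussian v) :=
  Measure.isProbabilityMeasure_map (MeasurableEquiv.measurable _).aemeasurable

instance (v : ℝ) : IsGaussian (complexGaussian v) :=
  isGaussian_map_equiv Complex.equivRealProdCLM.symm

theorem integral_complexGaussian (v : ℝ) (f : ℂ → ℂ) :
    ∫ z, f z ∂complexGaussian v = ∫ x, f (x.1 + x.2 * Complex.I)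
      ∂((gaussianReal 0 (v / 2).toNNReal).prod (gaussianReal 0 (v / 2).toNNReal)) := by
  rw [complexGaussian, integral_map_equiv]
  refine integral_congr_ae (Filter.Eventually.of_forall fun x => ?_)
  exact congrArg f (Complex.mk_eq_add_mul_I x.1 x.2)

theorem integral_sq_gaussianReal (v : NNReal) : ∫ x, x ^ 2 ∂gaussianReal 0 v = v := by
  have := variance_eq_integral (μ := gaussianReal 0 v) (X := id) measurable_id.aemeasurable
  rw [variance_id_gaussianReal] at this
  simpa using this.symm

theorem integral_id_complexGaussian (v : ℝ) : ∫ z, z ∂complexGaussian v = 0 := by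
  set γ := gaussianReal 0 (v / 2).toNNReal
  have h : Integrable (fun x : ℝ => (x : ℂ)) γ :=
    ((memLp_id_gaussianReal 1).integrable (by simp)).ofReal
  have h0 : ∫ x : ℝ, (x : ℂ) ∂γ = 0 := by
    rw [integral_complex_ofReal]; simp [γ]
  rw [integral_complexGaussian]
  rw [integral_add (h.comp_fst γ) ((h.comp_snd γ).mul_const _), integral_mul_const,
    integral_fun_fst (fun x : ℝ => (x : ℂ)), integral_fun_snd (fun x : ℝ => (x : ℂ)), h0]
  simp

theorem integrable_sq_ofReal_gaussianReal (v : NNReal) :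
    Integrable (fun x : ℝ => (x : ℂ) ^ 2) (gaussianReal 0 v) := by
  have : Integrable (fun x : ℝ => x ^ 2) (gaussianReal 0 v) :=
    (memLp_id_gaussianReal 2).integrable_sq
  simpa using this.ofReal (𝕜 := ℂ)

/-- The real and imaginary parts have equal variance and are uncorrelated. Vanishing of this
pseudo-variance is what later allows uncorrelated noise coefficients to be called independent. -/
theorem integral_sq_complexGaussian (v : ℝ) : ∫ z, z ^ 2 ∂complexGaussian v = 0 := by
  set γ := gaussianReal 0 (v / 2).toNNReal with hγ
  have h : Integrable (fun x : ℝ => (x : ℂ)) γ :=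
    ((memLp_id_gaussianReal 1).integrable (by simp)).ofReal
  have h0 : ∫ x : ℝ, (x : ℂ) ∂γ = 0 := by
    rw [integral_complex_ofReal]; simp [γ]
  have h2 := integrable_sq_ofReal_gaussianReal (v / 2).toNNReal
  rw [← hγ] at h2
  rw [integral_complexGaussian]
  have key : ∀ x : ℝ × ℝ, ((x.1 : ℂ) + x.2 * Complex.I) ^ 2
      = ((x.1 : ℂ) ^ 2 - (x.2 : ℂ) ^ 2) + 2 * Complex.I * ((x.1 : ℂ) * (x.2 : ℂ)) := by
    intro x
    linear_combination (x.2 : ℂ) ^ 2 * Complex.I_sq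
  simp only [key]
  have i1 : Integrable (fun x : ℝ × ℝ => (x.1 : ℂ) ^ 2) (γ.prod γ) := h2.comp_fst γ
  have i2 : Integrable (fun x : ℝ × ℝ => (x.2 : ℂ) ^ 2) (γ.prod γ) := h2.comp_snd γ
  have i3 : Integrable (fun x : ℝ × ℝ => (x.1 : ℂ) * (x.2 : ℂ)) (γ.prod γ) := h.mul_prod h
  have i4 : Integrable (fun x : ℝ × ℝ => (x.1 : ℂ) ^ 2 - (x.2 : ℂ) ^ 2) (γ.prod γ) := i1.sub i2
  rw [integral_add i4 (i3.const_mul _), integral_sub i1 i2, integral_const_mul,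
    integral_fun_fst (fun x : ℝ => (x : ℂ) ^ 2), integral_fun_snd (fun x : ℝ => (x : ℂ) ^ 2),
    integral_prod_mul (fun x : ℝ => (x : ℂ)) (fun x : ℝ => (x : ℂ)), h0]
  simp

theorem integral_normSq_complexGaussian {v : ℝ} (hv : 0 ≤ v) :
    ∫ z, z * conj z ∂complexGaussian v = v := by
  set γ := gaussianReal 0 (v / 2).toNNReal with hγ
  have h2 := integrable_sq_ofReal_gaussianReal (v / 2).toNNReal
  rw [← hγ] at h2
  have h0 : ∫ x : ℝ, (x : ℂ) ^ 2 ∂γ = (v / 2 : ℝ) := by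
    have : ∫ x : ℝ, ((x ^ 2 : ℝ) : ℂ) ∂γ = (v / 2 : ℝ) := by
      rw [integral_complex_ofReal, integral_sq_gaussianReal, Real.coe_toNNReal _ (by positivity)]
    simpa using this
  rw [integral_complexGaussian]
  have key : ∀ x : ℝ × ℝ, ((x.1 : ℂ) + x.2 * Complex.I) * conj ((x.1 : ℂ) + x.2 * Complex.I)
      = (x.1 : ℂ) ^ 2 + (x.2 : ℂ) ^ 2 := by
    intro x
    simp only [map_add, map_mul, Complex.conj_ofReal, Complex.conj_I]
    linear_combination -(x.2 : ℂ) ^ 2 * Complex.I_sq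
  simp only [key]
  have i1 : Integrable (fun x : ℝ × ℝ => (x.1 : ℂ) ^ 2) (γ.prod γ) := h2.comp_fst γ
  have i2 : Integrable (fun x : ℝ × ℝ => (x.2 : ℂ) ^ 2) (γ.prod γ) := h2.comp_snd γ
  rw [integral_add i1 i2,
    integral_fun_fst (fun x : ℝ => (x : ℂ) ^ 2), integral_fun_snd (fun x : ℝ => (x : ℂ) ^ 2), h0]
  simp

/-- The Lebesgue density of `CN(0, v)`. -/
def complexGaussianPDF (v : ℝ) (z : ℂ) : ℝ := (Real.pi * v)⁻¹ * Real.exp (-(‖z‖ ^ 2 / v))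

theorem measurable_complexGaussianPDF (v : ℝ) : Measurable (complexGaussianPDF v) := by
  unfold complexGaussianPDF; fun_prop

theorem complexGaussianPDF_pos {v : ℝ} (hv : 0 < v) (z : ℂ) : 0 < complexGaussianPDF v z := by
  unfold complexGaussianPDF; positivity

theorem log_complexGaussianPDF {v : ℝ} (hv : 0 < v) (z : ℂ) :
    Real.log (complexGaussianPDF v z) = -(Real.log (Real.pi * v) + ‖z‖ ^ 2 / v) := by
  unfold complexGaussianPDF
  rw [Real.log_mul (by positivity) (by positivity), Real.log_inv, Real.log_exp]
  ring

theorem complexGaussian_eq_withDensity {v : ℝ} (hv : 0 < v) :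
    complexGaussian v = volume.withDensity fun z => ENNReal.ofReal (complexGaussianPDF v z) := by
  have hv2 : (v / 2).toNNReal ≠ 0 := by
    simpa using hv
  have hm := Complex.volume_preserving_equiv_real_prod.symm
  rw [complexGaussian, gaussianReal_of_var_ne_zero _ hv2,
    prod_withDensity (measurable_gaussianPDF _ _) (measurable_gaussianPDF _ _)]
  ext s hs
  rw [Measure.map_apply (MeasurableEquiv.measurable _) hs,
    withDensity_apply _ ((MeasurableEquiv.measurable _) hs), withDensity_apply _ hs,
    ← hm.setLIntegral_comp_preimage_emb (MeasurableEquiv.measurableEmbedding _)]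
  refine setLIntegral_congr_fun ((MeasurableEquiv.measurable _) hs) fun x _ => ?_
  simp only [gaussianPDF_def, gaussianPDFReal_def, complexGaussianPDF]
  rw [← ENNReal.ofReal_mul (by positivity)]
  congr 1
  have h1 : ‖Complex.measurableEquivRealProd.symm x‖ ^ 2 = x.1 ^ 2 + x.2 ^ 2 := by
    rw [← Complex.normSq_eq_norm_sq, Complex.normSq_apply]
    change x.1 * x.1 + x.2 * x.2 = _
    ring
  -- Each real factor has variance `v / 2`, hence prefactor `(√(π v))⁻¹`; the two multiply to `(π
  -- v)⁻¹`.
  rw [h1, Real.coe_toNNReal _ (by positivity), mul_mul_mul_comm, ← Real.exp_add, ← mul_inv,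
    Real.mul_self_sqrt (by positivity)]
  congr 2
  · ring
  · field_simp; ring

theorem lintegral_complexGaussianPDF {v : ℝ} (hv : 0 < v) :
    ∫⁻ z, ENNReal.ofReal (complexGaussianPDF v z) = 1 := by
  have := measure_univ (μ := complexGaussian v)
  rwa [complexGaussian_eq_withDensity hv, withDensity_apply _ MeasurableSet.univ,
    Measure.restrict_univ] at this

end ComplexGaussian

/-! ### Entropy bounds -/

section Entropy

variable {α : Type*} [MeasurableSpace α]

/-- Positive and negative parts are compared separately. Both parts of `h` are finite, while the
negative part of `g` may have infinite integral: the value `-∞` is allowed and `∞ - ∞` never arises.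
-/
theorem extIntegral_le {μ : Measure α} {g h : α → ℝ} (hh : Integrable h μ)
    (hgh : ∀ᵐ a ∂μ, g a ≤ h a) : extIntegral g μ ≤ ((∫ a, h a ∂μ : ℝ) : EReal) := by
  have fin : ∀ f : α → ℝ, Integrable f μ → ∫⁻ a, ENNReal.ofReal (f a) ∂μ ≠ ⊤ := fun f hf =>
    ((lintegral_mono fun a => Real.ofReal_le_enorm (f a)).trans_lt hf.2).ne
  have h1 := fin h hh
  have h2 : ∫⁻ a, ENNReal.ofReal (-h a) ∂μ ≠ ⊤ := fin (fun a => -h a) hh.neg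
  rw [integral_eq_lintegral_pos_part_sub_lintegral_neg_part hh, EReal.coe_sub,
    EReal.coe_ennreal_toReal h1, EReal.coe_ennreal_toReal h2]
  refine EReal.sub_le_sub ?_ ?_ <;> rw [EReal.coe_ennreal_le_coe_ennreal_iff]
  · exact lintegral_mono_ae (hgh.mono fun a ha => ENNReal.ofReal_le_ofReal ha)
  · exact lintegral_mono_ae (hgh.mono fun a ha => ENNReal.ofReal_le_ofReal (neg_le_neg ha))

theorem extIntegral_eq_integral {μ : Measure α} {g : α → ℝ} (hg : Integrable g μ) :
    extIntegral g μ = ((∫ a, g a ∂μ : ℝ) : EReal) := by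
  have fin : ∀ f : α → ℝ, Integrable f μ → ∫⁻ a, ENNReal.ofReal (f a) ∂μ ≠ ⊤ := fun f hf =>
    ((lintegral_mono fun a => Real.ofReal_le_enorm (f a)).trans_lt hf.2).ne
  have h1 := fin g hg
  have h2 : ∫⁻ a, ENNReal.ofReal (-g a) ∂μ ≠ ⊤ := fin (fun a => -g a) hg.neg
  rw [integral_eq_lintegral_pos_part_sub_lintegral_neg_part hg, EReal.coe_sub,
    EReal.coe_ennreal_toReal h1, EReal.coe_ennreal_toReal h2, extIntegral]

/-- Gibbs' inequality: the cross entropy relative to a sub-probability density `q` dominates the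
entropy. -/
theorem extIntegral_neg_llr_le {J m : Measure α} [IsProbabilityMeasure J] [SigmaFinite m]
    (hJ : J ≪ m) {q : α → ℝ} (hqm : Measurable q) (hq : ∀ a, 0 < q a)
    (hq1 : ∫⁻ a, ENNReal.ofReal (q a) ∂m ≤ 1) (hlog : Integrable (fun a => Real.log (q a)) J) :
    extIntegral (fun a => -llr J m a) J ≤ ((-∫ a, Real.log (q a) ∂J : ℝ) : EReal) := by
  set f : α → ℝ := fun a => (J.rnDeriv m a).toReal with hf
  have hfm : Measurable f := (Measure.measurable_rnDeriv J m).ennreal_toReal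
  set r : α → ℝ := fun a => q a / f a with hr
  have hrm : Measurable r := hqm.div hfm
  have hr0 : ∀ a, 0 ≤ r a := fun a => div_nonneg (hq a).le ENNReal.toReal_nonneg
  -- With `f = dJ/dm`, the integral of `q / f` against `J` is that of `q` against `m` over `{f >
  -- 0}`. Where `f = 0` the convention `q / 0 = 0` is harmless.
  have hrl : ∫⁻ a, ENNReal.ofReal (r a) ∂J ≤ 1 := by
    rw [← lintegral_rnDeriv_mul hJ (hrm.ennreal_ofReal).aemeasurable]
    refine le_trans (lintegral_mono_ae ?_) hq1
    filter_upwards [Measure.rnDeriv_ne_top J m] with a ha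
    by_cases h0 : J.rnDeriv m a = 0
    · simp [h0]
    · have hpos : 0 < f a := ENNReal.toReal_pos h0 ha
      rw [← ENNReal.ofReal_toReal ha, ← ENNReal.ofReal_mul ENNReal.toReal_nonneg]
      change ENNReal.ofReal (f a * (q a / f a)) ≤ _
      rw [mul_div_cancel₀ _ hpos.ne']
  have hri : Integrable r J := by
    refine ⟨hrm.aestronglyMeasurable, ?_⟩
    rw [hasFiniteIntegral_iff_ofReal (Filter.Eventually.of_forall hr0)]
    exact hrl.trans_lt ENNReal.one_lt_top
  have hr1 : ∫ a, r a ∂J ≤ 1 := by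
    rw [integral_eq_lintegral_of_nonneg_ae (Filter.Eventually.of_forall hr0)
      hrm.aestronglyMeasurable]
    exact ENNReal.toReal_le_of_le_ofReal zero_le_one (by simpa using hrl)
  have hr2 : Integrable (fun a => r a - 1) J := hri.sub (integrable_const 1)
  have hint : Integrable (fun a => -Real.log (q a) + (r a - 1)) J := hlog.neg.add hr2
  -- From `log t ≤ t - 1` at `t = q / f`: `-log f ≤ -log q + (r - 1)`, and `r - 1` has nonpositive
  -- integral under `J`.
  refine (extIntegral_le hint ?_).trans ?_
  · filter_upwards [Measure.rnDeriv_pos hJ, hJ.ae_le (Measure.rnDeriv_ne_top J m)] with a h0 h1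
    have hpos : 0 < f a := ENNReal.toReal_pos h0.ne' h1
    have := Real.log_le_sub_one_of_pos (div_pos (hq a) hpos)
    rw [Real.log_div (hq a).ne' hpos.ne'] at this
    change -Real.log (f a) ≤ -Real.log (q a) + (q a / f a - 1)
    linarith
  · rw [EReal.coe_le_coe_iff, integral_add (f := fun a => -Real.log (q a)) hlog.neg hr2,
      integral_sub hri (integrable_const 1)]
    simp only [integral_neg, integral_const, probReal_univ, smul_eq_mul, one_mul]
    linarith

variable {Ω : Type*} [MeasurableSpace Ω] {P : Measure Ω} [IsProbabilityMeasure P]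

theorem diffEntropy_of_map_eq_complexGaussian {X : Ω → ℂ} {v : ℝ} (hv : 0 < v)
    (hX : Measurable X) (hmap : P.map X = complexGaussian v) (hE : ∫ ω, ‖X ω‖ ^ 2 ∂P = v) :
    diffEntropy X P = ((Real.log (Real.pi * v) + 1 : ℝ) : EReal) := by
  have hd : P.map X = volume.withDensity fun z => ENNReal.ofReal (complexGaussianPDF v z) := by
    rw [hmap, complexGaussian_eq_withDensity hv]
  have hac : P.map X ≪ volume := by rw [hd]; exact withDensity_absolutelyContinuous _ _
  -- A non-integrable function has Bochner integral `0`, so a positive energy forces integrability.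
  have hsq : Integrable (fun ω => ‖X ω‖ ^ 2) P := by
    by_contra h
    rw [integral_undef h] at hE
    exact hv.ne hE
  have hae : (fun z => -llr (P.map X) volume z)
      =ᵐ[P.map X] fun z => Real.log (Real.pi * v) + ‖z‖ ^ 2 / v := by
    refine hac.ae_le ?_
    rw [hd]
    filter_upwards [Measure.rnDeriv_withDensity volume
      (measurable_complexGaussianPDF v).ennreal_ofReal] with z hz
    rw [llr, hz, ENNReal.toReal_ofReal (complexGaussianPDF_pos hv z).le,
      log_complexGaussianPDF hv, neg_neg]
  have := Measure.isProbabilityMeasure_map (μ := P) hX.aemeasurable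
  have hn : Integrable (fun z : ℂ => ‖z‖ ^ 2) (P.map X) :=
    (integrable_map_measure (by fun_prop) hX.aemeasurable).2 hsq
  have hE' : ∫ z, ‖z‖ ^ 2 ∂P.map X = v := by
    rw [integral_map hX.aemeasurable (by fun_prop), hE]
  have hi : Integrable (fun z : ℂ => Real.log (Real.pi * v) + ‖z‖ ^ 2 / v) (P.map X) :=
    (integrable_const _).add (hn.div_const v)
  rw [diffEntropy, if_pos hac, extIntegral_eq_integral (hi.congr hae.symm), integral_congr_ae hae,
    integral_add (integrable_const _) (hn.div_const v), integral_div, hE']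
  simp [hv.ne']

/-- The conditional entropy of `X` given `Y` is at most the entropy of a circularly symmetric
Gaussian variable with the energy of the error of any estimate `e` of `X` from `Y`. -/
theorem condDiffEntropy_le {β : Type*} [MeasurableSpace β] {X : Ω → ℂ} {Y : Ω → β}
    (hX : Measurable X) (hY : Measurable Y) {e : β → ℂ} (he : Measurable e) {s : ℝ} (hs : 0 < s)
    (hE : ∫ ω, ‖X ω - e (Y ω)‖ ^ 2 ∂P = s) :
    condDiffEntropy X Y P ≤ ((Real.log (Real.pi * s) + 1 : ℝ) : EReal) := by
  rw [condDiffEntropy]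
  split_ifs with hac
  swap; · exact bot_le
  have hXY : Measurable fun ω => (X ω, Y ω) := hX.prodMk hY
  have := Measure.isProbabilityMeasure_map (μ := P) hXY.aemeasurable
  have := Measure.isProbabilityMeasure_map (μ := P) hY.aemeasurable
  have hem : Measurable fun z : ℂ × β => z.1 - e z.2 := by fun_prop
  have hsq : Integrable (fun ω => ‖X ω - e (Y ω)‖ ^ 2) P := by
    by_contra h
    rw [integral_undef h] at hE
    exact hs.ne hE
  have hn : Integrable (fun z : ℂ × β => ‖z.1 - e z.2‖ ^ 2) (P.map fun ω => (X ω, Y ω)) :=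
    (integrable_map_measure (hem.norm.pow_const 2).aestronglyMeasurable hXY.aemeasurable).2 hsq
  have hi : Integrable (fun z : ℂ × β => -(Real.log (Real.pi * s) + ‖z.1 - e z.2‖ ^ 2 / s))
      (P.map fun ω => (X ω, Y ω)) := ((integrable_const _).add (hn.div_const s)).neg
  -- The comparison density is `CN(e(y), s)` in `x` for each `y`. It integrates to `1` by
  -- translation invariance, and its cross entropy is `log (π s) + E|X - e(Y)|² / s = log (π s) +
  -- 1`.
  refine (extIntegral_neg_llr_le hac (q := fun z => complexGaussianPDF s (z.1 - e z.2))
    ((measurable_complexGaussianPDF s).comp hem) (fun z => complexGaussianPDF_pos hs _) ?_ ?_).trans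
    (le_of_eq ?_)
  · have hm : Measurable fun z : ℂ × β => ENNReal.ofReal (complexGaussianPDF s (z.1 - e z.2)) :=
      ((measurable_complexGaussianPDF s).comp hem).ennreal_ofReal
    rw [lintegral_prod_symm _ hm.aemeasurable]
    have : ∀ y : β, ∫⁻ x : ℂ, ENNReal.ofReal (complexGaussianPDF s (x - e y)) = 1 := fun y => by
      rw [lintegral_sub_right_eq_self (fun x => ENNReal.ofReal (complexGaussianPDF s x)),
        lintegral_complexGaussianPDF hs]
    simp [this]
  · simpa only [log_complexGaussianPDF hs] using hi
  · simp only [log_complexGaussianPDF hs]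
    rw [integral_neg, neg_neg, integral_add (integrable_const _) (hn.div_const s), integral_div,
      integral_map hXY.aemeasurable (hem.norm.pow_const 2).aestronglyMeasurable, hE]
    simp [hs.ne']

end Entropy

/-! ### Discrete Fourier analysis -/

theorem sum_pow_eq_zero_of_pow_eq_one {r : ℂ} {K : ℕ} (hr : r ^ K = 1) (h1 : r ≠ 1) :
    ∑ j ∈ Finset.range K, r ^ j = 0 := by
  have := geom_sum_mul r K
  rw [hr, sub_self] at this
  exact (mul_eq_zero.1 this).resolve_right (sub_ne_zero.2 h1)

namespace OFDM

variable (S : OFDM)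

theorem K_pos : 0 < S.K := Nat.succ_pos _

theorem K_cast_ne_zero : (S.K : ℂ) ≠ 0 := Nat.cast_ne_zero.2 S.K_pos.ne'

/-- The primitive `K`-th root of unity `e^{j 2π / K}`. -/
def root : ℂ := Complex.exp (2 * Real.pi * Complex.I / (S.K : ℂ))

theorem isPrimitiveRoot_root : IsPrimitiveRoot S.root S.K :=
  Complex.isPrimitiveRoot_exp S.K S.K_pos.ne'

theorem root_ne_zero : S.root ≠ 0 := Complex.exp_ne_zero _

theorem tone_eq_zpow (k : ℤ) (n : Fin S.K) : S.tone k n = S.root ^ (k * (n : ℤ)) := by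
  rw [tone, root, ← Complex.exp_int_mul]
  congr 1
  push_cast
  ring

theorem tone_add (a b : ℤ) (n : Fin S.K) : S.tone (a + b) n = S.tone a n * S.tone b n := by
  simp only [tone_eq_zpow, add_mul, zpow_add₀ S.root_ne_zero]

theorem tone_zero (n : Fin S.K) : S.tone 0 n = 1 := by simp [tone]

theorem conj_tone (a : ℤ) (n : Fin S.K) : conj (S.tone a n) = S.tone (-a) n := by
  rw [tone, tone, ← Complex.exp_conj]
  congr 1
  simp only [map_div₀, map_mul, Complex.conj_ofReal, Complex.conj_I, map_ofNat, map_intCast,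
    map_natCast]
  push_cast
  ring

theorem tone_mul_conj (a : ℤ) (n : Fin S.K) : S.tone a n * conj (S.tone a n) = 1 := by
  rw [conj_tone, ← tone_add, add_neg_cancel, tone_zero]

theorem sum_tone (a : ℤ) : ∑ n, S.tone a n = if (S.K : ℤ) ∣ a then (S.K : ℂ) else 0 := by
  have h : ∑ n, S.tone a n = ∑ j ∈ Finset.range S.K, (S.root ^ a) ^ j := by
    rw [← Fin.sum_univ_eq_sum_range (fun j => (S.root ^ a) ^ j)]
    simp only [tone_eq_zpow, _root_.zpow_mul, zpow_natCast]
  rw [h]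
  split_ifs with hd
  · rw [(S.isPrimitiveRoot_root.zpow_eq_one_iff_dvd a).2 hd]
    simp
  · refine sum_pow_eq_zero_of_pow_eq_one ?_
      fun h => hd ((S.isPrimitiveRoot_root.zpow_eq_one_iff_dvd a).1 h)
    rw [← zpow_natCast, ← _root_.zpow_mul, mul_comm, _root_.zpow_mul, zpow_natCast,
      S.isPrimitiveRoot_root.pow_eq_one, _root_.one_zpow]

theorem carriers_eq_image : S.carriers
    = (Finset.range S.K).image fun j : ℕ => -(S.K₁ : ℤ) + j := by
  ext l
  simp only [carriers, Finset.mem_Icc, Finset.mem_image, Finset.mem_range, K]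
  constructor
  · rintro ⟨h1, h2⟩
    exact ⟨(l + S.K₁).toNat, by omega, by omega⟩
  · rintro ⟨j, hj, rfl⟩
    omega

/-- The carriers are `K` consecutive integers, a full residue system modulo `K`. This is the
completeness relation behind Parseval's identity over the carriers. -/
theorem sum_carriers_tone (n m : Fin S.K) :
    ∑ l ∈ S.carriers, S.tone l n * conj (S.tone l m) = if n = m then (S.K : ℂ) else 0 := by
  rw [carriers_eq_image, Finset.sum_image fun a _ b _ h => by simpa using h]
  split_ifs with hnm
  · subst hnm
    simp [tone_mul_conj]
  · have hterm : ∀ j : ℕ, S.tone (-(S.K₁ : ℤ) + j) n * conj (S.tone (-(S.K₁ : ℤ) + j) m)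
        = S.root ^ (-(S.K₁ : ℤ) * ((n : ℤ) - m)) * (S.root ^ ((n : ℤ) - m)) ^ j := by
      intro j
      rw [conj_tone, tone_eq_zpow, tone_eq_zpow, ← zpow_natCast (S.root ^ _) j, ← _root_.zpow_mul,
        ← zpow_add₀ S.root_ne_zero, ← zpow_add₀ S.root_ne_zero]
      congr 1
      ring
    simp only [hterm]
    rw [← Finset.mul_sum, sum_pow_eq_zero_of_pow_eq_one, mul_zero]
    · rw [← zpow_natCast, ← _root_.zpow_mul, mul_comm, _root_.zpow_mul, zpow_natCast,
        S.isPrimitiveRoot_root.pow_eq_one, _root_.one_zpow]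
    · intro h
      have hd := (S.isPrimitiveRoot_root.zpow_eq_one_iff_dvd _).1 h
      have h1 := n.2
      have h2 := m.2
      have := Int.eq_zero_of_abs_lt_dvd hd (abs_lt.2 ⟨by omega, by omega⟩)
      exact hnm (Fin.ext (by omega))

theorem nDFT_add (f g : Fin S.K → ℂ) (k : ℤ) :
    S.nDFT (fun n => f n + g n) k = S.nDFT f k + S.nDFT g k := by
  simp only [nDFT, add_mul, Finset.sum_add_distrib, mul_add]

theorem nDFT_const_mul (c : ℂ) (f : Fin S.K → ℂ) (k : ℤ) :
    S.nDFT (fun n => c * f n) k = c * S.nDFT f k := by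
  simp only [nDFT, mul_assoc, ← Finset.mul_sum]
  ring

theorem nDFT_sum {ι : Type*} (s : Finset ι) (f : ι → Fin S.K → ℂ) (k : ℤ) :
    S.nDFT (fun n => ∑ i ∈ s, f i n) k = ∑ i ∈ s, S.nDFT (f i) k := by
  simp only [nDFT, Finset.sum_mul, ← Finset.mul_sum]
  rw [Finset.sum_comm]

theorem nDFT_tone_mul (g : ℤ) (f : Fin S.K → ℂ) (k : ℤ) :
    S.nDFT (fun n => S.tone g n * f n) k = S.nDFT f (k - g) := by
  simp only [nDFT]
  congr 1
  refine Finset.sum_congr rfl fun n _ => ?_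
  rw [show -(k - g) = g + -k by ring, tone_add]
  ring

/-- Parseval's identity over the carriers, in shifted and reflected form. -/
theorem sum_carriers_norm_sq_nDFT (h : Fin S.K → ℂ) (a : ℤ) :
    ∑ l ∈ S.carriers, ‖S.nDFT h (a - l)‖ ^ 2 = (1 / (S.K : ℝ)) * ∑ n, ‖h n‖ ^ 2 := by
  have hK := S.K_cast_ne_zero
  have key : ∑ l ∈ S.carriers, S.nDFT h (a - l) * conj (S.nDFT h (a - l))
      = (1 / (S.K : ℂ)) * ∑ n, h n * conj (h n) := by
    have hterm : ∀ l, S.nDFT h (a - l) * conj (S.nDFT h (a - l))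
        = ∑ n, ∑ m, (1 / (S.K : ℂ)) ^ 2 * (h n * conj (h m) * S.tone (-a) n *
          conj (S.tone (-a) m)) * (S.tone l n * conj (S.tone l m)) := by
      intro l
      have hl : -(a - l) = -a + l := by ring
      simp only [nDFT, map_mul, map_sum, map_div₀, map_one, map_natCast, hl, tone_add]
      rw [mul_mul_mul_comm, Finset.sum_mul_sum, Finset.mul_sum]
      refine Finset.sum_congr rfl fun n _ => ?_
      rw [Finset.mul_sum]
      refine Finset.sum_congr rfl fun m _ => ?_
      ring
    simp only [hterm]
    rw [Finset.sum_comm, Finset.mul_sum]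
    refine Finset.sum_congr rfl fun n _ => ?_
    rw [Finset.sum_comm]
    simp only [← Finset.mul_sum, sum_carriers_tone, mul_ite, mul_zero, Finset.sum_ite_eq,
      Finset.mem_univ, if_true]
    have := S.tone_mul_conj (-a) n
    field_simp
    linear_combination (h n * conj (h n)) * this
  apply Complex.ofReal_injective
  push_cast
  simpa only [Complex.mul_conj, Complex.normSq_eq_norm_sq, Complex.ofReal_pow] using key

/-- The tones of a set of pairwise incongruent indices are orthogonal. -/
theorem sum_norm_sq_sum_tone {ι : Type*} (s : Finset ι) (e : ι → ℤ)
    (he : ∀ i ∈ s, ∀ j ∈ s, (S.K : ℤ) ∣ e i - e j → i = j) (c : ι → ℂ) :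
    ∑ n, ‖∑ i ∈ s, c i * S.tone (e i) n‖ ^ 2 = S.K * ∑ i ∈ s, ‖c i‖ ^ 2 := by
  classical
  have key : ∑ n, (∑ i ∈ s, c i * S.tone (e i) n) * conj (∑ i ∈ s, c i * S.tone (e i) n)
      = S.K * ∑ i ∈ s, c i * conj (c i) := by
    simp only [map_sum, map_mul, Finset.sum_mul_sum, conj_tone]
    rw [Finset.sum_comm, Finset.mul_sum]
    refine Finset.sum_congr rfl fun i hi => ?_
    rw [Finset.sum_comm]
    have hterm : ∀ j, ∑ n, c i * S.tone (e i) n * (conj (c j) * S.tone (-e j) n)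
        = c i * conj (c j) * if (S.K : ℤ) ∣ e i - e j then (S.K : ℂ) else 0 := by
      intro j
      rw [← sum_tone, Finset.mul_sum]
      refine Finset.sum_congr rfl fun n _ => ?_
      rw [sub_eq_add_neg, tone_add]
      ring
    simp only [hterm]
    rw [Finset.sum_eq_single i]
    · simp [mul_comm]
    · intro j hj hji
      rw [if_neg fun hd => hji (he i hi j hj hd).symm, mul_zero]
    · exact fun h => absurd hi h
  apply Complex.ofReal_injective
  push_cast
  simpa only [Complex.mul_conj, Complex.normSq_eq_norm_sq, Complex.ofReal_pow] using key

/-- The inner sum is one Fourier coefficient of `f` times a trigonometric polynomial with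
coefficients `c`. Parseval over the carriers passes to samples, where `|f| = 1` drops out, and
orthogonality of the tones returns `∑ |c_i|²`. -/
theorem sum_carriers_norm_sq_sum_nDFT {f : Fin S.K → ℂ} (hf : ∀ n, ‖f n‖ = 1) {ι : Type*}
    (s : Finset ι) (e : ι → ℤ) (he : ∀ i ∈ s, ∀ j ∈ s, (S.K : ℤ) ∣ e i - e j → i = j) (c : ι → ℂ)
    (k : ℤ) :
    ∑ l ∈ S.carriers, ‖∑ i ∈ s, c i * S.nDFT f (k + e i - l)‖ ^ 2 = ∑ i ∈ s, ‖c i‖ ^ 2 := by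
  have hK : (S.K : ℝ) ≠ 0 := Nat.cast_ne_zero.2 S.K_pos.ne'
  have h1 : ∀ l, ∑ i ∈ s, c i * S.nDFT f (k + e i - l)
      = S.nDFT (fun n => ∑ i ∈ s, c i * (S.tone (-e i) n * f n)) (k - l) := by
    intro l
    rw [nDFT_sum]
    refine Finset.sum_congr rfl fun i _ => ?_
    rw [nDFT_const_mul, nDFT_tone_mul]
    congr 2
    ring
  simp only [h1]
  rw [sum_carriers_norm_sq_nDFT]
  have h2 : ∀ n, ‖∑ i ∈ s, c i * (S.tone (-e i) n * f n)‖
      = ‖∑ i ∈ s, c i * S.tone (-e i) n‖ := by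
    intro n
    simp only [← mul_assoc, ← Finset.sum_mul, norm_mul, hf, mul_one]
  simp only [h2]
  rw [S.sum_norm_sq_sum_tone s (fun i => -e i), ← mul_assoc, one_div, inv_mul_cancel₀ hK, one_mul]
  intro i hi j hj hd
  refine (he j hj i hi ?_).symm
  convert hd using 1
  ring

theorem sum_symIcc_norm_sq_nDFT_le {f : Fin S.K → ℂ} (hf : ∀ n, ‖f n‖ = 1) {M : ℕ}
    (hM : 2 * M < S.K) : ∑ c ∈ symIcc M, ‖S.nDFT f c‖ ^ 2 ≤ 1 := by
  have hK : (S.K : ℝ) ≠ 0 := Nat.cast_ne_zero.2 S.K_pos.ne'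
  -- With the shift `K₂ - M`, the index `K₂ - M - l` runs over `-M, …, K - 1 - M`, which contains
  -- `-M, …, M` exactly when `2 M < K`.
  have h := S.sum_carriers_norm_sq_nDFT f (S.K₂ - M)
  simp only [hf, one_pow, Finset.sum_const, Finset.card_univ, Fintype.card_fin, nsmul_eq_mul,
    mul_one, one_div, inv_mul_cancel₀ hK] at h
  rw [← h, ← Finset.sum_image (f := fun c => ‖S.nDFT f c‖ ^ 2)
    (g := fun l => (S.K₂ : ℤ) - M - l) fun a _ b _ hab => by simpa using hab]
  refine Finset.sum_le_sum_of_subset_of_nonneg (fun c hc => ?_) fun _ _ _ => by positivity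
  simp only [Finset.mem_image, carriers, Finset.mem_Icc] at hc ⊢
  simp only [K] at hM
  exact ⟨S.K₂ - M - c, by omega, by omega⟩

theorem norm_nDFT_le {f : Fin S.K → ℂ} (hf : ∀ n, ‖f n‖ = 1) (k : ℤ) : ‖S.nDFT f k‖ ≤ 1 := by
  have hK : (S.K : ℝ) ≠ 0 := Nat.cast_ne_zero.2 S.K_pos.ne'
  have ht : ∀ n, ‖S.tone (-k) n‖ = 1 := by
    intro n
    have := congrArg norm (S.tone_mul_conj (-k) n)
    rw [norm_mul, RCLike.norm_conj, norm_one] at this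
    nlinarith [norm_nonneg (S.tone (-k) n)]
  rw [nDFT, norm_mul]
  calc _ ≤ ‖1 / (S.K : ℂ)‖ * ∑ n : Fin S.K, (1 : ℝ) := by
        gcongr
        refine (norm_sum_le _ _).trans (Finset.sum_le_sum fun n _ => ?_)
        rw [norm_mul, hf, ht, one_mul]
    _ = 1 := by
        simp [hK]

end OFDM

/-! ### Matrix estimates -/

theorem ofReal_sum_norm_sq {ι : Type*} [Fintype ι] (w : ι → ℂ) :
    ((∑ i, ‖w i‖ ^ 2 : ℝ) : ℂ) = star w ⬝ᵥ w := by
  simp only [dotProduct, Pi.star_apply, RCLike.star_def, Complex.conj_mul']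
  push_cast
  rfl

theorem star_mulVec_dotProduct_mulVec {m n : Type*} [Fintype m] [Fintype n] (A : Matrix m n ℂ)
    (w : n → ℂ) : star (A *ᵥ w) ⬝ᵥ (A *ᵥ w) = star w ⬝ᵥ ((Aᴴ * A) *ᵥ w) := by
  rw [star_mulVec, ← dotProduct_mulVec, mulVec_mulVec]

/-- `‖A w‖² ≤ λ_max(Aᴴ A) ‖w‖²`. -/
theorem sum_norm_sq_mulVec_le {m n : Type*} [Fintype m] [Fintype n] [DecidableEq n]
    (A : Matrix m n ℂ) {M : Matrix n n ℂ} (hM : M.IsHermitian) (hMA : M = Aᴴ * A) (w : n → ℂ) :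
    ∑ i, ‖(A *ᵥ w) i‖ ^ 2 ≤ (⨆ i, hM.eigenvalues i) * ∑ i, ‖w i‖ ^ 2 := by
  set V : Matrix n n ℂ := ↑(hM.eigenvectorUnitary) with hV
  obtain ⟨z, hz⟩ : ∃ z : n → ℂ, z = star V *ᵥ w := ⟨_, rfl⟩
  have hspec : M = V * diagonal (RCLike.ofReal ∘ hM.eigenvalues) * star V := by
    conv_lhs => rw [hM.spectral_theorem, Unitary.conjStarAlgAut_apply]
  have hVV : V * star V = 1 := by simp [hV]
  have h1 : ∑ i, ‖(A *ᵥ w) i‖ ^ 2 = ∑ i, hM.eigenvalues i * ‖z i‖ ^ 2 := by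
    apply Complex.ofReal_injective
    rw [ofReal_sum_norm_sq, star_mulVec_dotProduct_mulVec, ← hMA]
    generalize hM.eigenvalues = ev at hspec
    rw [hspec, ← mulVec_mulVec, ← mulVec_mulVec, dotProduct_mulVec]
    have : star w ᵥ* V = star z := by
      rw [hz, star_mulVec, star_eq_conjTranspose, conjTranspose_conjTranspose]
    rw [this, ← hz]
    simp only [dotProduct, Pi.star_apply, mulVec_diagonal, Function.comp_apply, RCLike.star_def]
    push_cast
    refine Finset.sum_congr rfl fun i _ => ?_
    rw [← Complex.conj_mul']
    simp only [Complex.coe_algebraMap]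
    ring
  have h2 : ∑ i, ‖w i‖ ^ 2 = ∑ i, ‖z i‖ ^ 2 := by
    apply Complex.ofReal_injective
    rw [ofReal_sum_norm_sq, ofReal_sum_norm_sq, hz, star_mulVec_dotProduct_mulVec,
      star_eq_conjTranspose, conjTranspose_conjTranspose, ← star_eq_conjTranspose, hVV, one_mulVec]
  rw [h1, h2, Finset.mul_sum]
  refine Finset.sum_le_sum fun i _ => ?_
  exact mul_le_mul_of_nonneg_right (le_ciSup (Set.finite_range _).bddAbove i) (by positivity)

theorem norm_sum_mul_sq_le {ι : Type*} (s : Finset ι) (f g : ι → ℂ) :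
    ‖∑ i ∈ s, f i * g i‖ ^ 2 ≤ (∑ i ∈ s, ‖f i‖ ^ 2) * ∑ i ∈ s, ‖g i‖ ^ 2 := by
  have h1 : ‖∑ i ∈ s, f i * g i‖ ≤ ∑ i ∈ s, ‖f i‖ * ‖g i‖ :=
    (norm_sum_le _ _).trans (Finset.sum_le_sum fun i _ => (norm_mul _ _).le)
  calc _ ≤ (∑ i ∈ s, ‖f i‖ * ‖g i‖) ^ 2 := by gcongr
    _ ≤ _ := Finset.sum_mul_sq_le_sq_mul_sq s _ _

/-! ### Properties of the matrices built from the reference signal -/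

namespace OFDM

variable {S : OFDM}

theorem Rp_inv_conjTranspose : (S.Rp⁻¹)ᴴ = S.Rp⁻¹ :=
  (Matrix.isHermitian_conjTranspose_mul_self S.Pmat).inv

theorem Admissible.inv_mul (hS : S.Admissible) : S.Rp⁻¹ * S.Rp = 1 :=
  nonsing_inv_mul _ hS.fullRank

theorem Admissible.mul_inv (hS : S.Admissible) : S.Rp * S.Rp⁻¹ = 1 :=
  mul_nonsing_inv _ hS.fullRank

-- The matrix is the Gram matrix of `R_p⁻¹ Pᴴ Q`. For an empty index set the supremum is `0`, so
-- `Ghat = 0` is covered.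
open ComplexOrder in
theorem Upsilon_nonneg : 0 ≤ S.Upsilon := by
  have hps : S.upsilonMat.PosSemidef := by
    have : S.upsilonMat = (S.Rp⁻¹ * S.Pmatᴴ * S.Qmat)ᴴ * (S.Rp⁻¹ * S.Pmatᴴ * S.Qmat) := by
      simp only [upsilonMat, conjTranspose_mul, conjTranspose_conjTranspose, Rp_inv_conjTranspose,
        Matrix.mul_assoc]
    rw [this]
    exact posSemidef_conjTranspose_mul_self _
  exact Real.iSup_nonneg fun i => hps.eigenvalues_nonneg i

/-- `Υ` is the squared operator norm of the leakage matrix `R_p⁻¹ Pᴴ Q`. -/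
theorem sum_norm_sq_leak_le (w : S.infIdx → ℂ) :
    ∑ u, ‖((S.Rp⁻¹ * S.Pmatᴴ * S.Qmat) *ᵥ w) u‖ ^ 2 ≤ S.Upsilon * ∑ g, ‖w g‖ ^ 2 := by
  refine sum_norm_sq_mulVec_le _ S.upsilonMat_isHermitian ?_ w
  simp only [upsilonMat, conjTranspose_mul, conjTranspose_conjTranspose, Rp_inv_conjTranspose,
    Matrix.mul_assoc]

-- An invertible Gram matrix is positive definite. The strict sign keeps the distortion energy
-- positive for every choice of channel gains.
open ComplexOrder in
theorem Rp_inv_trace_pos (hS : S.Admissible) : 0 < (S.Rp⁻¹.trace).re := by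
  have : Nonempty (symIcc S.U) := ⟨⟨0, by simp⟩⟩
  have h : S.Rp.PosDef := (posSemidef_conjTranspose_mul_self S.Pmat).posDef_iff_isUnit.2
    ((Matrix.isUnit_iff_isUnit_det _).2 hS.fullRank)
  exact (Complex.lt_def.1 h.inv.trace_pos).1

theorem norm_le_betaBar {l : ℤ} (hl : l ∈ S.carriers) : ‖S.β l‖ ≤ S.betaBar :=
  le_ciSup (f := fun k : S.carriers => ‖S.β k‖) (Set.finite_range _).bddAbove ⟨l, hl⟩

theorem mem_symIcc {n : ℕ} {a : ℤ} : a ∈ symIcc n ↔ -(n : ℤ) ≤ a ∧ a ≤ n := Finset.mem_Icc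

theorem Admissible.p_eq_zero (hS : S.Admissible) {g : ℤ} (hg : g ∉ symIcc S.Ghat) : S.p g = 0 := by
  refine hS.p_support g ?_
  rw [mem_symIcc, not_and_or] at hg
  rw [lt_abs]
  omega

/-- Removing the zero part of a convolution with the reference signal. -/
theorem Admissible.sum_p_mul (hS : S.Admissible) {u : ℤ} {M : ℕ} (hu : u ∈ symIcc M)
    (F : ℤ → ℂ) : ∑ g ∈ symIcc S.Ghat, S.p g * F g
      = ∑ v ∈ symIcc (S.Ghat + M), S.p (v - u) * F (v - u) := by
  rw [mem_symIcc] at hu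
  rw [← Finset.sum_image (s := symIcc (S.Ghat + M)) (f := fun g => S.p g * F g)
    (g := fun v => v - u) fun a _ b _ h => by simpa using h]
  refine Finset.sum_subset (fun g hg => ?_) fun g _ hg => by rw [hS.p_eq_zero hg, zero_mul]
  rw [mem_symIcc] at hg
  exact Finset.mem_image.2 ⟨g + u, mem_symIcc.2 ⟨by push_cast; omega, by push_cast; omega⟩, by ring⟩

/-- The reference signal seen through the phase noise, as a product with `P` and `Q`. -/
theorem Admissible.toeplitz (hS : S.Admissible) (F : ℤ → ℂ) (v : symIcc (S.Ghat + S.U)) :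
    ∑ g ∈ symIcc S.Ghat, S.p g * F (v - g)
      = (S.Pmat *ᵥ fun u : symIcc S.U => F u) v + (S.Qmat *ᵥ fun g : S.infIdx => F g) v := by
  have hsub : symIcc S.U ⊆ symIcc (2 * S.Ghat + S.U) :=
    Finset.Icc_subset_Icc (by push_cast; omega) (by push_cast; omega)
  have hv := mem_symIcc.1 v.2
  push_cast at hv
  -- Substitute `c = v - g`. Since `|v| ≤ Ghat + U` and `|g| ≤ Ghat`, `c` stays within `2 Ghat + U`,
  -- and the indices added to fill that window meet a zero of `p`.
  have h1 : ∑ g ∈ symIcc S.Ghat, S.p g * F (v - g)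
      = ∑ c ∈ symIcc (2 * S.Ghat + S.U), S.p (v - c) * F c := by
    have h2 := Finset.sum_subset (s₁ := (symIcc S.Ghat).image fun g => (v : ℤ) - g)
      (s₂ := symIcc (2 * S.Ghat + S.U)) (f := fun c => S.p (v - c) * F c) (fun c hc => by
        obtain ⟨g, hg, rfl⟩ := Finset.mem_image.1 hc
        have := mem_symIcc.1 hg
        exact mem_symIcc.2 ⟨by push_cast; omega, by push_cast; omega⟩) (fun c _ hc => by
        rw [hS.p_eq_zero fun h => hc (Finset.mem_image.2 ⟨v - c, h, by ring⟩), zero_mul])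
    rw [← h2, Finset.sum_image fun a _ b _ h => by simpa using h]
    simp only [sub_sub_cancel]
  rw [h1]
  simp only [mulVec, dotProduct, Pmat, Qmat, of_apply]
  rw [Finset.sum_coe_sort (symIcc S.U) (fun c => S.p (v - c) * F c),
    Finset.sum_coe_sort S.infIdx (fun c => S.p (v - c) * F c), infIdx,
    add_comm (∑ c ∈ symIcc S.U, _),
    Finset.sum_sdiff hsub]

end OFDM

namespace OFDM

variable (S : OFDM)

/-! ### Receiver quantities as functions of the phase noise and of the channel noise -/

/-- The phase-noise coefficient `Ω_k` as a function of the phase-noise samples. -/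
def phaseCoef (t : Fin S.K → ℝ) (k : ℤ) : ℂ :=
  S.nDFT (fun n => Complex.exp (Complex.I * (t n : ℂ))) k

/-- The leakage vector as a function of the phase-noise samples. -/
def phaseLeak (t : Fin S.K → ℝ) : symIcc S.U → ℂ :=
  (S.Rp⁻¹ * S.Pmatᴴ * S.Qmat) *ᵥ fun g : S.infIdx => S.phaseCoef t g

/-- The combining coefficient of `Ω_u` as a function of the phase-noise samples. -/
def combCoef (t : Fin S.K → ℝ) (u : symIcc S.U) : ℂ :=
  conj (S.phaseCoef t u + S.phaseLeak t u)

/-- The estimation noise as a function of the channel-noise coefficients. -/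
def estNoise (V : symIcc (S.Ghat + S.U) → ℂ) : symIcc S.U → ℂ := (S.Rp⁻¹ * S.Pmatᴴ) *ᵥ V

/-- Sub-carrier `k` of `e^{j θ}` shifted by `g`, combined over `u`. -/
def combGain (t : Fin S.K → ℝ) (j : ℤ) (c : symIcc S.U → ℂ) (g : ℤ) : ℂ :=
  ∑ u, c u * S.phaseCoef t (j + (u : ℤ) - g)

theorem continuous_phaseCoef (k : ℤ) : Continuous fun t => S.phaseCoef t k := by
  unfold phaseCoef nDFT; fun_prop

theorem continuous_phaseLeak (u : symIcc S.U) : Continuous fun t => S.phaseLeak t u := by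
  have := S.continuous_phaseCoef
  simp only [phaseLeak, mulVec, dotProduct]; fun_prop

theorem continuous_combCoef (u : symIcc S.U) : Continuous fun t => S.combCoef t u := by
  have h1 := S.continuous_phaseCoef
  have h2 := S.continuous_phaseLeak
  unfold combCoef; fun_prop

theorem continuous_estNoise (u : symIcc S.U) : Continuous fun V => S.estNoise V u := by
  simp only [estNoise, mulVec, dotProduct]; fun_prop

theorem norm_phasor (t : Fin S.K → ℝ) (n : Fin S.K) :
    ‖Complex.exp (Complex.I * (t n : ℂ))‖ = 1 := by
  rw [mul_comm, Complex.norm_exp_ofReal_mul_I]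

theorem norm_phaseCoef_le (t : Fin S.K → ℝ) (k : ℤ) : ‖S.phaseCoef t k‖ ≤ 1 :=
  S.norm_nDFT_le (S.norm_phasor t) k

variable {S}

theorem eq_of_dvd_sub {a b : ℤ} {M : ℕ} (hM : 2 * M < S.K) (ha : a ∈ symIcc M)
    (hb : b ∈ symIcc M) (h : (S.K : ℤ) ∣ a - b) : a = b := by
  rw [mem_symIcc] at ha hb
  have := Int.eq_zero_of_abs_lt_dvd h (abs_lt.2 ⟨by omega, by omega⟩)
  omega

theorem Admissible.two_U_lt (hS : S.Admissible) : 2 * S.U < S.K := by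
  have := hS.distinct; omega

theorem Admissible.two_GU_lt (hS : S.Admissible) : 2 * (S.Ghat + S.U) < S.K := by
  have := hS.distinct; omega

/-- Phase noise preserves energy: the combined gains over all carriers. -/
theorem Admissible.sum_norm_sq_combGain (hS : S.Admissible) (t : Fin S.K → ℝ) (k : ℤ)
    (c : symIcc S.U → ℂ) :
    ∑ l ∈ S.carriers, ‖S.combGain t k c l‖ ^ 2 = ∑ u, ‖c u‖ ^ 2 :=
  S.sum_carriers_norm_sq_sum_nDFT (S.norm_phasor t) Finset.univ (fun u : symIcc S.U => (u : ℤ))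
    (fun i _ j _ h => Subtype.ext (eq_of_dvd_sub hS.two_U_lt i.2 j.2 h)) c k

theorem sum_norm_sq_phaseLeak_le (t : Fin S.K → ℝ) :
    ∑ u, ‖S.phaseLeak t u‖ ^ 2 ≤ S.Upsilon * ∑ g : S.infIdx, ‖S.phaseCoef t g‖ ^ 2 :=
  sum_norm_sq_leak_le _

theorem symIcc_U_subset : symIcc S.U ⊆ symIcc (2 * S.Ghat + S.U) :=
  Finset.Icc_subset_Icc (by push_cast; omega) (by push_cast; omega)

theorem sum_infIdx_add (F : ℤ → ℝ) :
    ∑ g : S.infIdx, F g + ∑ u : symIcc S.U, F u = ∑ c ∈ symIcc (2 * S.Ghat + S.U), F c := by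
  rw [Finset.sum_coe_sort S.infIdx F, Finset.sum_coe_sort (symIcc S.U) F, infIdx,
    Finset.sum_sdiff symIcc_U_subset]

/-- `c = (Ω + L)^*` with `∑ |L_u|² ≤ Υ ∑ |Ω_g|²` over the disturbing indices, and all the
coefficients involved have total energy at most `1`. The bound holds pointwise, as the first
interference term needs. -/
theorem Admissible.sum_norm_sq_combCoef_le (hS : S.Admissible) (t : Fin S.K → ℝ) :
    ∑ u, ‖S.combCoef t u‖ ^ 2 ≤ 1 + S.Upsilon := by
  set a := ∑ u : symIcc S.U, ‖S.phaseCoef t u‖ ^ 2 with ha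
  set b := ∑ g : S.infIdx, ‖S.phaseCoef t g‖ ^ 2 with hb
  set L := ∑ u, ‖S.phaseLeak t u‖ ^ 2 with hL
  have hLb : L ≤ S.Upsilon * b := sum_norm_sq_phaseLeak_le t
  have hab : b + a ≤ 1 := by
    rw [ha, hb, sum_infIdx_add fun c => ‖S.phaseCoef t c‖ ^ 2]
    exact S.sum_symIcc_norm_sq_nDFT_le (S.norm_phasor t) hS.distinct
  have hU := S.Upsilon_nonneg
  have hnorm : ∀ u, ‖S.combCoef t u‖ ≤ ‖S.phaseCoef t u‖ + ‖S.phaseLeak t u‖ := fun u => by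
    rw [combCoef, RCLike.norm_conj]; exact norm_add_le _ _
  -- Young's inequality below needs `Υ⁻¹`; for `Υ = 0` the leakage vanishes outright.
  rcases hU.eq_or_lt with h0 | hpos
  · have hL0 : L = 0 := le_antisymm (by rw [← h0, zero_mul] at hLb; exact hLb)
      (Finset.sum_nonneg fun _ _ => by positivity)
    have hz : ∀ u, S.phaseLeak t u = 0 := fun u => by
      have := (Finset.sum_eq_zero_iff_of_nonneg fun _ _ => by positivity).1 hL0 u
        (Finset.mem_univ u)
      simpa using this
    have hb0 : 0 ≤ b := Finset.sum_nonneg fun _ _ => by positivity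
    have : ∑ u, ‖S.combCoef t u‖ ^ 2 = a := by simp [combCoef, hz, ha]
    linarith
  -- Young's inequality with weight `Υ`: the slack is `Υ⁻¹ (Υ |Ω_u| - |L_u|)²`. With this weight `(1
  -- + Υ⁻¹) Υ = 1 + Υ`, so both energies receive the same factor.
  · have hstep : ∀ u, ‖S.combCoef t u‖ ^ 2
        ≤ (1 + S.Upsilon) * ‖S.phaseCoef t u‖ ^ 2 + (1 + S.Upsilon⁻¹) * ‖S.phaseLeak t u‖ ^ 2 := by
      intro u
      have h1 : ‖S.combCoef t u‖ ^ 2 ≤ (‖S.phaseCoef t u‖ + ‖S.phaseLeak t u‖) ^ 2 := by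
        gcongr; exact hnorm u
      have h2 : 0 ≤ S.Upsilon⁻¹ * (S.Upsilon * ‖S.phaseCoef t u‖ - ‖S.phaseLeak t u‖) ^ 2 := by
        positivity
      have h3 : S.Upsilon⁻¹ * (S.Upsilon * ‖S.phaseCoef t u‖ - ‖S.phaseLeak t u‖) ^ 2
          = S.Upsilon * ‖S.phaseCoef t u‖ ^ 2 - 2 * (‖S.phaseCoef t u‖ * ‖S.phaseLeak t u‖)
            + S.Upsilon⁻¹ * ‖S.phaseLeak t u‖ ^ 2 := by
        field_simp
        ring
      nlinarith
    calc _ ≤ ∑ u : symIcc S.U, ((1 + S.Upsilon) * ‖S.phaseCoef t u‖ ^ 2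
          + (1 + S.Upsilon⁻¹) * ‖S.phaseLeak t u‖ ^ 2) := Finset.sum_le_sum fun u _ => hstep u
      _ = (1 + S.Upsilon) * a + (1 + S.Upsilon⁻¹) * L := by
        rw [Finset.sum_add_distrib, Finset.mul_sum, Finset.mul_sum]
      _ ≤ (1 + S.Upsilon) * a + (1 + S.Upsilon⁻¹) * (S.Upsilon * b) := by
        gcongr
      _ = (1 + S.Upsilon) * (b + a) := by field_simp; ring
      _ ≤ (1 + S.Upsilon) * 1 := by gcongr
      _ = _ := mul_one _

/-- The reversed matrix `P` has the same Gram matrix up to transposition. -/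
theorem Admissible.sum_norm_sq_reverse (hS : S.Admissible) (c : symIcc S.U → ℂ) :
    ∑ v ∈ symIcc (S.Ghat + S.U), ‖∑ u, conj (c u) * S.p (v + (u : ℤ))‖ ^ 2
      = ∑ v, ‖(S.Pmat *ᵥ c) v‖ ^ 2 := by
  -- Both sums are the autocorrelation of `p` at lag `u' - u`, through `m = v + u` and `m = v - u'`;
  -- either window covers the whole support of `p`.
  have hcorr : ∀ u u' : symIcc S.U,
      ∑ v ∈ symIcc (S.Ghat + S.U), S.p (v + (u : ℤ)) * conj (S.p (v + (u' : ℤ)))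
        = ∑ v ∈ symIcc (S.Ghat + S.U), S.p (v - (u' : ℤ)) * conj (S.p (v - (u : ℤ))) := by
    intro u u'
    have hu : (-(u : ℤ)) ∈ symIcc S.U := by
      have := mem_symIcc.1 u.2; exact mem_symIcc.2 ⟨by omega, by omega⟩
    have h1 := hS.sum_p_mul hu fun m => conj (S.p (m + ((u' : ℤ) - u)))
    have h2 := hS.sum_p_mul u'.2 fun m => conj (S.p (m + ((u' : ℤ) - u)))
    have e1 : ∀ v : ℤ, v + (u : ℤ) + ((u' : ℤ) - u) = v + u' := fun v => by ring
    have e2 : ∀ v : ℤ, v - (u' : ℤ) + ((u' : ℤ) - u) = v - u := fun v => by ring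
    simp only [sub_neg_eq_add, e1] at h1
    simp only [e2] at h2
    rw [← h1, h2]
  apply Complex.ofReal_injective
  push_cast
  simp only [← Complex.mul_conj', map_sum, map_mul, Complex.conj_conj, Finset.sum_mul_sum, mulVec,
    dotProduct, Pmat, of_apply]
  rw [Finset.sum_coe_sort (symIcc (S.Ghat + S.U)) (fun v => ∑ i : symIcc S.U, ∑ j : symIcc S.U,
    S.p (v - i) * c i * (conj (S.p (v - j)) * conj (c j)))]
  have swap : ∀ F : ℤ → symIcc S.U → symIcc S.U → ℂ,
      ∑ v ∈ symIcc (S.Ghat + S.U), ∑ i, ∑ j, F v i j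
        = ∑ i, ∑ j, ∑ v ∈ symIcc (S.Ghat + S.U), F v i j := by
    intro F
    rw [Finset.sum_comm]
    exact Finset.sum_congr rfl fun i _ => Finset.sum_comm
  rw [swap, swap, Finset.sum_comm]
  refine Finset.sum_congr rfl fun i _ => Finset.sum_congr rfl fun j _ => ?_
  have := hcorr j i
  calc _ = conj (c j) * c i * ∑ v ∈ symIcc (S.Ghat + S.U),
        S.p (v + (j : ℤ)) * conj (S.p (v + (i : ℤ))) := by
        rw [Finset.mul_sum]; exact Finset.sum_congr rfl fun v _ => by ring
    _ = _ := by
        rw [this, Finset.mul_sum]; exact Finset.sum_congr rfl fun v _ => by ring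

/-- Cauchy-Schwarz for the reference signal combined with the estimation noise. -/
theorem Admissible.norm_sq_sum_combGain_le (hS : S.Admissible) (t : Fin S.K → ℝ) (k : ℤ)
    (c : symIcc S.U → ℂ) :
    ‖∑ g ∈ symIcc S.Ghat, S.p g * S.combGain t k (fun u => conj (c u)) g‖ ^ 2
      ≤ (∑ v, ‖(S.Pmat *ᵥ c) v‖ ^ 2)
        * ∑ v ∈ symIcc (S.Ghat + S.U), ‖S.phaseCoef t (k - v)‖ ^ 2 := by
  -- Reindexing by `v = g - u` turns `Ω_{k+u-g}` into `Ω_{k-v}`, which no longer depends on `u`.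
  -- Cauchy-Schwarz over `v` then separates estimation noise from phase noise.
  have h : ∑ g ∈ symIcc S.Ghat, S.p g * S.combGain t k (fun u => conj (c u)) g
      = ∑ v ∈ symIcc (S.Ghat + S.U), (∑ u, conj (c u) * S.p (v + (u : ℤ)))
          * S.phaseCoef t (k - v) := by
    simp only [combGain, Finset.mul_sum, Finset.sum_mul]
    rw [Finset.sum_comm, Finset.sum_comm (s := symIcc (S.Ghat + S.U))]
    refine Finset.sum_congr rfl fun u _ => ?_
    have hu : (-(u : ℤ)) ∈ symIcc S.U := by
      have := mem_symIcc.1 u.2; exact mem_symIcc.2 ⟨by omega, by omega⟩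
    have := hS.sum_p_mul hu fun g => conj (c u) * S.phaseCoef t (k + (u : ℤ) - g)
    rw [this]
    refine Finset.sum_congr rfl fun v _ => ?_
    rw [sub_neg_eq_add, show k + (u : ℤ) - (v + u) = k - v by ring]
    ring
  rw [h]
  refine (norm_sum_mul_sq_le _ _ _).trans_eq ?_
  rw [hS.sum_norm_sq_reverse]

end OFDM

/-! ### Receiver outputs in terms of the coefficients `Ω_k` and `W_k` -/

namespace Signals

variable {S : OFDM} {Ω : Type*} (T : Signals S Ω)

/-- The phase-noise samples as a random vector. -/
def phase (ω : Ω) : Fin S.K → ℝ := fun n => T.θ n ω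

/-- The channel-noise coefficients that enter the estimate. -/
def noiseVec (ω : Ω) : symIcc (S.Ghat + S.U) → ℂ := fun v => T.W (v : ℤ) ω

theorem Om_eq (k : ℤ) (ω : Ω) : T.Om k ω = S.phaseCoef (T.phase ω) k := rfl

theorem leak_eq (ω : Ω) : T.leak ω = S.phaseLeak (T.phase ω) := rfl

theorem What_eq (u : symIcc S.U) (ω : Ω) : T.What u ω = S.estNoise (T.noiseVec ω) u := rfl

theorem nDFT_refPart_mul (k : ℤ) (ω : Ω) :
    S.nDFT (fun n => refPart n * Complex.exp (Complex.I * (T.θ n ω : ℂ))) k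
      = ∑ g ∈ symIcc S.Ghat, S.β 0 * S.p g * T.Om (k - g) ω := by
  simp only [refPart, Finset.sum_mul, mul_assoc (_ * S.p _)]
  rw [S.nDFT_sum]
  refine Finset.sum_congr rfl fun g _ => ?_
  rw [S.nDFT_const_mul, S.nDFT_tone_mul]
  rfl

theorem nDFT_dataPart_mul (k : ℤ) (ω : Ω) :
    S.nDFT (fun n => T.dataPart n ω * Complex.exp (Complex.I * (T.θ n ω : ℂ))) k
      = ∑ l ∈ S.dataIdx, S.β l * T.x l ω * T.Om (k - l) ω := by
  simp only [dataPart, Finset.sum_mul, mul_assoc (_ * T.x _ _)]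
  rw [S.nDFT_sum]
  refine Finset.sum_congr rfl fun g _ => ?_
  rw [S.nDFT_const_mul, S.nDFT_tone_mul]
  rfl

theorem Y_eq (k : ℤ) (ω : Ω) :
    T.Y k ω = ∑ g ∈ symIcc S.Ghat, S.β 0 * S.p g * T.Om (k - g) ω
      + ∑ l ∈ S.dataIdx, S.β l * T.x l ω * T.Om (k - l) ω + T.W k ω := by
  simp only [Y, add_mul, S.nDFT_add, nDFT_refPart_mul, nDFT_dataPart_mul, W]

theorem Yref_eq (k : ℤ) (ω : Ω) :
    T.Yref k ω = ∑ g ∈ symIcc S.Ghat, S.β 0 * S.p g * T.Om (k - g) ω + T.W k ω := by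
  simp only [Yref, S.nDFT_add, nDFT_refPart_mul, W]

/-- The observation is `β₀ (P Ω^(U) + Q Ω^(inf)) + W`. Least squares inverts `P` on the left, so
what remains besides the wanted coefficients is the leakage through `Q` and the filtered noise. -/
theorem est_eq (hS : S.Admissible) (u : symIcc S.U) (ω : Ω) :
    T.est ω u = S.β 0 * conj (S.combCoef (T.phase ω) u) + T.What u ω := by
  have h1 : (fun v : symIcc (S.Ghat + S.U) => T.Yref (v : ℤ) ω)
      = S.β 0 • (S.Pmat *ᵥ (fun u : symIcc S.U => T.Om u ω)
        + S.Qmat *ᵥ fun g : S.infIdx => T.Om g ω)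
        + (fun v : symIcc (S.Ghat + S.U) => T.W (v : ℤ) ω) := by
    ext v
    simp only [Yref_eq, mul_assoc, ← Finset.mul_sum, Pi.add_apply, Pi.smul_apply, smul_eq_mul]
    rw [hS.toeplitz (fun c => T.Om c ω) v]
  rw [est, h1, mulVec_add, mulVec_smul, mulVec_add, mulVec_mulVec, mulVec_mulVec,
    Matrix.mul_assoc _ _ S.Pmat, show S.Pmatᴴ * S.Pmat = S.Rp from rfl, hS.inv_mul, one_mulVec]
  simp only [Pi.add_apply, Pi.smul_apply, smul_eq_mul, OFDM.combCoef, Complex.conj_conj]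
  rfl

/-! ### The components in affine form -/

theorem Z1_eq (k : ℤ) (ω : Ω) : T.Z1 k ω = S.β 0 * ∑ g ∈ symIcc S.Ghat,
    S.p g * S.combGain (T.phase ω) k (fun u => conj (S.estNoise (T.noiseVec ω) u)) g := by
  simp only [Z1, What_eq, OFDM.combGain, Finset.mul_sum]
  rw [Finset.sum_comm]
  refine Finset.sum_congr rfl fun g _ => Finset.sum_congr rfl fun u _ => ?_
  rw [Om_eq]; ring

theorem Z2_eq (k : ℤ) (ω : Ω) : T.Z2 k ω = ∑ l : S.dataIdx, T.x l ω * (S.β l *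
    S.combGain (T.phase ω) k (fun u => conj (S.estNoise (T.noiseVec ω) u)) l) := by
  rw [Finset.sum_coe_sort S.dataIdx (fun l => T.x l ω * (S.β l *
    S.combGain (T.phase ω) k (fun u => conj (S.estNoise (T.noiseVec ω) u)) l))]
  simp only [Z2, What_eq, OFDM.combGain, Finset.mul_sum]
  rw [Finset.sum_comm]
  refine Finset.sum_congr rfl fun l _ => Finset.sum_congr rfl fun u _ => ?_
  rw [Om_eq]; ring

theorem Z4_eq (k : ℤ) (ω : Ω) : T.Z4 k ω = ∑ u : symIcc S.U,
    T.W (k + (u : ℤ)) ω * conj (S.estNoise (T.noiseVec ω) u) := by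
  simp only [Z4, What_eq]
  exact Finset.sum_congr rfl fun u _ => by ring

variable [MeasurableSpace Ω] (P : Measure Ω)

/-- The `χ`-terms of `coef` and `Phi` cancel. The decomposition by `χ` only prepares the splitting
off of the mean gain; the combining coefficient itself is a fixed function of the phase noise. -/
theorem coef_eq (u : symIcc S.U) (ω : Ω) : T.coef P u ω = S.combCoef (T.phase ω) u := by
  simp only [coef, Phi, OFDM.combCoef, ← Om_eq, ← leak_eq, map_add, map_sub, map_mul]
  ring

theorem Delta_re (c : ℤ) : (T.Delta P c c).re = ∫ ω, ‖T.Om c ω‖ ^ 2 ∂P := by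
  simp only [Delta, Complex.mul_conj']
  have : ∫ ω, ((‖T.Om c ω‖ : ℂ)) ^ 2 ∂P = ((∫ ω, ‖T.Om c ω‖ ^ 2 ∂P : ℝ) : ℂ) := by
    rw [← integral_complex_ofReal]; push_cast; rfl
  rw [this, Complex.ofReal_re]

theorem mu_eq_add (a : ℤ) (b : ℕ) :
    T.mu P a b = ∑ c ∈ symIcc b, ∫ ω, ‖T.Om (a + c) ω‖ ^ 2 ∂P := by
  simp only [mu, Delta_re]
  rw [← Finset.sum_image (s := symIcc b) (f := fun c => ∫ ω, ‖T.Om c ω‖ ^ 2 ∂P)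
    (g := fun c => a + c) fun x _ y _ h => by simpa using h]
  congr 1
  ext c
  simp only [Finset.mem_Icc, Finset.mem_image]
  exact ⟨fun h => ⟨c - a, by omega, by ring⟩, by rintro ⟨d, hd, rfl⟩; omega⟩

theorem mu_eq_sub (a : ℤ) (b : ℕ) :
    T.mu P a b = ∑ c ∈ symIcc b, ∫ ω, ‖T.Om (a - c) ω‖ ^ 2 ∂P := by
  rw [mu_eq_add]
  refine Finset.sum_nbij' (fun c => -c) (fun c => -c) ?_ ?_ (by simp) (by simp) (by simp)
  all_goals intro c hc; simp only [Finset.mem_Icc] at hc ⊢; omega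

theorem mu_zero (b : ℕ) : T.mu P 0 b = ∑ c : symIcc b, ∫ ω, ‖T.Om c ω‖ ^ 2 ∂P := by
  rw [mu_eq_add, Finset.sum_coe_sort (symIcc b) fun c => ∫ ω, ‖T.Om c ω‖ ^ 2 ∂P]
  simp only [zero_add]

/-- The gain of the wanted symbol after compensation. -/
def gain (k : ℤ) : ℂ := conj (S.β 0) * S.β k * ((1 + conj (T.chi P)) * (T.mu P 0 S.U : ℂ))

theorem Shat_eq (k : ℤ) (ω : Ω) : T.Shat P k ω = T.gain P k * T.x k ω := by
  simp only [Shat, gain, mu_zero, ← Finset.mul_sum]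
  push_cast
  ring

theorem I1_eq (k : ℤ) (ω : Ω) : T.I1 P k ω = ((‖S.β 0‖ ^ 2 : ℝ) : ℂ) *
    ∑ g ∈ symIcc S.Ghat, S.p g * S.combGain (T.phase ω) k (S.combCoef (T.phase ω)) g := by
  simp only [I1, coef_eq, OFDM.combGain, Finset.mul_sum]
  rw [Finset.sum_comm]
  refine Finset.sum_congr rfl fun g _ => Finset.sum_congr rfl fun u _ => ?_
  rw [Om_eq]; ring

/-- The two parts of `I2` merge into one sum over the data: for `l = k` the shift `k + u - k` is
`u`, and the mean gain is removed from that term only. -/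
theorem I2_eq {k : ℤ} (hk : k ∈ S.dataIdx) (ω : Ω) : T.I2 P k ω = ∑ l : S.dataIdx,
    T.x l ω * (conj (S.β 0) * S.β l * (S.combGain (T.phase ω) k (S.combCoef (T.phase ω)) l
      - if (l : ℤ) = k then (1 + conj (T.chi P)) * (T.mu P 0 S.U : ℂ) else 0)) := by
  rw [Finset.sum_coe_sort S.dataIdx (fun l => T.x l ω * (conj (S.β 0) * S.β l *
    (S.combGain (T.phase ω) k (S.combCoef (T.phase ω)) l
      - if l = k then (1 + conj (T.chi P)) * (T.mu P 0 S.U : ℂ) else 0))),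
    ← Finset.sum_erase_add _ _ hk, I2]
  congr 1
  · rw [Finset.sum_comm]
    refine Finset.sum_congr rfl fun l hl => ?_
    rw [if_neg (Finset.ne_of_mem_erase hl), sub_zero, OFDM.combGain, Finset.mul_sum,
      Finset.mul_sum]
    refine Finset.sum_congr rfl fun u _ => ?_
    rw [coef_eq, Om_eq]; ring
  · simp only [if_true, OFDM.combGain, coef_eq, Om_eq, add_sub_cancel_left]
    ring

theorem Z3_eq (k : ℤ) (ω : Ω) : T.Z3 P k ω = ∑ u : symIcc S.U,
    T.W (k + (u : ℤ)) ω * (conj (S.β 0) * S.combCoef (T.phase ω) u) := by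
  simp only [Z3, coef_eq]
  exact Finset.sum_congr rfl fun u _ => by ring

theorem Yhat_eq (hS : S.Admissible) {k : ℤ} (hk : k ∈ S.dataIdx) (ω : Ω) :
    T.Yhat k ω = T.Shat P k ω + T.Ihat P k ω + T.Zhat P k ω := by
  have hest : ∀ u, conj (T.est ω u) = conj (S.β 0) * T.coef P u ω + conj (T.What u ω) := by
    intro u
    rw [est_eq T hS, coef_eq]
    simp
  have hI1 : T.I1 P k ω = ∑ u : symIcc S.U, conj (S.β 0) * T.coef P u ω *
      ∑ g ∈ symIcc S.Ghat, S.β 0 * S.p g * T.Om (k + (u : ℤ) - g) ω := by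
    simp only [I1, Finset.mul_sum]
    refine Finset.sum_congr rfl fun u _ => Finset.sum_congr rfl fun g _ => ?_
    push_cast
    rw [← Complex.conj_mul']
    ring
  have hZ1 : T.Z1 k ω = ∑ u : symIcc S.U, conj (T.What u ω) *
      ∑ g ∈ symIcc S.Ghat, S.β 0 * S.p g * T.Om (k + (u : ℤ) - g) ω := by
    simp only [Z1, Finset.mul_sum]
    exact Finset.sum_congr rfl fun u _ => Finset.sum_congr rfl fun g _ => by ring
  have hZ2 : T.Z2 k ω = ∑ u : symIcc S.U, conj (T.What u ω) *
      ∑ l ∈ S.dataIdx, S.β l * T.x l ω * T.Om (k + (u : ℤ) - l) ω := by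
    simp only [Z2, Finset.mul_sum]
    exact Finset.sum_congr rfl fun u _ => Finset.sum_congr rfl fun g _ => by ring
  -- The mean gain subtracted in `I2` is what `Shat` restores, so together they form the full data
  -- term.
  have hI2 : T.Shat P k ω + T.I2 P k ω = ∑ u : symIcc S.U, conj (S.β 0) * T.coef P u ω *
      ∑ l ∈ S.dataIdx, S.β l * T.x l ω * T.Om (k + (u : ℤ) - l) ω := by
    rw [Shat_eq, gain, I2]
    have : ∀ u : symIcc S.U, conj (S.β 0) * T.coef P u ω *
        ∑ l ∈ S.dataIdx, S.β l * T.x l ω * T.Om (k + (u : ℤ) - l) ω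
        = (∑ l ∈ S.dataIdx.erase k,
          conj (S.β 0) * S.β l * T.x l ω * T.coef P u ω * T.Om (k + (u : ℤ) - l) ω)
          + conj (S.β 0) * S.β k * T.x k ω * (T.coef P u ω * T.Om (u : ℤ) ω) := by
      intro u
      rw [← Finset.sum_erase_add _ _ hk, mul_add, Finset.mul_sum, add_sub_cancel_left]
      congr 1
      · exact Finset.sum_congr rfl fun l _ => by ring
      · ring
    simp only [this, Finset.sum_add_distrib, ← Finset.mul_sum]
    ring
  have hY : T.Yhat k ω = (∑ u : symIcc S.U, conj (S.β 0) * T.coef P u ω *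
      ∑ g ∈ symIcc S.Ghat, S.β 0 * S.p g * T.Om (k + (u : ℤ) - g) ω)
      + (∑ u : symIcc S.U, conj (S.β 0) * T.coef P u ω *
      ∑ l ∈ S.dataIdx, S.β l * T.x l ω * T.Om (k + (u : ℤ) - l) ω)
      + (∑ u : symIcc S.U, conj (T.What u ω) *
      ∑ g ∈ symIcc S.Ghat, S.β 0 * S.p g * T.Om (k + (u : ℤ) - g) ω)
      + (∑ u : symIcc S.U, conj (T.What u ω) *
      ∑ l ∈ S.dataIdx, S.β l * T.x l ω * T.Om (k + (u : ℤ) - l) ω)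
      + T.Z3 P k ω + T.Z4 k ω := by
    rw [Yhat, Z3, Z4]
    simp only [← Finset.sum_add_distrib]
    refine Finset.sum_congr rfl fun u _ => ?_
    rw [hest, Y_eq]
    ring
  rw [hY, Ihat, Zhat, ← hI1, ← hI2, ← hZ1, ← hZ2]
  ring

end Signals

namespace Signals

variable {S : OFDM} {Ω : Type*} [MeasurableSpace Ω] {T : Signals S Ω} {P : Measure Ω}

/-! ### Channel noise -/

theorem Lawful.hasGaussianLaw_w (hT : T.Lawful P) (n : Fin S.K) : HasGaussianLaw (T.w n) P := by
  have : IsGaussian (P.map (T.w n)) := by rw [hT.law_w]; infer_instance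
  exact IsGaussian.hasGaussianLaw

theorem Lawful.memLp_w (hT : T.Lawful P) (n : Fin S.K) : MemLp (T.w n) 2 P :=
  (hT.hasGaussianLaw_w n).memLp_two

theorem Lawful.integral_comp_w (hT : T.Lawful P) (n : Fin S.K) {f : ℂ → ℂ} (hf : Continuous f) :
    ∫ ω, f (T.w n ω) ∂P = ∫ z, f z ∂complexGaussian (S.N₀ * S.K) := by
  rw [← hT.law_w n, integral_map (hT.meas_w n).aemeasurable hf.aestronglyMeasurable]

theorem Lawful.integral_w (hT : T.Lawful P) (n : Fin S.K) : ∫ ω, T.w n ω ∂P = 0 := by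
  rw [hT.integral_comp_w n continuous_id', integral_id_complexGaussian]

theorem Lawful.integral_w_mul_w (hT : T.Lawful P) (n m : Fin S.K) :
    ∫ ω, T.w n ω * T.w m ω ∂P = 0 := by
  by_cases h : n = m
  · subst h
    have := hT.integral_comp_w n (f := fun z => z ^ 2) (by fun_prop)
    rw [integral_sq_complexGaussian] at this
    simpa only [pow_two] using this
  · rw [(hT.indep_w.indepFun h).integral_fun_mul_eq_mul_integral
      (hT.memLp_w n).aestronglyMeasurable (hT.memLp_w m).aestronglyMeasurable, hT.integral_w,
      zero_mul]

theorem Lawful.integral_w_mul_conj_w (hS : S.Admissible) (hT : T.Lawful P) (n m : Fin S.K) :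
    ∫ ω, T.w n ω * conj (T.w m ω) ∂P = if n = m then ((S.N₀ * S.K : ℝ) : ℂ) else 0 := by
  split_ifs with h
  · subst h
    rw [hT.integral_comp_w n (f := fun z => z * conj z) (by fun_prop),
      integral_normSq_complexGaussian (mul_nonneg hS.N₀_pos.le (Nat.cast_nonneg _))]
  · have hi : IndepFun (T.w n) (fun ω => conj (T.w m ω)) P :=
      (hT.indep_w.indepFun h).comp measurable_id Complex.continuous_conj.measurable
    rw [hi.integral_fun_mul_eq_mul_integral
      (hT.memLp_w n).aestronglyMeasurable (hT.memLp_w m).star.aestronglyMeasurable, hT.integral_w,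
      zero_mul]

theorem Lawful.memLp_W (hT : T.Lawful P) (a : ℤ) : MemLp (T.W a) 2 P := by
  unfold W OFDM.nDFT
  refine MemLp.const_mul ?_ _
  exact memLp_finsetSum _ fun n _ => (hT.memLp_w n).mul_const _

theorem Lawful.measurable_W (hT : T.Lawful P) (a : ℤ) : Measurable (T.W a) := by
  have := hT.meas_w
  unfold W OFDM.nDFT
  fun_prop

theorem Lawful.integral_W [IsProbabilityMeasure P] (hT : T.Lawful P) (a : ℤ) :
    ∫ ω, T.W a ω ∂P = 0 := by
  simp only [W, OFDM.nDFT]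
  rw [integral_const_mul, integral_finsetSum _ fun n _ =>
    ((hT.memLp_w n).integrable one_le_two).mul_const _]
  simp [integral_mul_const, hT.integral_w]

theorem Lawful.integral_W_mul_W (hT : T.Lawful P) (a b : ℤ) :
    ∫ ω, T.W a ω * T.W b ω ∂P = 0 := by
  have hterm : ∀ ω, T.W a ω * T.W b ω = ∑ n, ∑ m, (1 / (S.K : ℂ)) ^ 2 * (S.tone (-a) n *
      S.tone (-b) m) * (T.w n ω * T.w m ω) := by
    intro ω
    simp only [W, OFDM.nDFT]
    rw [mul_mul_mul_comm, Finset.sum_mul_sum, Finset.mul_sum]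
    refine Finset.sum_congr rfl fun n _ => ?_
    rw [Finset.mul_sum]
    exact Finset.sum_congr rfl fun m _ => by ring
  have hint : ∀ n m, Integrable (fun ω => (1 / (S.K : ℂ)) ^ 2 * (S.tone (-a) n *
      S.tone (-b) m) * (T.w n ω * T.w m ω)) P := fun n m =>
    ((hT.memLp_w n).integrable_mul (hT.memLp_w m)).const_mul _
  simp only [hterm]
  rw [integral_finsetSum _ fun n _ => integrable_finsetSum _ fun m _ => hint n m]
  refine Finset.sum_eq_zero fun n _ => ?_
  rw [integral_finsetSum _ fun m _ => hint n m]
  refine Finset.sum_eq_zero fun m _ => ?_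
  rw [integral_const_mul, hT.integral_w_mul_w, mul_zero]

/-- The discrete Fourier transform of white noise is white. The two factors `1 / K`, the variance
`N₀ K` and the `K` terms of the tone sum combine to `N₀`. -/
theorem Lawful.integral_W_mul_conj_W (hS : S.Admissible) (hT : T.Lawful P) (a b : ℤ) :
    ∫ ω, T.W a ω * conj (T.W b ω) ∂P = if (S.K : ℤ) ∣ b - a then (S.N₀ : ℂ) else 0 := by
  have hterm : ∀ ω, T.W a ω * conj (T.W b ω) = ∑ n, ∑ m, (1 / (S.K : ℂ)) ^ 2 * (S.tone (-a) n *
      S.tone b m) * (T.w n ω * conj (T.w m ω)) := by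
    intro ω
    simp only [W, OFDM.nDFT, map_mul, map_sum, map_div₀, map_one, map_natCast, OFDM.conj_tone,
      neg_neg]
    rw [mul_mul_mul_comm, Finset.sum_mul_sum, Finset.mul_sum]
    refine Finset.sum_congr rfl fun n _ => ?_
    rw [Finset.mul_sum]
    exact Finset.sum_congr rfl fun m _ => by ring
  have hint : ∀ n m, Integrable (fun ω => (1 / (S.K : ℂ)) ^ 2 * (S.tone (-a) n *
      S.tone b m) * (T.w n ω * conj (T.w m ω))) P := fun n m =>
    ((hT.memLp_w n).integrable_mul (hT.memLp_w m).star).const_mul _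
  have hK := S.K_cast_ne_zero
  simp only [hterm]
  rw [integral_finsetSum _ fun n _ => integrable_finsetSum _ fun m _ => hint n m]
  have hn : ∀ n, ∫ ω, ∑ m, (1 / (S.K : ℂ)) ^ 2 * (S.tone (-a) n *
      S.tone b m) * (T.w n ω * conj (T.w m ω)) ∂P = S.N₀ / S.K * S.tone (b - a) n := by
    intro n
    rw [integral_finsetSum _ fun m _ => hint n m]
    simp only [integral_const_mul, hT.integral_w_mul_conj_w hS, mul_ite, mul_zero,
      Finset.sum_ite_eq, Finset.mem_univ, if_true]
    rw [sub_eq_add_neg, OFDM.tone_add]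
    push_cast
    field_simp
  simp only [hn, ← Finset.mul_sum, OFDM.sum_tone]
  split_ifs
  · field_simp
  · simp

theorem Lawful.integral_norm_sq_W (hS : S.Admissible) (hT : T.Lawful P) (a : ℤ) :
    ∫ ω, ‖T.W a ω‖ ^ 2 ∂P = S.N₀ := by
  have h := hT.integral_W_mul_conj_W hS a a
  simp only [sub_self, dvd_zero, if_true, Complex.mul_conj'] at h
  have h2 : ∫ ω, ((‖T.W a ω‖ : ℂ)) ^ 2 ∂P = ((∫ ω, ‖T.W a ω‖ ^ 2 ∂P : ℝ) : ℂ) := by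
    rw [← integral_complex_ofReal]; push_cast; rfl
  rw [h2] at h
  exact_mod_cast h

/-- Noise coefficients on incongruent sets of sub-carriers are independent. -/
theorem Lawful.indepFun_W [IsProbabilityMeasure P] (hS : S.Admissible) (hT : T.Lawful P)
    {ι κ : Type*} [Fintype ι] [Fintype κ] (e : ι → ℤ) (f : κ → ℤ)
    (hef : ∀ i j, ¬ (S.K : ℤ) ∣ f j - e i) :
    IndepFun (fun ω i => T.W (e i) ω) (fun ω j => T.W (f j) ω) P := by
  -- Real and imaginary parts of all coefficients form one real-linear image of the noise vector, so
  -- they are jointly Gaussian; independence of the two blocks follows once all cross covariances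
  -- vanish.
  let part : ℂ → Bool → ℝ := fun z b => if b then z.re else z.im
  let L : (Fin S.K → ℂ) →ₗ[ℝ] ((ι × Bool → ℝ) × (κ × Bool → ℝ)) :=
    { toFun := fun z => (fun i => part (S.nDFT z (e i.1)) i.2,
        fun j => part (S.nDFT z (f j.1)) j.2)
      map_add' := by
        intro z z'
        have h : ∀ a, S.nDFT (z + z') a = S.nDFT z a + S.nDFT z' a := S.nDFT_add z z'
        refine Prod.ext ?_ ?_ <;> ext i <;> simp only [part, h, Prod.fst_add, Prod.snd_add,
          Pi.add_apply] <;> split_ifs <;> simp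
      map_smul' := by
        intro c z
        have h : ∀ a, S.nDFT (c • z) a = c * S.nDFT z a := S.nDFT_const_mul c z
        refine Prod.ext ?_ ?_ <;> ext i <;> simp only [part, h, Prod.smul_fst, Prod.smul_snd,
          Pi.smul_apply, RingHom.id_apply, smul_eq_mul] <;> split_ifs <;> simp }
  have hw : HasGaussianLaw (fun ω n => T.w n ω) P :=
    hT.indep_w.hasGaussianLaw hT.hasGaussianLaw_w
  have hL : HasGaussianLaw (fun ω => ((fun i : ι × Bool => part (T.W (e i.1) ω) i.2),
      (fun j : κ × Bool => part (T.W (f j.1) ω) j.2))) P :=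
    hw.map_fun L.toContinuousLinearMap
  have hcov : ∀ (i : ι × Bool) (j : κ × Bool), cov[fun ω => part (T.W (e i.1) ω) i.2,
      fun ω => part (T.W (f j.1) ω) j.2; P] = 0 := by
    have hpart : ∀ (a : ℤ) (b : Bool), MemLp (fun ω => part (T.W a ω) b) 2 P := by
      intro a b
      cases b
      · exact (hT.memLp_W a).im
      · exact (hT.memLp_W a).re
    have hint : ∀ a, Integrable (T.W a) P := fun a => (hT.memLp_W a).integrable one_le_two
    have hmean : ∀ (a : ℤ) (b : Bool), ∫ ω, part (T.W a ω) b ∂P = 0 := by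
      intro a b
      cases b
      · have := integral_im (hint a)
        rw [hT.integral_W] at this
        simpa [part] using this
      · have := integral_re (hint a)
        rw [hT.integral_W] at this
        simpa [part] using this
    intro i j
    rw [covariance_eq_sub (hpart _ _) (hpart _ _), hmean, zero_mul, sub_zero]
    have h1 := (hT.memLp_W (e i.1)).integrable_mul (hT.memLp_W (f j.1))
    have h2 := (hT.memLp_W (e i.1)).integrable_mul (hT.memLp_W (f j.1)).star
    have e1 := hT.integral_W_mul_W (e i.1) (f j.1)
    have e2 := hT.integral_W_mul_conj_W hS (e i.1) (f j.1)
    rw [if_neg (hef _ _)] at e2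
    have r1 : ∫ ω, (T.W (e i.1) ω * T.W (f j.1) ω).re ∂P = 0 := by
      have := integral_re h1
      simp only [Pi.mul_apply, RCLike.re_eq_complex_re, e1] at this
      simpa using this
    have m1 : ∫ ω, (T.W (e i.1) ω * T.W (f j.1) ω).im ∂P = 0 := by
      have := integral_im h1
      simp only [Pi.mul_apply, RCLike.im_eq_complex_im, e1] at this
      simpa using this
    have r2 : ∫ ω, (T.W (e i.1) ω * conj (T.W (f j.1) ω)).re ∂P = 0 := by
      have := integral_re h2
      simp only [Pi.mul_apply, Pi.star_apply, RCLike.star_def, RCLike.re_eq_complex_re, e2] at this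
      simpa using this
    have m2 : ∫ ω, (T.W (e i.1) ω * conj (T.W (f j.1) ω)).im ∂P = 0 := by
      have := integral_im h2
      simp only [Pi.mul_apply, Pi.star_apply, RCLike.star_def, RCLike.im_eq_complex_im, e2] at this
      simpa using this
    have comb : ∀ (s t : ℝ) (F G H : Ω → ℝ), Integrable F P → Integrable G P →
        ∫ ω, F ω ∂P = 0 → ∫ ω, G ω ∂P = 0 → (∀ ω, H ω = s * F ω + t * G ω) →
        ∫ ω, H ω ∂P = 0 := by
      intro s t F G H hF hG hF0 hG0 hH
      simp only [hH]
      rw [integral_add (hF.const_mul s) (hG.const_mul t), integral_const_mul, integral_const_mul,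
        hF0, hG0]
      simp
    -- Each product of real or imaginary parts is half a sum or difference of the real, or
    -- imaginary, parts of `z w^*` and `z w`. Both the covariance and the pseudo-covariance are
    -- needed.
    rcases hi : i.2 <;> rcases hj : j.2
    · refine comb (1 / 2) (-1 / 2) _ _ _ h2.re h1.re r2 r1 fun ω => ?_
      simp [part]; ring
    · refine comb (1 / 2) (1 / 2) _ _ _ h1.im h2.im m1 m2 fun ω => ?_
      simp [part]; ring
    · refine comb (1 / 2) (-1 / 2) _ _ _ h1.im h2.im m1 m2 fun ω => ?_
      simp [part]; ring
    · refine comb (1 / 2) (1 / 2) _ _ _ h1.re h2.re r1 r2 fun ω => ?_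
      simp [part]; ring
  have hmk : Measurable fun p : ℝ × ℝ => (⟨p.1, p.2⟩ : ℂ) :=
    Complex.measurableEquivRealProd.symm.measurable
  have hind := hL.indepFun_of_covariance_eval hcov
  have := hind.comp
    (φ := fun (g : ι × Bool → ℝ) (i : ι) => (⟨g (i, true), g (i, false)⟩ : ℂ))
    (ψ := fun (g : κ × Bool → ℝ) (j : κ) => (⟨g (j, true), g (j, false)⟩ : ℂ))
    (measurable_pi_lambda _ fun i => hmk.comp
      (f := fun g : ι × Bool → ℝ => (g (i, true), g (i, false)))
      (by fun_prop))
    (measurable_pi_lambda _ fun i => hmk.comp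
      (f := fun g : κ × Bool → ℝ => (g (i, true), g (i, false)))
      (by fun_prop))
  exact this

end Signals

/-! ### Separation of estimation sub-carriers from compensated sub-carriers -/

namespace OFDM

theorem dataIdx_subset_carriers (S : OFDM) : S.dataIdx ⊆ S.carriers := Finset.sdiff_subset

/-- Compensating sub-carrier `k` involves no sub-carrier used for the estimation. -/
theorem Admissible.not_dvd_of_mem_dataIdx {S : OFDM} (hS : S.Admissible) {k : ℤ}
    (hk : k ∈ S.dataIdx) (v : symIcc (S.Ghat + S.U)) (u : symIcc S.U) :
    ¬ (S.K : ℤ) ∣ k + (u : ℤ) - v := by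
  have hv := mem_symIcc.1 v.2
  have hu := mem_symIcc.1 u.2
  have h1 := hS.guard
  have h2 := hS.lower
  have h3 := hS.upper
  simp only [dataIdx, carriers, Finset.mem_sdiff, Finset.mem_Icc, not_and_or, not_le] at hk
  obtain ⟨⟨hk1, hk2⟩, hk3⟩ := hk
  have hK : (S.K : ℤ) = S.K₁ + S.K₂ + 1 := by simp [K]
  push_cast at hv
  intro h
  -- `|u - v| ≤ Ghat + 2U ≤ G`. As `G ≤ K₁` and `G ≤ K₂`, the sum `k + u - v` cannot wrap around
  -- modulo `K` on either side; as `|k| > G`, it is not zero.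
  have := Int.eq_zero_of_abs_lt_dvd h (abs_lt.2 ⟨by omega, by omega⟩)
  omega

end OFDM

/-! ### Independence of the state from the fresh variables -/

namespace Signals

variable {S : OFDM} {Ω : Type*} [MeasurableSpace Ω] {T : Signals S Ω} {P : Measure Ω}

/-- The random quantities that determine the estimate: phase noise and channel noise on the
sub-carriers used for estimation. -/
def state (T : Signals S Ω) (ω : Ω) : (Fin S.K → ℝ) × (symIcc (S.Ghat + S.U) → ℂ) :=
  (T.phase ω, T.noiseVec ω)

/-- The data and the channel noise on the sub-carriers combined for sub-carrier `k`. -/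
def fresh (T : Signals S Ω) (k : ℤ) (ω : Ω) : (S.dataIdx → ℂ) × (symIcc S.U → ℂ) :=
  (fun l => T.x l ω, fun u => T.W (k + (u : ℤ)) ω)

/-- The coordinates of `fresh`. -/
def freshCoord (S : OFDM) : S.dataIdx ⊕ symIcc S.U → (S.dataIdx → ℂ) × (symIcc S.U → ℂ) → ℂ :=
  Sum.elim (fun l g => g.1 l) fun u g => g.2 u

/-- The energies of the coordinates of `fresh`. -/
def freshEnergy (S : OFDM) : S.dataIdx ⊕ symIcc S.U → ℝ :=
  Sum.elim (fun _ => S.Ed) fun _ => S.N₀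

theorem Lawful.measurable_phase (hT : T.Lawful P) : Measurable T.phase :=
  measurable_pi_lambda _ hT.meas_θ

theorem Lawful.measurable_noiseVec (hT : T.Lawful P) : Measurable T.noiseVec :=
  measurable_pi_lambda _ fun v => hT.measurable_W v

theorem Lawful.measurable_state (hT : T.Lawful P) : Measurable T.state :=
  hT.measurable_phase.prodMk hT.measurable_noiseVec

theorem Lawful.measurable_data (hT : T.Lawful P) :
    Measurable fun ω (l : S.dataIdx) => T.x (l : ℤ) ω :=
  measurable_pi_lambda _ fun l => hT.meas_x l l.2

theorem Lawful.indepFun_phase_noiseVec (hT : T.Lawful P) : IndepFun T.phase T.noiseVec P := by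
  have h := hT.indep_θ_wx.comp (φ := id)
    (ψ := fun (g : (Fin S.K → ℂ) × (S.dataIdx → ℂ)) (v : symIcc (S.Ghat + S.U)) =>
      S.nDFT g.1 v) measurable_id (by unfold OFDM.nDFT; fun_prop)
  exact h

theorem Lawful.memLp_mulVec_noiseVec (hT : T.Lawful P) {m : Type*}
    (A : Matrix m (symIcc (S.Ghat + S.U)) ℂ) (i : m) :
    MemLp (fun ω => (A *ᵥ T.noiseVec ω) i) 2 P := by
  simp only [mulVec, dotProduct, noiseVec]
  exact memLp_finsetSum _ fun v _ => (hT.memLp_W v).const_mul _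

section

variable [IsProbabilityMeasure P]

/-- The data are independent of phase and channel noise together, the phase noise of all channel
noise, and the two groups of noise coefficients of each other. The last fact needs Gaussianity:
uncorrelated coefficients alone would not let `E|Ŵ_u|²|W_{k+u}|²` factor. -/
theorem Lawful.indepFun_state_fresh (hS : S.Admissible) (hT : T.Lawful P) {k : ℤ}
    (hk : k ∈ S.dataIdx) : IndepFun T.state (T.fresh k) P := by
  have hw : Measurable fun ω n => T.w n ω := measurable_pi_lambda _ hT.meas_w
  have hx := hT.measurable_data
  have hV' : Measurable fun ω (u : symIcc S.U) => T.W (k + (u : ℤ)) ω :=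
    measurable_pi_lambda _ fun u => hT.measurable_W _
  have a1 : IndepFun (fun ω => (T.phase ω, fun n => T.w n ω))
      (fun ω (l : S.dataIdx) => T.x (l : ℤ) ω) P :=
    indepFun_prodMk_of_indepFun hT.measurable_phase hw hx hT.indep_θ_wx hT.indep_w_x
  have a2 : IndepFun T.noiseVec (fun ω (u : symIcc S.U) => T.W (k + (u : ℤ)) ω) P :=
    hT.indepFun_W hS (fun v : symIcc (S.Ghat + S.U) => (v : ℤ))
      (fun u : symIcc S.U => k + (u : ℤ)) fun v u => hS.not_dvd_of_mem_dataIdx hk v u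
  have a3 : IndepFun T.phase
      (fun ω => (T.noiseVec ω, fun (u : symIcc S.U) => T.W (k + (u : ℤ)) ω)) P :=
    hT.indep_θ_wx.comp (φ := id)
      (ψ := fun (g : (Fin S.K → ℂ) × (S.dataIdx → ℂ)) =>
        ((fun v : symIcc (S.Ghat + S.U) => S.nDFT g.1 v),
          fun u : symIcc S.U => S.nDFT g.1 (k + (u : ℤ))))
      measurable_id (by unfold OFDM.nDFT; fun_prop)
  have a4 : IndepFun T.state (fun ω (u : symIcc S.U) => T.W (k + (u : ℤ)) ω) P :=
    indepFun_prodMk_of_indepFun hT.measurable_phase hT.measurable_noiseVec hV' a3 a2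
  have a5 : IndepFun (fun ω => ((fun (u : symIcc S.U) => T.W (k + (u : ℤ)) ω), T.state ω))
      (fun ω (l : S.dataIdx) => T.x (l : ℤ) ω) P :=
    a1.comp (φ := fun (g : (Fin S.K → ℝ) × (Fin S.K → ℂ)) =>
        ((fun u : symIcc S.U => S.nDFT g.2 (k + (u : ℤ))),
          (g.1, fun v : symIcc (S.Ghat + S.U) => S.nDFT g.2 v)))
      (by unfold OFDM.nDFT; fun_prop) measurable_id
  exact (indepFun_prodMk_of_indepFun hx hV' hT.measurable_state a5.symm a4.symm).symm

theorem Lawful.whiteFamily_fresh (hS : S.Admissible) (hT : T.Lawful P) (k : ℤ) :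
    WhiteFamily P (T.fresh k) (freshCoord S) (freshEnergy S) where
  meas := by rintro (l | u) <;> simp only [freshCoord, Sum.elim_inl, Sum.elim_inr] <;> fun_prop
  sq := by
    rintro (l | u)
    · exact hT.sq_x l l.2
    · exact hT.memLp_W _
  mean := by
    rintro (l | u)
    · exact hT.mean_x l l.2
    · exact hT.integral_W _
  energy := by
    rintro (l | u)
    · exact hT.energy_x l l.2
    · exact hT.integral_norm_sq_W hS _
  cov := by
    have hWx : ∀ (l : S.dataIdx) (u : ℤ), IndepFun (T.W u) (T.x l) P := fun l u =>
      hT.indep_w_x.comp (φ := fun g : Fin S.K → ℂ => S.nDFT g u)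
        (ψ := fun g : S.dataIdx → ℂ => g l) (by unfold OFDM.nDFT; fun_prop) (by fun_prop)
    have hconj : Measurable (conj : ℂ → ℂ) := Complex.continuous_conj.measurable
    rintro (l | u) (l' | u') hne
    · have hi : IndepFun (T.x l) (fun ω => conj (T.x l' ω)) P :=
        (hT.indep_x.indepFun fun h => hne (by rw [h])).comp measurable_id hconj
      refine (hi.integral_fun_mul_eq_mul_integral (hT.sq_x l l.2).aestronglyMeasurable
        (hT.sq_x l' l'.2).star.aestronglyMeasurable).trans ?_
      rw [hT.mean_x l l.2, zero_mul]
    · have hi : IndepFun (T.x l) (fun ω => conj (T.W (k + (u' : ℤ)) ω)) P :=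
        (hWx l _).symm.comp measurable_id hconj
      refine (hi.integral_fun_mul_eq_mul_integral (hT.sq_x l l.2).aestronglyMeasurable
        (hT.memLp_W _).star.aestronglyMeasurable).trans ?_
      rw [hT.mean_x l l.2, zero_mul]
    · have hi : IndepFun (T.W (k + (u : ℤ))) (fun ω => conj (T.x l' ω)) P :=
        (hWx l' _).comp measurable_id hconj
      refine (hi.integral_fun_mul_eq_mul_integral (hT.memLp_W _).aestronglyMeasurable
        (hT.sq_x l' l'.2).star.aestronglyMeasurable).trans ?_
      rw [hT.integral_W, zero_mul]
    · refine (hT.integral_W_mul_conj_W hS _ _).trans (if_neg fun h => hne ?_)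
      rw [add_sub_add_left_eq_sub] at h
      rw [Subtype.ext (OFDM.eq_of_dvd_sub hS.two_U_lt u'.2 u.2 h)]

/-! ### Estimation noise -/

/-- As `2 (Ghat + U) < K`, the entries of `noiseVec` lie on distinct sub-carriers and are white with
variance `N₀`; a row of `A` contributes `N₀` times its squared norm. -/
theorem Lawful.integral_sum_norm_sq_mulVec_noiseVec (hS : S.Admissible) (hT : T.Lawful P)
    {m : Type*} [Fintype m] (A : Matrix m (symIcc (S.Ghat + S.U)) ℂ) :
    ∑ i, ∫ ω, ‖(A *ᵥ T.noiseVec ω) i‖ ^ 2 ∂P = S.N₀ * (A * Aᴴ).trace.re := by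
  have h1 : ∀ i, ∫ ω, ‖(A *ᵥ T.noiseVec ω) i‖ ^ 2 ∂P = S.N₀ * ∑ v, ‖A i v‖ ^ 2 := by
    intro i
    simp only [mulVec, dotProduct, noiseVec]
    rw [integral_norm_sq_sum Finset.univ (f := fun v ω => A i v * T.W (v : ℤ) ω)
      fun v _ => (hT.memLp_W v).const_mul (A i v)]
    · simp only [norm_mul, mul_pow, integral_const_mul, hT.integral_norm_sq_W hS, Finset.mul_sum]
      exact Finset.sum_congr rfl fun v _ => mul_comm _ _
    · intro v _ v' _ hne
      have : ∀ ω, A i v * T.W v ω * conj (A i v' * T.W v' ω)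
          = A i v * conj (A i v') * (T.W v ω * conj (T.W v' ω)) := fun ω => by
        rw [map_mul]; ring
      simp only [this]
      rw [integral_const_mul, hT.integral_W_mul_conj_W hS, if_neg, mul_zero]
      exact fun h => hne (Subtype.ext (OFDM.eq_of_dvd_sub hS.two_GU_lt v'.2 v.2 h)).symm
  simp only [h1, ← Finset.mul_sum]
  congr 1
  simp only [trace, diag, mul_apply, conjTranspose_apply, RCLike.star_def, Complex.mul_conj',
    Complex.re_sum]
  refine Finset.sum_congr rfl fun i _ => Finset.sum_congr rfl fun v _ => ?_
  norm_cast

theorem Lawful.memLp_estNoise (hT : T.Lawful P) (u : symIcc S.U) :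
    MemLp (fun ω => S.estNoise (T.noiseVec ω) u) 2 P := hT.memLp_mulVec_noiseVec _ u

theorem Lawful.integral_estNoise (hT : T.Lawful P) (u : symIcc S.U) :
    ∫ ω, S.estNoise (T.noiseVec ω) u ∂P = 0 := by
  simp only [OFDM.estNoise, mulVec, dotProduct, noiseVec]
  rw [integral_finsetSum Finset.univ
    (f := fun (v : symIcc (S.Ghat + S.U)) ω => (S.Rp⁻¹ * S.Pmatᴴ) u v * T.W (v : ℤ) ω)
    fun v _ => ((hT.memLp_W v).integrable one_le_two).const_mul _]
  simp [integral_const_mul, hT.integral_W]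

/-- `A Aᴴ = R_p⁻¹ Pᴴ P R_p⁻¹ = R_p⁻¹` for `A = R_p⁻¹ Pᴴ`. -/
theorem Lawful.sum_integral_norm_sq_estNoise (hS : S.Admissible) (hT : T.Lawful P) :
    ∑ u, ∫ ω, ‖S.estNoise (T.noiseVec ω) u‖ ^ 2 ∂P = S.N₀ * (S.Rp⁻¹.trace).re := by
  simp only [OFDM.estNoise]
  rw [hT.integral_sum_norm_sq_mulVec_noiseVec hS, conjTranspose_mul, conjTranspose_conjTranspose,
    OFDM.Rp_inv_conjTranspose, Matrix.mul_assoc, ← Matrix.mul_assoc S.Pmatᴴ,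
    show S.Pmatᴴ * S.Pmat = S.Rp from rfl, hS.mul_inv, Matrix.mul_one]

/-- `P R_p⁻¹ Pᴴ` is the orthogonal projection onto the range of `P`; its trace is the rank `2U + 1`.
-/
theorem Lawful.sum_integral_norm_sq_Pmat_estNoise (hS : S.Admissible) (hT : T.Lawful P) :
    ∑ v, ∫ ω, ‖(S.Pmat *ᵥ S.estNoise (T.noiseVec ω)) v‖ ^ 2 ∂P = S.N₀ * (2 * S.U + 1) := by
  simp only [OFDM.estNoise, mulVec_mulVec]
  rw [hT.integral_sum_norm_sq_mulVec_noiseVec hS]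
  congr 1
  have h : S.Pmat * (S.Rp⁻¹ * S.Pmatᴴ) * (S.Pmat * (S.Rp⁻¹ * S.Pmatᴴ))ᴴ
      = S.Pmat * (S.Rp⁻¹ * S.Pmatᴴ) := by
    rw [conjTranspose_mul, conjTranspose_mul, conjTranspose_conjTranspose,
      OFDM.Rp_inv_conjTranspose]
    have : S.Pmat * (S.Rp⁻¹ * S.Pmatᴴ) * (S.Pmat * S.Rp⁻¹ * S.Pmatᴴ)
        = S.Pmat * (S.Rp⁻¹ * (S.Pmatᴴ * S.Pmat) * S.Rp⁻¹ * S.Pmatᴴ) := by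
      simp only [Matrix.mul_assoc]
    rw [this, show S.Pmatᴴ * S.Pmat = S.Rp from rfl, hS.inv_mul, Matrix.one_mul]
  rw [h, trace_mul_comm, Matrix.mul_assoc, show S.Pmatᴴ * S.Pmat = S.Rp from rfl, hS.inv_mul,
    trace_one]
  simp only [Fintype.card_coe, Int.card_Icc, Complex.natCast_re]
  rw [show ((S.U : ℤ) + 1 - -(S.U : ℤ)).toNat = 2 * S.U + 1 by omega]
  push_cast
  ring

/-! ### Functions of the phase noise -/

theorem Lawful.memLp_of_phase (hT : T.Lawful P) {f : (Fin S.K → ℝ) → ℂ} (hf : Continuous f)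
    {C : ℝ} (hC : ∀ t, ‖f t‖ ≤ C) : MemLp (fun ω => f (T.phase ω)) 2 P :=
  MemLp.of_bound (hf.measurable.comp hT.measurable_phase).aestronglyMeasurable C
    (Filter.Eventually.of_forall fun _ => hC _)

theorem Lawful.memLp_Om (hT : T.Lawful P) (k : ℤ) : MemLp (T.Om k) 2 P :=
  hT.memLp_of_phase (S.continuous_phaseCoef k) fun t => S.norm_phaseCoef_le t k

/-- A crude bound, from `1 + Υ ≤ (1 + Υ)²`; only boundedness matters, for square integrability. -/
theorem _root_.OFDM.Admissible.norm_combCoef_le (hS : S.Admissible) (t : Fin S.K → ℝ)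
    (u : symIcc S.U) : ‖S.combCoef t u‖ ≤ 1 + S.Upsilon := by
  have h1 := hS.sum_norm_sq_combCoef_le t
  have h2 : ‖S.combCoef t u‖ ^ 2 ≤ ∑ u, ‖S.combCoef t u‖ ^ 2 :=
    Finset.single_le_sum (f := fun u => ‖S.combCoef t u‖ ^ 2) (fun _ _ => by positivity)
      (Finset.mem_univ u)
  have h3 := S.Upsilon_nonneg
  nlinarith [norm_nonneg (S.combCoef t u)]

theorem Lawful.memLp_combCoef (hS : S.Admissible) (hT : T.Lawful P) (u : symIcc S.U) :
    MemLp (fun ω => S.combCoef (T.phase ω) u) 2 P :=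
  hT.memLp_of_phase (S.continuous_combCoef u) fun t => hS.norm_combCoef_le t u

theorem _root_.OFDM.continuous_combGain_combCoef (S : OFDM) (k l : ℤ) :
    Continuous fun t => S.combGain t k (S.combCoef t) l := by
  have h1 := S.continuous_phaseCoef
  have h2 := S.continuous_combCoef
  unfold OFDM.combGain
  fun_prop

theorem _root_.OFDM.continuous_combGain_estNoise (S : OFDM) (k l : ℤ) :
    Continuous fun s : (Fin S.K → ℝ) × (symIcc (S.Ghat + S.U) → ℂ) =>
      S.combGain s.1 k (fun u => conj (S.estNoise s.2 u)) l := by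
  unfold OFDM.combGain
  refine continuous_finsetSum _ fun u _ => ?_
  exact (Complex.continuous_conj.comp ((S.continuous_estNoise u).comp continuous_snd)).mul
    ((S.continuous_phaseCoef _).comp continuous_fst)

theorem Lawful.memLp_combGain_combCoef (hS : S.Admissible) (hT : T.Lawful P) (k l : ℤ) :
    MemLp (fun ω => S.combGain (T.phase ω) k (S.combCoef (T.phase ω)) l) 2 P := by
  refine hT.memLp_of_phase (S.continuous_combGain_combCoef k l)
    (C := ∑ _ : symIcc S.U, (1 + S.Upsilon)) fun t => ?_
  refine (norm_sum_le _ _).trans (Finset.sum_le_sum fun u _ => ?_)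
  rw [norm_mul]
  calc _ ≤ (1 + S.Upsilon) * 1 := by
        gcongr
        · exact add_nonneg zero_le_one S.Upsilon_nonneg
        · exact hS.norm_combCoef_le t u
        · exact S.norm_phaseCoef_le t _
    _ = _ := mul_one _

/-- A function of the phase noise and one of the estimation noise. -/
theorem Lawful.indepFun_comp_phase_noiseVec (hT : T.Lawful P) {α β : Type*} [MeasurableSpace α]
    [MeasurableSpace β] {f : (Fin S.K → ℝ) → α} {g : (symIcc (S.Ghat + S.U) → ℂ) → β}
    (hf : Measurable f) (hg : Measurable g) :
    IndepFun (fun ω => f (T.phase ω)) (fun ω => g (T.noiseVec ω)) P :=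
  hT.indepFun_phase_noiseVec.comp hf hg

theorem Lawful.memLp_conj_estNoise_mul (hT : T.Lawful P) (u : symIcc S.U) (k : ℤ) :
    MemLp (fun ω => conj (S.estNoise (T.noiseVec ω) u) * S.phaseCoef (T.phase ω) k) 2 P :=
  IndepFun.memLp_two_mul
    (hT.indepFun_comp_phase_noiseVec (S.continuous_phaseCoef k).measurable
      (Complex.continuous_conj.comp (S.continuous_estNoise u)).measurable).symm
    (hT.memLp_estNoise u).star (hT.memLp_Om k)

theorem Lawful.memLp_combGain_estNoise (hT : T.Lawful P) (k l : ℤ) :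
    MemLp (fun ω => S.combGain (T.phase ω) k
      (fun u => conj (S.estNoise (T.noiseVec ω) u)) l) 2 P :=
  memLp_finsetSum _ fun u _ => hT.memLp_conj_estNoise_mul u _

/-- Functions of the phase noise are orthogonal to everything linear in the estimation noise. -/
theorem Lawful.integral_phase_mul_estNoise (hT : T.Lawful P) {f : (Fin S.K → ℝ) → ℂ}
    (hf : Continuous f) (u : symIcc S.U) :
    ∫ ω, f (T.phase ω) * S.estNoise (T.noiseVec ω) u ∂P = 0 := by
  have hi := hT.indepFun_comp_phase_noiseVec hf.measurable (S.continuous_estNoise u).measurable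
  rw [hi.integral_fun_mul_eq_mul_integral
    (hf.measurable.comp hT.measurable_phase).aestronglyMeasurable
    (hT.memLp_estNoise u).aestronglyMeasurable, hT.integral_estNoise, mul_zero]

theorem Lawful.integral_phase_mul_conj_combGain (hT : T.Lawful P) {f : (Fin S.K → ℝ) → ℂ}
    (hf : Continuous f) (hf2 : MemLp (fun ω => f (T.phase ω)) 2 P) (k l : ℤ) :
    ∫ ω, f (T.phase ω) * conj (S.combGain (T.phase ω) k
      (fun u => conj (S.estNoise (T.noiseVec ω) u)) l) ∂P = 0 := by
  simp only [OFDM.combGain, map_sum, map_mul, Complex.conj_conj, Finset.mul_sum]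
  rw [integral_finsetSum]
  · refine Finset.sum_eq_zero fun u _ => ?_
    have := hT.integral_phase_mul_estNoise (f := fun t => f t * conj (S.phaseCoef t (k + u - l)))
      (hf.mul (Complex.continuous_conj.comp (S.continuous_phaseCoef _))) u
    rw [← this]
    exact integral_congr_ae (Filter.Eventually.of_forall fun ω => by ring)
  · intro u _
    have := hf2.integrable_mul (hT.memLp_conj_estNoise_mul u (k + u - l)).star
    refine this.congr (Filter.Eventually.of_forall fun ω => ?_)
    simp

end

end Signals

namespace Signals

variable {S : OFDM} {Ω : Type*} [MeasurableSpace Ω] {T : Signals S Ω} {P : Measure Ω}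
  [IsProbabilityMeasure P]

/-! ### Statistics of the combining coefficients -/

theorem Lawful.integrable_norm_sq_Om (hT : T.Lawful P) (k : ℤ) :
    Integrable (fun ω => ‖T.Om k ω‖ ^ 2) P := (hT.memLp_Om k).integrable_norm_pow two_ne_zero

theorem Lawful.memLp_leak (hT : T.Lawful P) (u : symIcc S.U) :
    MemLp (fun ω => T.leak ω u) 2 P := by
  simp only [leak, mulVec, dotProduct]
  exact memLp_finsetSum _ fun g _ => (hT.memLp_Om g).const_mul _

theorem Lawful.integrable_conj_Om_mul_leak (hT : T.Lawful P) (u : symIcc S.U) :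
    Integrable (fun ω => conj (T.Om u ω) * T.leak ω u) P :=
  (hT.memLp_Om u).star.integrable_mul (hT.memLp_leak u)

/-- If `μ(0,U) = 0` then every `Ω_u` vanishes almost surely, and so does the numerator of `χ`. The
convention for division by zero is thus consistent and no case distinction survives. -/
theorem Lawful.chi_mul_mu (hT : T.Lawful P) :
    T.chi P * (T.mu P 0 S.U : ℂ) = ∫ ω, ∑ u : symIcc S.U, conj (T.Om u ω) * T.leak ω u ∂P := by
  by_cases h : T.mu P 0 S.U = 0
  · rw [h, Complex.ofReal_zero, mul_zero]
    rw [mu_zero] at h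
    have hz : ∀ u : symIcc S.U, T.Om u =ᵐ[P] 0 := by
      intro u
      have h0 := (Finset.sum_eq_zero_iff_of_nonneg fun c _ =>
        integral_nonneg fun ω => by positivity).1 h u (Finset.mem_univ u)
      rw [integral_eq_zero_iff_of_nonneg (fun ω => by positivity)
        (hT.integrable_norm_sq_Om u)] at h0
      filter_upwards [h0] with ω hω
      simpa using hω
    symm
    refine integral_eq_zero_of_ae ?_
    filter_upwards [ae_all_iff.2 hz] with ω hω
    exact Finset.sum_eq_zero fun u _ => by simp [hω u]
  · rw [chi, div_mul_cancel₀ _ (Complex.ofReal_ne_zero.2 h)]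

/-- At the own carrier the gain is `∑ |Ω_u|² + (∑ Ω_u^* L_u)^*`, and `χ` is the normalised mean of
the last sum. This is the mean gain that `Shat` collects. -/
theorem Lawful.integral_combGain_combCoef (hT : T.Lawful P) (k : ℤ) :
    ∫ ω, S.combGain (T.phase ω) k (S.combCoef (T.phase ω)) k ∂P
      = (1 + conj (T.chi P)) * (T.mu P 0 S.U : ℂ) := by
  have hterm : ∀ ω, S.combGain (T.phase ω) k (S.combCoef (T.phase ω)) k
      = ∑ u : symIcc S.U, ((‖T.Om u ω‖ ^ 2 : ℝ) : ℂ)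
        + conj (∑ u : symIcc S.U, conj (T.Om u ω) * T.leak ω u) := by
    intro ω
    rw [map_sum, ← Finset.sum_add_distrib]
    refine Finset.sum_congr rfl fun u _ => ?_
    rw [add_sub_cancel_left, OFDM.combCoef, ← Om_eq, ← leak_eq, map_mul, Complex.conj_conj, map_add]
    push_cast
    rw [← Complex.conj_mul']
    ring
  have i1 : ∀ u : symIcc S.U, Integrable (fun ω => ((‖T.Om u ω‖ ^ 2 : ℝ) : ℂ)) P := fun u =>
    (hT.integrable_norm_sq_Om u).ofReal
  have i2 : Integrable (fun ω => conj (∑ u : symIcc S.U, conj (T.Om u ω) * T.leak ω u)) P :=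
    Complex.conjCLE.toContinuousLinearMap.integrable_comp
      (integrable_finsetSum _ fun u _ => hT.integrable_conj_Om_mul_leak u)
  simp only [hterm]
  rw [integral_add (integrable_finsetSum _ fun u _ => i1 u) i2,
    integral_finsetSum _ fun u _ => i1 u, integral_conj, ← hT.chi_mul_mu, mu_zero]
  simp only [integral_complex_ofReal, map_mul, Complex.conj_ofReal]
  push_cast
  ring

/-- Expand `|Ω_u + L_u|²`: the cross terms have mean `2 Re χ · μ(0,U)` exactly, and only the leakage
energy is estimated, by `Υ` times the mean energy of the disturbing coefficients. -/
theorem Lawful.sum_integral_norm_sq_combCoef_le (hT : T.Lawful P) :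
    ∑ u, ∫ ω, ‖S.combCoef (T.phase ω) u‖ ^ 2 ∂P ≤ T.coefEnergyBound P := by
  have hterm : ∀ u ω, ‖S.combCoef (T.phase ω) u‖ ^ 2 = ‖T.Om u ω‖ ^ 2 + ‖T.leak ω u‖ ^ 2
      + 2 * (conj (T.Om u ω) * T.leak ω u).re := by
    intro u ω
    rw [OFDM.combCoef, RCLike.norm_conj, ← Om_eq, ← leak_eq]
    simp only [← Complex.normSq_eq_norm_sq]
    rw [Complex.normSq_add]
    congr 2
    simp only [Complex.mul_re, Complex.conj_re, Complex.conj_im]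
    ring
  have il : ∀ u, Integrable (fun ω => ‖T.leak ω u‖ ^ 2) P := fun u =>
    (hT.memLp_leak u).integrable_norm_pow two_ne_zero
  have ic : ∀ u : symIcc S.U, Integrable (fun ω => (conj (T.Om u ω) * T.leak ω u).re) P :=
    fun u => (hT.integrable_conj_Om_mul_leak u).re
  have h1 : ∀ u, ∫ ω, ‖S.combCoef (T.phase ω) u‖ ^ 2 ∂P = ∫ ω, ‖T.Om u ω‖ ^ 2 ∂P
      + ∫ ω, ‖T.leak ω u‖ ^ 2 ∂P + 2 * (∫ ω, conj (T.Om u ω) * T.leak ω u ∂P).re := by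
    intro u
    simp only [hterm]
    have i1 : Integrable (fun ω => ‖T.Om u ω‖ ^ 2 + ‖T.leak ω u‖ ^ 2) P :=
      (hT.integrable_norm_sq_Om u).add (il u)
    rw [integral_add i1 ((ic u).const_mul 2), integral_add (hT.integrable_norm_sq_Om u) (il u),
      integral_const_mul]
    have := integral_re (hT.integrable_conj_Om_mul_leak u)
    simp only [RCLike.re_eq_complex_re] at this
    rw [this]
  have h2 : ∑ u : symIcc S.U, (∫ ω, conj (T.Om u ω) * T.leak ω u ∂P).re
      = (T.chi P).re * T.mu P 0 S.U := by
    rw [← Complex.re_sum, ← integral_finsetSum _ fun u _ => hT.integrable_conj_Om_mul_leak u,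
      ← hT.chi_mul_mu, Complex.re_mul_ofReal]
  have h3 : ∑ u, ∫ ω, ‖T.leak ω u‖ ^ 2 ∂P
      ≤ S.Upsilon * (T.mu P 0 (2 * S.Ghat + S.U) - T.mu P 0 S.U) := by
    have e : T.mu P 0 (2 * S.Ghat + S.U) - T.mu P 0 S.U
        = ∑ g : S.infIdx, ∫ ω, ‖T.Om g ω‖ ^ 2 ∂P := by
      rw [mu_zero, mu_zero, sub_eq_iff_eq_add,
        OFDM.sum_infIdx_add fun c => ∫ ω, ‖T.Om c ω‖ ^ 2 ∂P,
        Finset.sum_coe_sort (symIcc (2 * S.Ghat + S.U)) fun c => ∫ ω, ‖T.Om c ω‖ ^ 2 ∂P]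
    rw [e, ← integral_finsetSum _ fun u _ => il u,
      ← integral_finsetSum _ fun (g : S.infIdx) _ => hT.integrable_norm_sq_Om g,
      ← integral_const_mul]
    refine integral_mono (integrable_finsetSum _ fun u _ => il u)
      ((integrable_finsetSum _ fun (g : S.infIdx) _ => hT.integrable_norm_sq_Om g).const_mul _)
      fun ω => ?_
    exact OFDM.sum_norm_sq_phaseLeak_le (T.phase ω)
  simp only [h1, Finset.sum_add_distrib, ← Finset.mul_sum, h2, coefEnergyBound]
  rw [← mu_zero]
  linarith

/-! ### Coefficients of the affine form -/

/-- The phase-noise part of the weights of the fresh variables. -/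
def weightPhase (T : Signals S Ω) (P : Measure Ω) (k : ℤ) (i : S.dataIdx ⊕ symIcc S.U)
    (t : Fin S.K → ℝ) : ℂ :=
  Sum.elim (fun l : S.dataIdx => conj (S.β 0) * S.β l * (S.combGain t k (S.combCoef t) l
      - if (l : ℤ) = k then (1 + conj (T.chi P)) * (T.mu P 0 S.U : ℂ) else 0))
    (fun u => conj (S.β 0) * S.combCoef t u) i

/-- The estimation-noise part of the weights of the fresh variables. -/
def weightNoise (S : OFDM) (k : ℤ) (i : S.dataIdx ⊕ symIcc S.U)
    (s : (Fin S.K → ℝ) × (symIcc (S.Ghat + S.U) → ℂ)) : ℂ :=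
  Sum.elim (fun l : S.dataIdx =>
      S.β l * S.combGain s.1 k (fun u => conj (S.estNoise s.2 u)) l)
    (fun u => conj (S.estNoise s.2 u)) i

theorem continuous_weightPhase (k : ℤ) (i : S.dataIdx ⊕ symIcc S.U) :
    Continuous (T.weightPhase P k i) := by
  have h1 := S.continuous_combGain_combCoef k
  have h2 := S.continuous_combCoef
  rcases i with l | u
  · exact continuous_const.mul ((h1 l).sub continuous_const)
  · exact continuous_const.mul (h2 u)

theorem measurable_weightPhase_fst (k : ℤ) (i : S.dataIdx ⊕ symIcc S.U) :
    Measurable fun s : (Fin S.K → ℝ) × (symIcc (S.Ghat + S.U) → ℂ) => T.weightPhase P k i s.1 :=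
  (continuous_weightPhase k i).measurable.comp measurable_fst

theorem continuous_weightNoise (k : ℤ) (i : S.dataIdx ⊕ symIcc S.U) :
    Continuous (weightNoise S k i) := by
  rcases i with l | u
  · exact continuous_const.mul (S.continuous_combGain_estNoise k l)
  · exact Complex.continuous_conj.comp ((S.continuous_estNoise u).comp continuous_snd)

theorem Lawful.memLp_weightPhase (hS : S.Admissible) (hT : T.Lawful P) (k : ℤ)
    (i : S.dataIdx ⊕ symIcc S.U) : MemLp (fun ω => T.weightPhase P k i (T.phase ω)) 2 P := by
  rcases i with l | u
  · exact ((hT.memLp_combGain_combCoef hS k l).sub (memLp_const _)).const_mul _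
  · exact (hT.memLp_combCoef hS u).const_mul _

theorem Lawful.memLp_weightNoise (hT : T.Lawful P) (k : ℤ)
    (i : S.dataIdx ⊕ symIcc S.U) : MemLp (fun ω => weightNoise S k i (T.state ω)) 2 P := by
  rcases i with l | u
  · exact (hT.memLp_combGain_estNoise k l).const_mul _
  · exact (hT.memLp_estNoise u).star

/-- The noise weight is linear in the conjugated estimation noise, which is centred and independent
of the phase noise. -/
theorem Lawful.integral_weightPhase_mul_conj_weightNoise (hS : S.Admissible) (hT : T.Lawful P)
    (k : ℤ) (i : S.dataIdx ⊕ symIcc S.U) :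
    ∫ ω, T.weightPhase P k i (T.phase ω) * conj (weightNoise S k i (T.state ω)) ∂P = 0 := by
  rcases i with l | u
  · have h := hT.integral_phase_mul_conj_combGain (T.continuous_weightPhase k (.inl l))
      (hT.memLp_weightPhase hS k (.inl l)) k l
    have e : ∀ ω, T.weightPhase P k (.inl l) (T.phase ω)
          * conj (weightNoise S k (.inl l) (T.state ω))
        = conj (S.β l) * (T.weightPhase P k (.inl l) (T.phase ω) * conj (S.combGain (T.phase ω) k
          (fun u => conj (S.estNoise (T.noiseVec ω) u)) l)) := fun ω => by
      simp only [weightNoise, Sum.elim_inl, map_mul, state]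
      ring
    simp only [e]
    rw [integral_const_mul, h, mul_zero]
  · have h := hT.integral_phase_mul_estNoise (T.continuous_weightPhase (P := P) k (.inr u)) u
    simpa only [weightNoise, Sum.elim_inr, Complex.conj_conj, state] using h

theorem I2_eq_sum {k : ℤ} (hk : k ∈ S.dataIdx) (ω : Ω) :
    T.I2 P k ω = ∑ l, freshCoord S (.inl l) (T.fresh k ω) *
      T.weightPhase P k (.inl l) (T.state ω).1 := I2_eq T P hk ω

theorem Z2_eq_sum (k : ℤ) (ω : Ω) :
    T.Z2 k ω = ∑ l, freshCoord S (.inl l) (T.fresh k ω) *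
      weightNoise S k (.inl l) (T.state ω) := Z2_eq T k ω

theorem Z3_eq_sum (k : ℤ) (ω : Ω) :
    T.Z3 P k ω = ∑ u, freshCoord S (.inr u) (T.fresh k ω) *
      T.weightPhase P k (.inr u) (T.state ω).1 := Z3_eq T P k ω

theorem Z4_eq_sum (k : ℤ) (ω : Ω) :
    T.Z4 k ω = ∑ u, freshCoord S (.inr u) (T.fresh k ω) *
      weightNoise S k (.inr u) (T.state ω) := Z4_eq T k ω

/-! ### Second moments of the components -/

/-- The reference-signal interference as a function of the phase noise. -/
def baseGain (S : OFDM) (k : ℤ) (t : Fin S.K → ℝ) : ℂ :=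
  ((‖S.β 0‖ ^ 2 : ℝ) : ℂ) * ∑ g ∈ symIcc S.Ghat, S.p g * S.combGain t k (S.combCoef t) g

/-- The reference signal combined with the estimation noise. -/
def baseNoise (S : OFDM) (k : ℤ) (s : (Fin S.K → ℝ) × (symIcc (S.Ghat + S.U) → ℂ)) : ℂ :=
  S.β 0 * ∑ g ∈ symIcc S.Ghat, S.p g * S.combGain s.1 k (fun u => conj (S.estNoise s.2 u)) g

theorem continuous_baseGain (k : ℤ) : Continuous (baseGain S k) := by
  have := S.continuous_combGain_combCoef k
  unfold baseGain; fun_prop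

theorem continuous_baseNoise (k : ℤ) : Continuous (baseNoise S k) :=
  continuous_const.mul (continuous_finsetSum _ fun g _ =>
    continuous_const.mul (S.continuous_combGain_estNoise k g))

theorem Lawful.memLp_I1 (hS : S.Admissible) (hT : T.Lawful P) (k : ℤ) :
    MemLp (T.I1 P k) 2 P := by
  rw [funext (I1_eq T P k)]
  exact (memLp_finsetSum _ fun g _ => (hT.memLp_combGain_combCoef hS k g).const_mul _).const_mul _

theorem Lawful.memLp_Z1 (hT : T.Lawful P) (k : ℤ) : MemLp (T.Z1 k) 2 P := by
  rw [funext (Z1_eq T k)]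
  exact (memLp_finsetSum _ fun g _ => (hT.memLp_combGain_estNoise k g).const_mul _).const_mul _

variable {k : ℤ}

theorem Lawful.memLp_I2 (hS : S.Admissible) (hT : T.Lawful P) (hk : k ∈ S.dataIdx) :
    MemLp (T.I2 P k) 2 P := by
  rw [funext (I2_eq_sum hk)]
  have hm : ∀ l : S.dataIdx, Measurable fun s : (Fin S.K → ℝ) × (symIcc (S.Ghat + S.U) → ℂ) =>
      T.weightPhase P k (.inl l) s.1 := fun l => measurable_weightPhase_fst k (.inl l)
  have hb : ∀ l : S.dataIdx, MemLp (fun ω => T.weightPhase P k (.inl l) (T.state ω).1) 2 P :=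
    fun l => hT.memLp_weightPhase hS k (.inl l)
  have h := ((hT.whiteFamily_fresh hS k).comp_injective Sum.inl_injective).memLp_sum
    (hT.indepFun_state_fresh hS hk) hm hb
  exact h

theorem Lawful.memLp_Z2 (hS : S.Admissible) (hT : T.Lawful P) (hk : k ∈ S.dataIdx) :
    MemLp (T.Z2 k) 2 P := by
  rw [funext (Z2_eq_sum k)]
  have h := ((hT.whiteFamily_fresh hS k).comp_injective Sum.inl_injective).memLp_sum
    (hT.indepFun_state_fresh hS hk)
    (fun l => (continuous_weightNoise k (.inl l)).measurable)
    fun l => hT.memLp_weightNoise k (.inl l)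
  exact h

theorem Lawful.memLp_Z3 (hS : S.Admissible) (hT : T.Lawful P) (hk : k ∈ S.dataIdx) :
    MemLp (T.Z3 P k) 2 P := by
  rw [funext (Z3_eq_sum k)]
  have hm : ∀ l : symIcc S.U, Measurable fun s : (Fin S.K → ℝ) × (symIcc (S.Ghat + S.U) → ℂ) =>
      T.weightPhase P k (.inr l) s.1 := fun l => measurable_weightPhase_fst k (.inr l)
  have hb : ∀ l : symIcc S.U, MemLp (fun ω => T.weightPhase P k (.inr l) (T.state ω).1) 2 P :=
    fun l => hT.memLp_weightPhase hS k (.inr l)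
  have h := ((hT.whiteFamily_fresh hS k).comp_injective Sum.inr_injective).memLp_sum
    (hT.indepFun_state_fresh hS hk) hm hb
  exact h

theorem Lawful.memLp_Z4 (hS : S.Admissible) (hT : T.Lawful P) (hk : k ∈ S.dataIdx) :
    MemLp (T.Z4 k) 2 P := by
  rw [funext (Z4_eq_sum k)]
  have h := ((hT.whiteFamily_fresh hS k).comp_injective Sum.inr_injective).memLp_sum
    (hT.indepFun_state_fresh hS hk)
    (fun l => (continuous_weightNoise k (.inr l)).measurable)
    fun l => hT.memLp_weightNoise k (.inr l)
  exact h

theorem Lawful.integral_norm_sq_I2 (hS : S.Admissible) (hT : T.Lawful P) (hk : k ∈ S.dataIdx) :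
    ∫ ω, ‖T.I2 P k ω‖ ^ 2 ∂P
      = ∑ l, S.Ed * ∫ ω, ‖T.weightPhase P k (.inl l) (T.phase ω)‖ ^ 2 ∂P := by
  simp only [I2_eq_sum hk]
  have hm : ∀ l : S.dataIdx, Measurable fun s : (Fin S.K → ℝ) × (symIcc (S.Ghat + S.U) → ℂ) =>
      T.weightPhase P k (.inl l) s.1 := fun l => measurable_weightPhase_fst k (.inl l)
  have hb : ∀ l : S.dataIdx, MemLp (fun ω => T.weightPhase P k (.inl l) (T.state ω).1) 2 P :=
    fun l => hT.memLp_weightPhase hS k (.inl l)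
  have h := ((hT.whiteFamily_fresh hS k).comp_injective Sum.inl_injective).integral_norm_sq_sum
    (hT.indepFun_state_fresh hS hk) hm hb
  exact h

theorem Lawful.integral_norm_sq_Z2 (hS : S.Admissible) (hT : T.Lawful P) (hk : k ∈ S.dataIdx) :
    ∫ ω, ‖T.Z2 k ω‖ ^ 2 ∂P
      = ∑ l, S.Ed * ∫ ω, ‖weightNoise S k (.inl l) (T.state ω)‖ ^ 2 ∂P := by
  simp only [Z2_eq_sum k]
  have h := ((hT.whiteFamily_fresh hS k).comp_injective Sum.inl_injective).integral_norm_sq_sum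
    (hT.indepFun_state_fresh hS hk)
    (fun l => (continuous_weightNoise k (.inl l)).measurable)
    fun l => hT.memLp_weightNoise k (.inl l)
  exact h

theorem Lawful.integral_norm_sq_Z3 (hS : S.Admissible) (hT : T.Lawful P) (hk : k ∈ S.dataIdx) :
    ∫ ω, ‖T.Z3 P k ω‖ ^ 2 ∂P
      = ∑ u, S.N₀ * ∫ ω, ‖T.weightPhase P k (.inr u) (T.phase ω)‖ ^ 2 ∂P := by
  simp only [Z3_eq_sum k]
  have hm : ∀ l : symIcc S.U, Measurable fun s : (Fin S.K → ℝ) × (symIcc (S.Ghat + S.U) → ℂ) =>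
      T.weightPhase P k (.inr l) s.1 := fun l => measurable_weightPhase_fst k (.inr l)
  have hb : ∀ l : symIcc S.U, MemLp (fun ω => T.weightPhase P k (.inr l) (T.state ω).1) 2 P :=
    fun l => hT.memLp_weightPhase hS k (.inr l)
  have h := ((hT.whiteFamily_fresh hS k).comp_injective Sum.inr_injective).integral_norm_sq_sum
    (hT.indepFun_state_fresh hS hk) hm hb
  exact h

theorem Lawful.integral_norm_sq_Z4 (hS : S.Admissible) (hT : T.Lawful P) (hk : k ∈ S.dataIdx) :
    ∫ ω, ‖T.Z4 k ω‖ ^ 2 ∂P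
      = ∑ u, S.N₀ * ∫ ω, ‖weightNoise S k (.inr u) (T.state ω)‖ ^ 2 ∂P := by
  simp only [Z4_eq_sum k]
  have h := ((hT.whiteFamily_fresh hS k).comp_injective Sum.inr_injective).integral_norm_sq_sum
    (hT.indepFun_state_fresh hS hk)
    (fun l => (continuous_weightNoise k (.inr l)).measurable)
    fun l => hT.memLp_weightNoise k (.inr l)
  exact h

/-- `I1 + Z1` is the part free of fresh variables, `I2 + Z2` carries the data and `Z3 + Z4` the
channel noise; within each pair the first weight comes from the phase noise and the second from the
estimation noise. -/
theorem distortion_eq_affine (hk : k ∈ S.dataIdx) (ω : Ω) :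
    T.Ihat P k ω + T.Zhat P k ω = (baseGain S k (T.state ω).1 + baseNoise S k (T.state ω))
      + ∑ i, freshCoord S i (T.fresh k ω) *
        (T.weightPhase P k i (T.state ω).1 + weightNoise S k i (T.state ω)) := by
  have h1 : T.I1 P k ω = baseGain S k (T.state ω).1 := I1_eq T P k ω
  have h2 : T.Z1 k ω = baseNoise S k (T.state ω) := Z1_eq T k ω
  simp only [mul_add, Finset.sum_add_distrib, Fintype.sum_sum_type]
  rw [← I2_eq_sum hk, ← Z2_eq_sum, ← Z3_eq_sum, ← Z4_eq_sum, ← h1, ← h2, Ihat, Zhat]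
  ring

/-- Two layers of orthogonality: over the fresh variables given the state, then between phase part
and estimation-noise part of each weight. All six components are thus uncorrelated and nothing is
lost by bounding them separately. -/
theorem Lawful.integral_norm_sq_distortion (hS : S.Admissible) (hT : T.Lawful P)
    (hk : k ∈ S.dataIdx) :
    ∫ ω, ‖T.Ihat P k ω + T.Zhat P k ω‖ ^ 2 ∂P = ∫ ω, ‖T.I1 P k ω‖ ^ 2 ∂P
      + ∫ ω, ‖T.I2 P k ω‖ ^ 2 ∂P + ∫ ω, ‖T.Z1 k ω‖ ^ 2 ∂P + ∫ ω, ‖T.Z2 k ω‖ ^ 2 ∂P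
      + ∫ ω, ‖T.Z3 P k ω‖ ^ 2 ∂P + ∫ ω, ‖T.Z4 k ω‖ ^ 2 ∂P := by
  have hA : ∫ ω, ‖baseGain S k (T.state ω).1 + baseNoise S k (T.state ω)‖ ^ 2 ∂P
      = ∫ ω, ‖T.I1 P k ω‖ ^ 2 ∂P + ∫ ω, ‖T.Z1 k ω‖ ^ 2 ∂P := by
    have h1 : T.I1 P k = fun ω => baseGain S k (T.phase ω) := funext (I1_eq T P k)
    have h2 : T.Z1 k = fun ω => baseNoise S k (T.state ω) := funext (Z1_eq T k)
    have m1 := hT.memLp_I1 hS k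
    have m2 := hT.memLp_Z1 k
    rw [h1] at m1 ⊢
    rw [h2] at m2 ⊢
    refine integral_norm_sq_add m1 m2 ?_
    have e : ∀ ω, baseGain S k (T.phase ω) * conj (baseNoise S k (T.state ω))
        = ∑ g ∈ symIcc S.Ghat, conj (S.β 0 * S.p g) * (baseGain S k (T.phase ω) *
          conj (S.combGain (T.phase ω) k (fun u => conj (S.estNoise (T.noiseVec ω) u)) g)) := by
      intro ω
      simp only [baseNoise, map_mul, map_sum, Finset.mul_sum, state]
      exact Finset.sum_congr rfl fun g _ => by ring
    refine (integral_congr_ae (Filter.Eventually.of_forall e)).trans ?_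
    have hint : ∀ g, Integrable (fun ω => conj (S.β 0 * S.p g) * (baseGain S k (T.phase ω) *
        conj (S.combGain (T.phase ω) k (fun u => conj (S.estNoise (T.noiseVec ω) u)) g))) P :=
      fun g => (m1.integrable_mul (hT.memLp_combGain_estNoise k g).star).const_mul _
    rw [integral_finsetSum _ fun g _ => hint g]
    refine Finset.sum_eq_zero fun g _ => ?_
    rw [integral_const_mul, hT.integral_phase_mul_conj_combGain (continuous_baseGain k) m1,
      mul_zero]
  have hB : ∀ i, ∫ ω, ‖T.weightPhase P k i (T.state ω).1 + weightNoise S k i (T.state ω)‖ ^ 2 ∂P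
      = ∫ ω, ‖T.weightPhase P k i (T.phase ω)‖ ^ 2 ∂P
        + ∫ ω, ‖weightNoise S k i (T.state ω)‖ ^ 2 ∂P := fun i =>
    integral_norm_sq_add (hT.memLp_weightPhase hS k i) (hT.memLp_weightNoise k i)
      (hT.integral_weightPhase_mul_conj_weightNoise hS k i)
  have hN := (hT.whiteFamily_fresh hS k).integral_norm_sq_affine (hT.indepFun_state_fresh hS hk)
    (a := fun s => baseGain S k s.1 + baseNoise S k s)
    (b := fun i s => T.weightPhase P k i s.1 + weightNoise S k i s)
    (((continuous_baseGain k).comp continuous_fst).add (continuous_baseNoise k)).measurable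
    (by
      have := (hT.memLp_I1 hS k).add (hT.memLp_Z1 k)
      rw [funext (I1_eq T P k), funext (Z1_eq T k)] at this
      exact this)
    (fun i => (measurable_weightPhase_fst k i).add (continuous_weightNoise k i).measurable)
    fun i => (hT.memLp_weightPhase hS k i).add (hT.memLp_weightNoise k i)
  simp only [distortion_eq_affine hk]
  rw [hN, hA]
  simp only [hB, Fintype.sum_sum_type, mul_add, Finset.sum_add_distrib]
  rw [hT.integral_norm_sq_I2 hS hk, hT.integral_norm_sq_Z2 hS hk, hT.integral_norm_sq_Z3 hS hk,
    hT.integral_norm_sq_Z4 hS hk]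
  simp only [freshEnergy, Sum.elim_inl, Sum.elim_inr]
  ring

/-- The distortion is uncorrelated with the wanted symbol. -/
theorem Lawful.integral_distortion_mul_conj (hS : S.Admissible) (hT : T.Lawful P)
    (hk : k ∈ S.dataIdx) :
    ∫ ω, (T.Ihat P k ω + T.Zhat P k ω) * conj (T.x k ω) ∂P = 0 := by
  have hN := (hT.whiteFamily_fresh hS k).integral_affine_mul_conj (hT.indepFun_state_fresh hS hk)
    (a := fun s => baseGain S k s.1 + baseNoise S k s)
    (b := fun i s => T.weightPhase P k i s.1 + weightNoise S k i s)
    (((continuous_baseGain k).comp continuous_fst).add (continuous_baseNoise k)).measurable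
    (by
      have := (hT.memLp_I1 hS k).add (hT.memLp_Z1 k)
      rw [funext (I1_eq T P k), funext (Z1_eq T k)] at this
      exact this)
    (fun i => (measurable_weightPhase_fst k i).add (continuous_weightNoise k i).measurable)
    (fun i => (hT.memLp_weightPhase hS k i).add (hT.memLp_weightNoise k i))
    (.inl ⟨k, hk⟩)
  simp only [distortion_eq_affine hk]
  refine hN.trans ?_
  have i1 : Integrable (fun ω => T.weightPhase P k (.inl ⟨k, hk⟩) (T.state ω).1) P :=
    (hT.memLp_weightPhase hS k (.inl ⟨k, hk⟩)).integrable one_le_two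
  have i2 := (hT.memLp_weightNoise k (.inl ⟨k, hk⟩)).integrable one_le_two
  -- The residual gain of `x_k` has mean zero precisely because `Shat` takes the whole mean gain.
  have z1 : ∫ ω, T.weightPhase P k (.inl ⟨k, hk⟩) (T.state ω).1 ∂P = 0 := by
    simp only [weightPhase, Sum.elim_inl, if_true, state]
    rw [integral_const_mul, integral_sub
      ((hT.memLp_combGain_combCoef hS k k).integrable one_le_two) (integrable_const _),
      hT.integral_combGain_combCoef]
    simp
  have z2 : ∫ ω, weightNoise S k (.inl ⟨k, hk⟩) (T.state ω) ∂P = 0 := by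
    have h := hT.integral_phase_mul_conj_combGain (f := fun _ => 1) continuous_const
      (memLp_const _) k k
    simp only [one_mul] at h
    rw [integral_conj, map_eq_zero] at h
    simp only [weightNoise, Sum.elim_inl, state]
    rw [integral_const_mul, h, mul_zero]
  rw [integral_add i1 i2, z1, z2]
  simp

end Signals

namespace Signals

variable {S : OFDM} {Ω : Type*} [MeasurableSpace Ω] {T : Signals S Ω} {P : Measure Ω}
  [IsProbabilityMeasure P] {k : ℤ}

/-! ### Bounds on the components -/

theorem signalEnergy_eq (k : ℤ) : T.signalEnergy P k = ‖T.gain P k‖ ^ 2 * S.Ed := by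
  have : ‖1 + conj (T.chi P)‖ = ‖1 + T.chi P‖ := by
    rw [← RCLike.norm_conj (1 + T.chi P), map_add, map_one]
  simp only [signalEnergy, gain, norm_mul, RCLike.norm_conj, this, Complex.norm_real,
    Real.norm_eq_abs, mul_pow, sq_abs]
  ring

theorem Lawful.memLp_Shat (hT : T.Lawful P) (hk : k ∈ S.dataIdx) : MemLp (T.Shat P k) 2 P := by
  rw [funext (Shat_eq T P k)]
  exact (hT.sq_x k hk).const_mul _

theorem Lawful.integral_norm_sq_Shat (hT : T.Lawful P) (hk : k ∈ S.dataIdx) :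
    ∫ ω, ‖T.Shat P k ω‖ ^ 2 ∂P = T.signalEnergy P k := by
  simp only [Shat_eq, norm_mul, mul_pow]
  rw [integral_const_mul, hT.energy_x k hk, signalEnergy_eq]

/-- Cauchy-Schwarz twice: over `g`, producing `Er`, and over `u`, producing `∑ |c_u|²`. Since `c`
and `Ω` depend on the same phase noise, the pointwise bound `1 + Υ` is taken before averaging. -/
theorem Lawful.integral_norm_sq_I1_le (hS : S.Admissible) (hT : T.Lawful P) (k : ℤ) :
    ∫ ω, ‖T.I1 P k ω‖ ^ 2 ∂P ≤ T.boundI1 P k := by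
  have hEr : 0 ≤ S.Er := Finset.sum_nonneg fun _ _ => by positivity
  have hpt : ∀ ω, ‖T.I1 P k ω‖ ^ 2 ≤ ∑ g ∈ symIcc S.Ghat, (1 + S.Upsilon) * S.Er * ‖S.β 0‖ ^ 4 *
      ∑ u ∈ symIcc S.U, ‖T.Om (k - g + u) ω‖ ^ 2 := by
    intro ω
    have h1 : ∀ g, ‖S.combGain (T.phase ω) k (S.combCoef (T.phase ω)) g‖ ^ 2
        ≤ (1 + S.Upsilon) * ∑ u ∈ symIcc S.U, ‖T.Om (k - g + u) ω‖ ^ 2 := by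
      intro g
      refine (norm_sum_mul_sq_le _ _ _).trans ?_
      rw [← Finset.sum_coe_sort (symIcc S.U) fun u => ‖T.Om (k - g + u) ω‖ ^ 2]
      refine mul_le_mul (hS.sum_norm_sq_combCoef_le _) (le_of_eq ?_) (by positivity)
        (add_nonneg zero_le_one S.Upsilon_nonneg)
      refine Finset.sum_congr rfl fun u _ => ?_
      rw [Om_eq, sub_add_eq_add_sub]
    rw [I1_eq, norm_mul, mul_pow, Complex.norm_real, Real.norm_eq_abs,
      abs_of_nonneg (by positivity)]
    calc _ ≤ (‖S.β 0‖ ^ 2) ^ 2 * (S.Er * ∑ g ∈ symIcc S.Ghat,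
          ‖S.combGain (T.phase ω) k (S.combCoef (T.phase ω)) g‖ ^ 2) := by
          gcongr
          exact norm_sum_mul_sq_le _ _ _
      _ ≤ (‖S.β 0‖ ^ 2) ^ 2 * (S.Er * ∑ g ∈ symIcc S.Ghat,
          (1 + S.Upsilon) * ∑ u ∈ symIcc S.U, ‖T.Om (k - g + u) ω‖ ^ 2) := by
          gcongr with g
          exact h1 g
      _ = _ := by
          rw [Finset.mul_sum, Finset.mul_sum]
          exact Finset.sum_congr rfl fun g _ => by ring
  have hint : ∀ g : ℤ, Integrable (fun ω => ∑ u ∈ symIcc S.U, ‖T.Om (k - g + u) ω‖ ^ 2) P :=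
    fun g => integrable_finsetSum _ fun u _ => hT.integrable_norm_sq_Om _
  refine (integral_mono ((hT.memLp_I1 hS k).integrable_norm_pow two_ne_zero)
    (integrable_finsetSum _ fun g _ => (hint g).const_mul _) hpt).trans (le_of_eq ?_)
  rw [integral_finsetSum _ fun g _ => (hint g).const_mul _, boundI1]
  refine Finset.sum_congr rfl fun g _ => ?_
  rw [integral_const_mul, integral_finsetSum _ fun u _ => hT.integrable_norm_sq_Om _, mu_eq_add]

/-- The total energy of the combined gains over the data sub-carriers. -/
theorem sum_dataIdx_norm_sq_combGain_le (hS : S.Admissible) (t : Fin S.K → ℝ) (k : ℤ)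
    (c : symIcc S.U → ℂ) :
    ∑ l : S.dataIdx, ‖S.combGain t k c l‖ ^ 2 ≤ ∑ u, ‖c u‖ ^ 2 := by
  rw [← hS.sum_norm_sq_combGain t k c,
    Finset.sum_coe_sort S.dataIdx fun l => ‖S.combGain t k c l‖ ^ 2]
  exact Finset.sum_le_sum_of_subset_of_nonneg S.dataIdx_subset_carriers
    fun _ _ _ => by positivity

theorem norm_sq_one_add_conj_chi_mul_mu :
    ‖(1 + conj (T.chi P)) * (T.mu P 0 S.U : ℂ)‖ ^ 2
      = ‖1 + T.chi P‖ ^ 2 * T.mu P 0 S.U ^ 2 := by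
  have : ‖1 + conj (T.chi P)‖ = ‖1 + T.chi P‖ := by
    rw [← RCLike.norm_conj (1 + T.chi P), map_add, map_one]
  rw [norm_mul, this, Complex.norm_real, mul_pow, Real.norm_eq_abs, sq_abs]

theorem integral_norm_sq_sub_mean {f : Ω → ℂ} (hf : MemLp f 2 P) {m : ℂ}
    (hm : ∫ ω, f ω ∂P = m) :
    ∫ ω, ‖f ω - m‖ ^ 2 ∂P = ∫ ω, ‖f ω‖ ^ 2 ∂P - ‖m‖ ^ 2 := by
  have hz : ∫ ω, (f ω - m) * conj m ∂P = 0 := by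
    rw [integral_mul_const, integral_sub (hf.integrable one_le_two) (integrable_const _), hm]
    simp
  have := integral_norm_sq_add (hf.sub (memLp_const m)) (memLp_const m) hz
  simp only [Pi.sub_apply, sub_add_cancel, integral_const, probReal_univ, one_smul] at this
  linarith

/-- The energy of the residual gain of data sub-carrier `l`, the mean gain being removed. -/
def residualGain (T : Signals S Ω) (P : Measure Ω) (k : ℤ) (l : S.dataIdx) : ℝ :=
  ∫ ω, ‖S.combGain (T.phase ω) k (S.combCoef (T.phase ω)) l
    - if (l : ℤ) = k then (1 + conj (T.chi P)) * (T.mu P 0 S.U : ℂ) else 0‖ ^ 2 ∂P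

theorem residualGain_nonneg (l : S.dataIdx) : 0 ≤ T.residualGain P k l :=
  integral_nonneg fun _ => by positivity

theorem Lawful.residualGain_eq (hS : S.Admissible) (hT : T.Lawful P) (l : S.dataIdx) :
    T.residualGain P k l
      = ∫ ω, ‖S.combGain (T.phase ω) k (S.combCoef (T.phase ω)) l‖ ^ 2 ∂P
        - if (l : ℤ) = k then ‖1 + T.chi P‖ ^ 2 * T.mu P 0 S.U ^ 2 else 0 := by
  rw [residualGain]
  split_ifs with hl
  · rw [hl, integral_norm_sq_sub_mean (hT.memLp_combGain_combCoef hS k k)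
      (hT.integral_combGain_combCoef k), norm_sq_one_add_conj_chi_mul_mu]
  · simp only [sub_zero]

/-- Parseval over the carriers, with the carriers outside the data discarded. -/
theorem Lawful.sum_integral_norm_sq_combGain_le (hS : S.Admissible) (hT : T.Lawful P) (k : ℤ) :
    ∑ l : S.dataIdx, ∫ ω, ‖S.combGain (T.phase ω) k (S.combCoef (T.phase ω)) l‖ ^ 2 ∂P
      ≤ T.coefEnergyBound P := by
  refine le_trans ?_ hT.sum_integral_norm_sq_combCoef_le
  have iG : ∀ l : S.dataIdx, Integrable
      (fun ω => ‖S.combGain (T.phase ω) k (S.combCoef (T.phase ω)) l‖ ^ 2) P := fun l =>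
    (hT.memLp_combGain_combCoef hS k l).integrable_norm_pow two_ne_zero
  have ic : ∀ u, Integrable (fun ω => ‖S.combCoef (T.phase ω) u‖ ^ 2) P := fun u =>
    (hT.memLp_combCoef hS u).integrable_norm_pow two_ne_zero
  rw [← integral_finsetSum _ fun l _ => iG l, ← integral_finsetSum _ fun u _ => ic u]
  exact integral_mono (integrable_finsetSum _ fun l _ => iG l)
    (integrable_finsetSum _ fun u _ => ic u) fun ω => sum_dataIdx_norm_sq_combGain_le hS _ k _

theorem Lawful.sum_residualGain_le (hS : S.Admissible) (hT : T.Lawful P) (hk : k ∈ S.dataIdx) :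
    ∑ l, T.residualGain P k l
      ≤ T.coefEnergyBound P - ‖1 + T.chi P‖ ^ 2 * T.mu P 0 S.U ^ 2 := by
  simp only [hT.residualGain_eq hS, Finset.sum_sub_distrib]
  have : ∑ l : S.dataIdx, (if (l : ℤ) = k then ‖1 + T.chi P‖ ^ 2 * T.mu P 0 S.U ^ 2 else 0)
      = ‖1 + T.chi P‖ ^ 2 * T.mu P 0 S.U ^ 2 := by
    rw [Finset.sum_coe_sort S.dataIdx
      fun l => if l = k then ‖1 + T.chi P‖ ^ 2 * T.mu P 0 S.U ^ 2 else 0,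
      Finset.sum_ite_eq' S.dataIdx k, if_pos hk]
  rw [this]
  exact sub_le_sub_right (hT.sum_integral_norm_sq_combGain_le hS k) _

/-- `|β_l|` is replaced by `betaBar` on the nonnegative residual gains, before the squared mean is
subtracted; the subtracted term then carries `betaBar` as well. -/
theorem Lawful.integral_norm_sq_I2_le (hS : S.Admissible) (hT : T.Lawful P)
    (hk : k ∈ S.dataIdx) : ∫ ω, ‖T.I2 P k ω‖ ^ 2 ∂P ≤ T.boundI2 P := by
  have hEd := hS.Ed_pos.le
  rw [hT.integral_norm_sq_I2 hS hk, boundI2]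
  calc _ = ∑ l : S.dataIdx, S.Ed * ((‖S.β 0‖ * ‖S.β l‖) ^ 2 * T.residualGain P k l) := by
        refine Finset.sum_congr rfl fun l _ => ?_
        simp only [weightPhase, Sum.elim_inl, norm_mul, RCLike.norm_conj, mul_pow]
        rw [integral_const_mul, residualGain]
    _ ≤ ∑ l : S.dataIdx, S.Ed * ((‖S.β 0‖ * S.betaBar) ^ 2 * T.residualGain P k l) := by
        refine Finset.sum_le_sum fun l _ => ?_
        have := S.norm_le_betaBar (S.dataIdx_subset_carriers l.2)
        have := T.residualGain_nonneg (P := P) (k := k) l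
        gcongr
    _ = (‖S.β 0‖ * S.betaBar) ^ 2 * S.Ed * ∑ l, T.residualGain P k l := by
        rw [Finset.mul_sum]
        exact Finset.sum_congr rfl fun l _ => by ring
    _ ≤ _ := by
        gcongr
        exact hT.sum_residualGain_le hS hk

/-- After Cauchy-Schwarz the majorant is a function of the channel noise times a function of the
phase noise, whose means multiply: `N₀ (2U + 1)` from the projection and `μ(k, Ghat + U)` from the
phase noise. -/
theorem Lawful.integral_norm_sq_Z1_le (hS : S.Admissible) (hT : T.Lawful P) (k : ℤ) :
    ∫ ω, ‖T.Z1 k ω‖ ^ 2 ∂P ≤ T.boundZ1 P k := by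
  set F : (symIcc (S.Ghat + S.U) → ℂ) → ℝ :=
    fun V => ∑ v, ‖(S.Pmat *ᵥ S.estNoise V) v‖ ^ 2 with hF
  set H : (Fin S.K → ℝ) → ℝ :=
    fun t => ∑ v ∈ symIcc (S.Ghat + S.U), ‖S.phaseCoef t (k - v)‖ ^ 2 with hH
  have hFm : Measurable F := by
    have : Continuous F := by
      simp only [hF, mulVec, dotProduct]
      have := S.continuous_estNoise
      fun_prop
    exact this.measurable
  have hHm : Measurable H := by
    have : Continuous H := by
      have := S.continuous_phaseCoef
      simp only [hH]; fun_prop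
    exact this.measurable
  have iF' : ∀ v, Integrable (fun ω => ‖(S.Pmat *ᵥ S.estNoise (T.noiseVec ω)) v‖ ^ 2) P := by
    intro v
    simp only [OFDM.estNoise, mulVec_mulVec]
    exact (hT.memLp_mulVec_noiseVec _ v).integrable_norm_pow two_ne_zero
  have iF : Integrable (fun ω => F (T.noiseVec ω)) P := integrable_finsetSum _ fun v _ => iF' v
  have iH : Integrable (fun ω => H (T.phase ω)) P :=
    integrable_finsetSum _ fun v _ => hT.integrable_norm_sq_Om (k - v)
  have eF : ∫ ω, F (T.noiseVec ω) ∂P = S.N₀ * (2 * S.U + 1) := by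
    rw [← hT.sum_integral_norm_sq_Pmat_estNoise hS, ← integral_finsetSum _ fun v _ => iF' v]
  have eH : ∫ ω, H (T.phase ω) ∂P = T.mu P k (S.Ghat + S.U) := by
    rw [mu_eq_sub, ← integral_finsetSum _ fun v _ => hT.integrable_norm_sq_Om (k - v)]
    rfl
  have hi := (hT.indepFun_comp_phase_noiseVec hHm hFm).symm
  have hprod := hi.integral_fun_mul_eq_mul_integral iF.aestronglyMeasurable iH.aestronglyMeasurable
  have iFH : Integrable (fun ω => F (T.noiseVec ω) * H (T.phase ω)) P := hi.integrable_mul iF iH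
  calc _ ≤ ∫ ω, ‖S.β 0‖ ^ 2 * (F (T.noiseVec ω) * H (T.phase ω)) ∂P := by
        refine integral_mono ((hT.memLp_Z1 k).integrable_norm_pow two_ne_zero)
          (iFH.const_mul _) fun ω => ?_
        simp only
        rw [Z1_eq, norm_mul, mul_pow]
        gcongr
        exact hS.norm_sq_sum_combGain_le _ _ _
    _ = _ := by
        rw [integral_const_mul, hprod, eF, eH, boundZ1]
        ring

theorem Lawful.integral_norm_sq_Z2_le (hS : S.Admissible) (hT : T.Lawful P)
    (hk : k ∈ S.dataIdx) : ∫ ω, ‖T.Z2 k ω‖ ^ 2 ∂P ≤ boundZ2 S := by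
  have hEd := hS.Ed_pos.le
  have iG : ∀ l : S.dataIdx, Integrable (fun ω => ‖S.combGain (T.phase ω) k
      (fun u => conj (S.estNoise (T.noiseVec ω) u)) l‖ ^ 2) P := fun l =>
    (hT.memLp_combGain_estNoise k l).integrable_norm_pow two_ne_zero
  have iE : ∀ u, Integrable (fun ω => ‖S.estNoise (T.noiseVec ω) u‖ ^ 2) P := fun u =>
    (hT.memLp_estNoise u).integrable_norm_pow two_ne_zero
  have hsum : ∑ l : S.dataIdx, ∫ ω, ‖S.combGain (T.phase ω) k
      (fun u => conj (S.estNoise (T.noiseVec ω) u)) l‖ ^ 2 ∂P ≤ S.N₀ * (S.Rp⁻¹.trace).re := by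
    rw [← hT.sum_integral_norm_sq_estNoise hS, ← integral_finsetSum _ fun l _ => iG l,
      ← integral_finsetSum _ fun u _ => iE u]
    refine integral_mono (integrable_finsetSum _ fun l _ => iG l)
      (integrable_finsetSum _ fun u _ => iE u) fun ω => ?_
    refine (sum_dataIdx_norm_sq_combGain_le hS _ k _).trans (le_of_eq ?_)
    simp only [RCLike.norm_conj]
  rw [hT.integral_norm_sq_Z2 hS hk, boundZ2]
  calc _ = ∑ l : S.dataIdx, S.Ed * (‖S.β l‖ ^ 2 * ∫ ω, ‖S.combGain (T.phase ω) k
      (fun u => conj (S.estNoise (T.noiseVec ω) u)) l‖ ^ 2 ∂P) := by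
        refine Finset.sum_congr rfl fun l _ => ?_
        simp only [weightNoise, Sum.elim_inl, norm_mul, mul_pow, state]
        rw [integral_const_mul]
    _ ≤ ∑ l : S.dataIdx, S.Ed * (S.betaBar ^ 2 * ∫ ω, ‖S.combGain (T.phase ω) k
      (fun u => conj (S.estNoise (T.noiseVec ω) u)) l‖ ^ 2 ∂P) := by
        refine Finset.sum_le_sum fun l _ => ?_
        have := S.norm_le_betaBar (S.dataIdx_subset_carriers l.2)
        gcongr
    _ = S.Ed * S.betaBar ^ 2 * ∑ l : S.dataIdx, ∫ ω, ‖S.combGain (T.phase ω) k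
      (fun u => conj (S.estNoise (T.noiseVec ω) u)) l‖ ^ 2 ∂P := by
        rw [Finset.mul_sum]
        exact Finset.sum_congr rfl fun l _ => by ring
    _ ≤ S.Ed * S.betaBar ^ 2 * (S.N₀ * (S.Rp⁻¹.trace).re) := by gcongr
    _ = _ := by ring

theorem Lawful.integral_norm_sq_Z3_le (hS : S.Admissible) (hT : T.Lawful P)
    (hk : k ∈ S.dataIdx) : ∫ ω, ‖T.Z3 P k ω‖ ^ 2 ∂P ≤ T.boundZ3 P := by
  have hN := hS.N₀_pos.le
  rw [hT.integral_norm_sq_Z3 hS hk, boundZ3]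
  calc _ = ‖S.β 0‖ ^ 2 * S.N₀ * ∑ u, ∫ ω, ‖S.combCoef (T.phase ω) u‖ ^ 2 ∂P := by
        rw [Finset.mul_sum]
        refine Finset.sum_congr rfl fun u _ => ?_
        simp only [weightPhase, Sum.elim_inr, norm_mul, RCLike.norm_conj, mul_pow]
        rw [integral_const_mul]
        ring
    _ ≤ ‖S.β 0‖ ^ 2 * S.N₀ * T.coefEnergyBound P := by
        gcongr
        exact hT.sum_integral_norm_sq_combCoef_le
    _ = _ := by ring

/-- No estimate is made here; the exact value also serves as a positive lower bound for the
distortion energy. -/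
theorem Lawful.integral_norm_sq_Z4_eq (hS : S.Admissible) (hT : T.Lawful P)
    (hk : k ∈ S.dataIdx) : ∫ ω, ‖T.Z4 k ω‖ ^ 2 ∂P = boundZ4 S := by
  rw [hT.integral_norm_sq_Z4 hS hk, ← Finset.mul_sum]
  simp only [weightNoise, Sum.elim_inr, RCLike.norm_conj, state]
  rw [hT.sum_integral_norm_sq_estNoise hS, boundZ4]
  ring

theorem Lawful.integral_norm_sq_distortion_pos (hS : S.Admissible) (hT : T.Lawful P)
    (hk : k ∈ S.dataIdx) : 0 < ∫ ω, ‖T.Ihat P k ω + T.Zhat P k ω‖ ^ 2 ∂P := by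
  have hnn : ∀ f : Ω → ℂ, 0 ≤ ∫ ω, ‖f ω‖ ^ 2 ∂P := fun f => integral_nonneg fun _ => by positivity
  have h4 : 0 < ∫ ω, ‖T.Z4 k ω‖ ^ 2 ∂P := by
    rw [hT.integral_norm_sq_Z4_eq hS hk, boundZ4]
    exact mul_pos (S.Rp_inv_trace_pos hS) (pow_pos hS.N₀_pos 2)
  rw [hT.integral_norm_sq_distortion hS hk]
  linarith [hnn (T.I1 P k), hnn (T.I2 P k), hnn (T.Z1 k), hnn (T.Z2 k), hnn (T.Z3 P k)]

theorem Lawful.integral_norm_sq_distortion_le (hS : S.Admissible) (hT : T.Lawful P)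
    (hk : k ∈ S.dataIdx) : ∫ ω, ‖T.Ihat P k ω + T.Zhat P k ω‖ ^ 2 ∂P
      ≤ (T.boundI1 P k + T.boundI2 P)
        + (T.boundZ1 P k + boundZ2 S + T.boundZ3 P + boundZ4 S) := by
  rw [hT.integral_norm_sq_distortion hS hk]
  linarith [hT.integral_norm_sq_I1_le hS k, hT.integral_norm_sq_I2_le hS hk,
    hT.integral_norm_sq_Z1_le hS k, hT.integral_norm_sq_Z2_le hS hk,
    hT.integral_norm_sq_Z3_le hS hk, (hT.integral_norm_sq_Z4_eq hS hk).le]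

theorem signalEnergy_nonneg (hS : S.Admissible) (k : ℤ) : 0 ≤ T.signalEnergy P k := by
  rw [signalEnergy_eq]
  exact mul_nonneg (by positivity) hS.Ed_pos.le

theorem Lawful.GammaLB_nonneg (hS : S.Admissible) (hT : T.Lawful P) (hk : k ∈ S.dataIdx) :
    0 ≤ T.GammaLB P k :=
  div_nonneg (signalEnergy_nonneg hS k)
    ((hT.integral_norm_sq_distortion_pos hS hk).le.trans (hT.integral_norm_sq_distortion_le hS hk))

theorem Lawful.GammaLB_le_SINR (hS : S.Admissible) (hT : T.Lawful P) (hk : k ∈ S.dataIdx) :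
    T.GammaLB P k ≤ T.SINR P k := by
  rw [GammaLB, SINR, hT.integral_norm_sq_Shat hk]
  exact div_le_div_of_nonneg_left (signalEnergy_nonneg hS k)
    (hT.integral_norm_sq_distortion_pos hS hk) (hT.integral_norm_sq_distortion_le hS hk)

/-! ### Throughput -/

/-- The error of the linear minimum mean-square-error estimate. -/
theorem integral_norm_sq_sub_lmmse {x N : Ω → ℂ} (hx : MemLp x 2 P) (hN : MemLp N 2 P)
    (hxN : ∫ ω, N ω * conj (x ω) ∂P = 0) {E ν : ℝ} (hE : 0 < E) (hν : 0 < ν)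
    (hxE : ∫ ω, ‖x ω‖ ^ 2 ∂P = E) (hNν : ∫ ω, ‖N ω‖ ^ 2 ∂P = ν) (a : ℂ) :
    ∫ ω, ‖x ω - conj a * ((E / (‖a‖ ^ 2 * E + ν) : ℝ) : ℂ) * (a * x ω + N ω)‖ ^ 2 ∂P
      = E / (1 + ‖a‖ ^ 2 * E / ν) := by
  have hD : 0 < ‖a‖ ^ 2 * E + ν := by positivity
  set c : ℝ := E / (‖a‖ ^ 2 * E + ν) with hc
  have e : ∀ ω, x ω - conj a * (c : ℂ) * (a * x ω + N ω)
      = -(conj a * (c : ℂ)) * N ω + ((1 - c * ‖a‖ ^ 2 : ℝ) : ℂ) * x ω := by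
    intro ω
    push_cast
    rw [← Complex.conj_mul']
    ring
  have hz : ∫ ω, -(conj a * (c : ℂ)) * N ω * conj (((1 - c * ‖a‖ ^ 2 : ℝ) : ℂ) * x ω) ∂P = 0 := by
    have : ∀ ω, -(conj a * (c : ℂ)) * N ω * conj (((1 - c * ‖a‖ ^ 2 : ℝ) : ℂ) * x ω)
        = -(conj a * (c : ℂ)) * ((1 - c * ‖a‖ ^ 2 : ℝ) : ℂ) * (N ω * conj (x ω)) := by
      intro ω
      rw [map_mul, Complex.conj_ofReal]
      ring
    simp only [this]
    rw [integral_const_mul, hxN, mul_zero]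
  simp only [e]
  rw [integral_norm_sq_add (hN.const_mul _) (hx.const_mul _) hz]
  simp only [norm_mul, mul_pow, integral_const_mul, hxE, hNν, norm_neg, RCLike.norm_conj,
    Complex.norm_real, Real.norm_eq_abs, sq_abs]
  rw [hc]
  -- With `D = |a|² E + ν` one has `1 - c |a|² = ν / D`, and the two energies add up to `E ν / D`.
  field_simp
  ring

theorem Lawful.measurable_Yhat_est (hS : S.Admissible) (hT : T.Lawful P) (k : ℤ) :
    Measurable fun ω => (T.Yhat k ω, T.est ω) := by
  have hOm : ∀ k, Measurable (T.Om k) := fun k =>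
    (S.continuous_phaseCoef k).measurable.comp hT.measurable_phase
  have hY : ∀ k, Measurable (T.Y k) := by
    intro k
    rw [funext (Y_eq T k)]
    refine ((Finset.measurable_fun_sum _ fun g _ => (hOm _).const_mul _).add
      (Finset.measurable_fun_sum _ fun l hl => ?_)).add (hT.measurable_W k)
    exact ((hT.meas_x l hl).const_mul _).mul (hOm _)
  have hest : ∀ u, Measurable fun ω => T.est ω u := by
    intro u
    simp only [est_eq T hS, What_eq]
    exact ((Complex.continuous_conj.measurable.comp ((S.continuous_combCoef u).measurable.comp
      hT.measurable_phase)).const_mul _).add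
      ((S.continuous_estNoise u).measurable.comp hT.measurable_noiseVec)
  refine Measurable.prodMk (Finset.measurable_fun_sum _ fun u _ => ?_)
    (measurable_pi_lambda _ hest)
  exact (Complex.continuous_conj.measurable.comp (hest u)).mul (hY _)

/-- The entropy of `x_k` is `log (π Ed) + 1`, and the conditional one is at most `log (π Ed / (1 +
SINR)) + 1`. The distortion need be neither Gaussian nor independent of `x_k`, only uncorrelated
with it. -/
theorem Lawful.log_one_add_GammaLB_le (hS : S.Admissible) (hT : T.Lawful P)
    (hG : T.GaussianData P) (hk : k ∈ S.dataIdx) :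
    ((Real.log (1 + T.GammaLB P k) : ℝ) : EReal) ≤ diffEntropy (T.x k) P
      - condDiffEntropy (T.x k) (fun ω => (T.Yhat k ω, T.est ω)) P := by
  set ν := ∫ ω, ‖T.Ihat P k ω + T.Zhat P k ω‖ ^ 2 ∂P with hν
  have hνpos : 0 < ν := hT.integral_norm_sq_distortion_pos hS hk
  have hEd := hS.Ed_pos
  set a := T.gain P k with ha
  have hSINR : T.SINR P k = ‖a‖ ^ 2 * S.Ed / ν := by
    rw [SINR, hT.integral_norm_sq_Shat hk, signalEnergy_eq]
  have hS0 : 0 ≤ T.SINR P k := by rw [hSINR]; positivity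
  have hN : MemLp (fun ω => T.Ihat P k ω + T.Zhat P k ω) 2 P :=
    ((hT.memLp_I1 hS k).add (hT.memLp_I2 hS hk)).add
      ((((hT.memLp_Z1 k).add (hT.memLp_Z2 hS hk)).add (hT.memLp_Z3 hS hk)).add
        (hT.memLp_Z4 hS hk))
  have hmse := integral_norm_sq_sub_lmmse (hT.sq_x k hk) hN
    (hT.integral_distortion_mul_conj hS hk) hEd hνpos (hT.energy_x k hk) hν.symm a
  rw [← hSINR] at hmse
  have hspos : 0 < S.Ed / (1 + T.SINR P k) := by positivity
  have hcond := condDiffEntropy_le (X := T.x k) (Y := fun ω => (T.Yhat k ω, T.est ω)) (P := P)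
    (hT.meas_x k hk) (hT.measurable_Yhat_est hS k)
    -- The linear MMSE estimate with deterministic gain uses `Yhat_k` alone and ignores the channel
    -- and phase estimate, which is admissible since any estimate bounds the conditional entropy.
    (e := fun y => conj a * ((S.Ed / (‖a‖ ^ 2 * S.Ed + ν) : ℝ) : ℂ) * y.1) (by fun_prop) hspos
    (by
      rw [← hmse]
      refine integral_congr_ae (Filter.Eventually.of_forall fun ω => ?_)
      simp only
      rw [Yhat_eq T P hS hk, Shat_eq, ← ha, add_assoc])
  have hent := diffEntropy_of_map_eq_complexGaussian hEd (hT.meas_x k hk) (hG k hk)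
    (hT.energy_x k hk)
  rw [hent]
  refine le_trans ?_ (EReal.sub_le_sub le_rfl hcond)
  rw [← EReal.coe_sub, EReal.coe_le_coe_iff, ← mul_div_assoc,
    Real.log_div (by positivity) (by positivity)]
  have hlog : Real.log (1 + T.GammaLB P k) ≤ Real.log (1 + T.SINR P k) :=
    Real.log_le_log (by linarith [hT.GammaLB_nonneg hS hk])
      (by linarith [hT.GammaLB_le_SINR hS hk])
  linarith

theorem Lawful.le_throughput (hS : S.Admissible) (hT : T.Lawful P) (hG : T.GaussianData P) :
    ((1 / (S.K : ℝ) * ∑ k ∈ S.dataIdx, Real.log (1 + T.GammaLB P k) : ℝ) : EReal)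
      ≤ T.throughput P := by
  have hsum : ((∑ k ∈ S.dataIdx, Real.log (1 + T.GammaLB P k) : ℝ) : EReal)
      ≤ ∑ k ∈ S.dataIdx, (diffEntropy (T.x k) P
        - condDiffEntropy (T.x k) (fun ω => (T.Yhat k ω, T.est ω)) P) := by
    have hcoe : ((∑ k ∈ S.dataIdx, Real.log (1 + T.GammaLB P k) : ℝ) : EReal)
        = ∑ k ∈ S.dataIdx, ((Real.log (1 + T.GammaLB P k) : ℝ) : EReal) :=
      map_sum (⟨⟨Real.toEReal, EReal.coe_zero⟩, EReal.coe_add⟩ : ℝ →+ EReal) _ _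
    rw [hcoe]
    exact Finset.sum_le_sum fun k hk => hT.log_one_add_GammaLB_le hS hG hk
  rw [throughput, EReal.coe_mul]
  exact mul_le_mul_of_nonneg_left hsum (EReal.coe_nonneg.2 (by positivity))

end Signals

end

theorem mainTheorem3 {Ω : Type*} [MeasurableSpace Ω] (P : Measure Ω) [IsProbabilityMeasure P]
    (S : OFDM) (hS : S.Admissible) (T : Signals S Ω) (hT : T.Lawful P) :
    (∀ k ∈ S.dataIdx,
      (∀ ω, T.Yhat k ω = T.Shat P k ω + T.Ihat P k ω + T.Zhat P k ω) ∧
      (MemLp (T.Shat P k) 2 P ∧ MemLp (T.I1 P k) 2 P ∧ MemLp (T.I2 P k) 2 P ∧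
        MemLp (T.Z1 k) 2 P ∧ MemLp (T.Z2 k) 2 P ∧ MemLp (T.Z3 P k) 2 P ∧ MemLp (T.Z4 k) 2 P) ∧
      (∫ ω, ‖T.Shat P k ω‖ ^ 2 ∂P = T.signalEnergy P k ∧
        ∫ ω, ‖T.I1 P k ω‖ ^ 2 ∂P ≤ T.boundI1 P k ∧
        ∫ ω, ‖T.I2 P k ω‖ ^ 2 ∂P ≤ T.boundI2 P ∧
        ∫ ω, ‖T.Z1 k ω‖ ^ 2 ∂P ≤ T.boundZ1 P k ∧
        ∫ ω, ‖T.Z2 k ω‖ ^ 2 ∂P ≤ Signals.boundZ2 S ∧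
        ∫ ω, ‖T.Z3 P k ω‖ ^ 2 ∂P ≤ T.boundZ3 P ∧
        ∫ ω, ‖T.Z4 k ω‖ ^ 2 ∂P ≤ Signals.boundZ4 S) ∧
      0 < ∫ ω, ‖T.Ihat P k ω + T.Zhat P k ω‖ ^ 2 ∂P ∧
      T.GammaLB P k ≤ T.SINR P k) ∧
    (T.GaussianData P →
      ((1 / (S.K : ℝ) * ∑ k ∈ S.dataIdx, Real.log (1 + T.GammaLB P k) : ℝ) : EReal)
        ≤ T.throughput P) := by
  refine ⟨fun k hk => ⟨Signals.Yhat_eq T P hS hk, ⟨hT.memLp_Shat hk, hT.memLp_I1 hS k,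
    hT.memLp_I2 hS hk, hT.memLp_Z1 k, hT.memLp_Z2 hS hk, hT.memLp_Z3 hS hk, hT.memLp_Z4 hS hk⟩,
    ⟨hT.integral_norm_sq_Shat hk, hT.integral_norm_sq_I1_le hS k, hT.integral_norm_sq_I2_le hS hk,
      hT.integral_norm_sq_Z1_le hS k, hT.integral_norm_sq_Z2_le hS hk,
      hT.integral_norm_sq_Z3_le hS hk, (hT.integral_norm_sq_Z4_eq hS hk).le⟩,
    hT.integral_norm_sq_distortion_pos hS hk, hT.GammaLB_le_SINR hS hk⟩,
    fun hG => hT.le_throughput hS hG⟩
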